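/- **Theorem (Infinite to finite approximation error).** *Setting.* A dual pair $(V,W,\|\cdot\|)$ consists of a normed real vector space $V$, a real vector space $W$ and a bilinear form $\langle\cdot,\cdot\rangle$ on $V\times W$ that separates points, such that $\|w\|_*:=\sup_{\|v\|\le1}\langle v,w\rangle$ is finite for every $w\in W$. Let $(\mathbb X,\mathbb C,\|\cdot\|)$ and $(\mathbb B,\mathbb Y,\|\cdot\|)$ be dual pairs, $c\in\mathbb C$, $b\in\mathbb B$, let $\mathcal A:\mathbb X\to\mathbb B$ be linear, continuous for the weak topologies $\sigma(\mathbb X,\mathbb C)$ and $\sigma(\mathbb B,\mathbb Y)$ and with finite operator norm $\|\mathcal A\|$, and let $\mathbb K\subset\mathbb B$ be a $\sigma(\mathbb B,\mathbb Y)$-closed convex cone with dual cone $\mathbb K^*=\{y\in\mathbb Y:\langle v,y\rangle\ge0\ \forall v\in\mathbb K\}$. Let $J=\inf\{\langle x,c\rangle: x\in\mathbb X,\ \mathcal Ax-b\in\mathbb K\}$ be attained at $x^\star$. *Semi-infinite program.* Let $(x_i)_{i\ge1}\subset\mathbb X$ be linearly independent with $\|x_i\|=1$. For each $n\ge1$ let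 $\|\cdot\|_{\mathfrak R}$ be a norm on $\mathbb R^n$ with dual norm $\|\cdot\|_{\mathfrak R^*}$, and $\theta_{\mathcal P}\in\mathbb R$ (both may depend on $n$). Put $\mathcal A_n\alpha=\sum_i\alpha_i\mathcal Ax_i$, $\mathcal A_n^*y=(\langle\mathcal Ax_i,y\rangle)_i$, $\mathbf c=(\langle x_i,c\rangle)_i$, $\mathscr A=\{\alpha\in\mathbb R^n:\|\alpha\|_{\mathfrak R}\le\theta_{\mathcal P}\}$, $\varrho_n=\sup_{\|\alpha\|_{\mathfrak R}\le1}\|\alpha\|_{\ell_1}$ and $J_n=\inf\{\alpha\cdot\mathbf c:\alpha\in\mathscr A,\ \mathcal A_n\alpha-b\in\mathbb K\}$. Let $d>0$ and $D$ be constants such that for all $n\ge1$ the residual $r_n=x^\star-\Pi_n$, with $\Pi_n$ a nearest point to $x^\star$ in $\{\sum_i\alpha_ix_i:\|\alpha\|_{\mathfrak R}\le\theta_{\mathcal P}\}$, satisfies $\|r_n\|\le Dn^{-1/d}$. Fix $n\ge1$ and assume that the program defining $J_n$ is feasible and that for some $\gamma>0$ one has $\|\mathcal A_n^*y\|_{\mathfrak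 R^*}\ge\gamma\|y\|_*$ for all $y\in\mathbb K^*$ and $\gamma\theta_{\mathcal P}>\|b\|$. For a lower bound $J_n^{\rm LB}\le J_n$ put $$\theta_{\mathcal D}=\frac{\theta_{\mathcal P}\|\mathbf c\|_{\mathfrak R^*}-J_n^{\rm LB}}{\gamma\theta_{\mathcal P}-\|b\|}.$$ *Scenario program.* Let $\mathcal K$ be the set of extreme points of $\{y\in\mathbb K^*:\|y\|_*=1\}$, and assume that every $y\in\mathbb K^*$ with $\|y\|_*=1$ lies in the $\sigma(\mathbb Y,\mathbb B)$-closed convex hull of $\mathcal K$. Equip $\mathbb Y$ with a $\sigma$-algebra for which all functionals $\langle v,\cdot\rangle$, $v\in\mathbb B$, are measurable. Let $\mathbb P$ be a probability measure on $\mathbb Y$ supported on $\mathcal K$, let $y_1,\dots,y_N$ be i.i.d. samples from $\mathbb P$, and put $J_{n,N}=\min\{\alpha\cdot\mathbf c:\alpha\in\mathscr A,\ \alpha\cdot\mathcal A_n^*y_j\ge\langle b,y_j\rangle,\ j\le N\}$; assume that almost surely this program has a unique minimizer $\alpha_N^\star$. A function $h\ge0$ on $\mathbb R^n\times[0,1)$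 is a *tail bound* if for all $(\alpha,\varepsilon)$ $$h(\alpha,\varepsilon)\ge\sup\Big\{\zeta\ge0:\ \mathbb P\big[y:\ \sup_{\kappa\in\mathcal K}\langle b-\mathcal A_n\alpha,\kappa\rangle<\langle b-\mathcal A_n\alpha,y\rangle+\zeta\big]\le\varepsilon\Big\}.$$ Put $\mathsf N(n,\varepsilon,\beta)=\min\{N\in\mathbb N:\sum_{i=0}^{n-1}\binom Ni\varepsilon^i(1-\varepsilon)^{N-i}\le\beta\}$, with $\min\emptyset=\infty$. *Smoothing algorithm.* Put $\mathscr Y=\{y\in\mathbb K^*:\|y\|_*\le\theta_{\mathcal D}\}$, let $\mathsf d:\mathscr Y\to[0,\infty)$ be strongly convex with respect to $\|\cdot\|_*$, and assume that for all $s>0$ and $\alpha\in\mathscr A$ a maximizer $y_s^\star(\alpha)$ of $y\mapsto\langle b-\mathcal A_n\alpha,y\rangle-s\,\mathsf d(y)$ over $\mathscr Y$ exists. Let $\eta>0$ be such that, for some $L>0$, $\|\mathcal A_n^*y_\eta^\star(\alpha)-\mathcal A_n^*y_\eta^\star(\alpha')\|_{\mathfrak R^*}\le\frac L\eta\|\alpha-\alpha'\|_{\mathfrak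 R}$ on $\mathscr A$, and let $\vartheta>0$ be a strong convexity parameter of $\frac12\|\cdot\|_{\mathfrak R}^2$ with respect to $\|\cdot\|_{\mathfrak R}$. With $\mathbb T(q,\alpha)=\arg\min_{\beta'\in\mathscr A}\{q\cdot\beta'+\frac1{2\vartheta}\|\beta'-\alpha\|_{\mathfrak R}^2\}$ and any $w^{(0)}\in\mathscr A$, define for $k\ge0$ $$r^{(k)}=\tfrac\eta L\big(\mathbf c-\mathcal A_n^*y_\eta^\star(w^{(k)})\big),\quad z^{(k)}=\mathbb T\Big(\sum_{j=0}^k\tfrac{j+1}2r^{(j)},0\Big),\quad\alpha^{(k)}=\mathbb T\big(\tfrac1\vartheta r^{(k)},w^{(k)}\big),\quad w^{(k+1)}=\tfrac2{k+3}z^{(k)}+\tfrac{k+1}{k+3}\alpha^{(k)}.$$ After $k$ iterations let $\widehat\alpha_\eta=\alpha^{(k)}$, $\widehat y_\eta=\sum_{j=0}^k\frac{2(j+1)}{(k+1)(k+2)}y_\eta^\star(w^{(j)})$, and $$J^{\rm LB}_{n,\eta}=\langle b,\widehat y_\eta\rangle-\theta_{\mathcal P}\|\mathcal A_n^*\widehat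 y_\eta-\mathbf c\|_{\mathfrak R^*},\qquad J^{\rm UB}_{n,\eta}=\widehat\alpha_\eta\cdot\mathbf c+\sup_{y\in\mathscr Y}\langle b-\mathcal A_n\widehat\alpha_\eta,y\rangle.$$ *Conclusion.* Let $\beta\in(0,1)$. (1) For every $\varepsilon\in(0,1)$ with $N\ge\mathsf N(n,\varepsilon,\beta)$, every tail bound $h$ and every number of iterations $k$, with probability at least $1-\beta$, $$\max\{J_{n,N},J^{\rm LB}_{n,\eta}\}-D\big(\|c\|_*+\theta_{\mathcal D}\|\mathcal A\|\big)n^{-1/d}\ \le\ J\ \le\ \min\{J^{\rm UB}_{n,\eta},\,J_{n,N}+\theta_{\mathcal D}h(\alpha_N^\star,\varepsilon)\}.$$ (2) Let $\varepsilon>0$ and $n\ge\big(D(\|c\|_*+\theta_{\mathcal D}\|\mathcal A\|)\varepsilon^{-1}\big)^d$. Suppose that (a) $N\ge\mathsf N(n,g(z_n\varepsilon),\beta)$ with $z_n=\big(\theta_{\mathcal D}(\theta_{\mathcal P}\varrho_n\|\mathcal A\|+\|b\|)\big)^{-1}$, for some non-decreasing $g:[0,\infty)\to[0,1]$ such that $g(r)\le\mathbb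 P[\{y:\|y-\kappa\|_*<r\}]$ for all $\kappa\in\mathcal K$, $r\ge0$; **or** (b) there are constants $c_0,C_0>0$ with $\mathsf d(y_s^\star(\alpha))\le C_0\max\{\log(c_0s^{-1}),1\}$ for all $s>0$, $\alpha\in\mathscr A$, such that $$\eta\le\frac{\varepsilon}{2C_0\max\{2\log(2c_0C_0\varepsilon^{-1}),1\}},\qquad k\ge5\,\theta_{\mathcal P}\sqrt{\frac{L}{\vartheta\,\eta\,\varepsilon}}.$$ Then with probability at least $1-\beta$, $\ \min\{|J-J_{n,N}|,\,|J-J^{\rm LB}_{n,\eta}|\}\le\varepsilon$. -/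

import Mathlib

open MeasureTheory Set

noncomputable section

/-- A dual pair `(V, W, ‖·‖)`: a bilinear form separating points, with `V` normed and such that
the dual norm `‖w‖_* = sup_{‖v‖ ≤ 1} ⟨v, w⟩` is finite for every `w`. -/
structure DualPair (V W : Type*) [NormedAddCommGroup V] [NormedSpace ℝ V]
    [AddCommGroup W] [Module ℝ W] where
  pairing : V →ₗ[ℝ] W →ₗ[ℝ] ℝ
  separating : pairing.Nondegenerate
  bounded : ∀ w : W, BddAbove {r : ℝ | ∃ v : V, ‖v‖ ≤ 1 ∧ r = pairing v w}

/-- The dual norm `‖w‖_*`. -/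
def DualPair.dualNorm {V W : Type*} [NormedAddCommGroup V] [NormedSpace ℝ V]
    [AddCommGroup W] [Module ℝ W] (p : DualPair V W) (w : W) : ℝ :=
  sSup {r : ℝ | ∃ v : V, ‖v‖ ≤ 1 ∧ r = p.pairing v w}

/-- The data of the linear program `inf {⟨x, c⟩ : A x - b ∈ K}` over the dual pairs
`(X, C)` and `(B, Y)`. The operator `A` has finite operator norm, it is continuous for the weak
topologies `σ(X, C)` and `σ(B, Y)`, and the convex cone `K` is `σ(B, Y)`-closed. -/
structure InfiniteLP (X C B Y : Type*)
    [NormedAddCommGroup X] [NormedSpace ℝ X] [AddCommGroup C] [Module ℝ C]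
    [NormedAddCommGroup B] [NormedSpace ℝ B] [AddCommGroup Y] [Module ℝ Y] where
  pX : DualPair X C
  pB : DualPair B Y
  A : X →L[ℝ] B
  K : PointedCone ℝ B
  c : C
  b : B
  weakly_continuous :
    @Continuous (WeakBilin pX.pairing) (WeakBilin pB.pairing) inferInstance inferInstance
      (fun x => A x)
  weakly_closed : @IsClosed (WeakBilin pB.pairing) inferInstance (K : Set B)

/-- A normalized linearly independent sequence in `X`, and for every `n` a norm `‖·‖_R` on `ℝⁿ`
and the radius `θ_P` of the ball of admissible coefficient vectors. -/
structure Discretization (X : Type*) [NormedAddCommGroup X] [NormedSpace ℝ X] where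
  x : ℕ → X
  linearIndependent : LinearIndependent ℝ x
  norm_x : ∀ i, ‖x i‖ = 1
  R : ∀ n : ℕ, Seminorm ℝ (Fin n → ℝ)
  R_definite : ∀ (n : ℕ) (α : Fin n → ℝ), R n α = 0 → α = 0
  θP : ℕ → ℝ

/-- `f` is strongly convex on `s` with parameter `m`, with respect to the norm `nrm`. -/
def StrongConvexWrt {E : Type*} [AddCommGroup E] [Module ℝ E] (nrm : E → ℝ) (s : Set E)
    (m : ℝ) (f : E → ℝ) : Prop :=
  Convex ℝ s ∧ ∀ y ∈ s, ∀ y' ∈ s, ∀ t t' : ℝ, 0 ≤ t → 0 ≤ t' → t + t' = 1 →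
    f (t • y + t' • y') ≤ t * f y + t' * f y' - m / 2 * (t * t') * nrm (y - y') ^ 2

namespace InfiniteLP

variable {X C B Y : Type*}
  [NormedAddCommGroup X] [NormedSpace ℝ X] [AddCommGroup C] [Module ℝ C]
  [NormedAddCommGroup B] [NormedSpace ℝ B] [AddCommGroup Y] [Module ℝ Y]
  (P : InfiniteLP X C B Y)

/-! ### The infinite program -/

def feasibleSet : Set X := {x | P.A x - P.b ∈ P.K}

/-- The optimal value `J`. -/
def value : ℝ := sInf ((fun x => P.pX.pairing x P.c) '' P.feasibleSet)

def IsOptimizer (x : X) : Prop :=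
  x ∈ P.feasibleSet ∧ ∀ x' ∈ P.feasibleSet, P.pX.pairing x P.c ≤ P.pX.pairing x' P.c

/-- The dual cone `K* = {y : ⟨v, y⟩ ≥ 0 for all v ∈ K}`. -/
def dualCone : PointedCone ℝ Y := PointedCone.dual P.pB.pairing (P.K : Set B)

variable (S : Discretization X) (n : ℕ)

/-! ### The semi-infinite program -/

/-- `A_n α = ∑ αᵢ A xᵢ`. -/
def An (α : Fin n → ℝ) : B := ∑ i, α i • P.A (S.x i)

/-- The adjoint `A_n^* y = (⟨A xᵢ, y⟩)ᵢ`. -/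
def AnAdj (y : Y) : Fin n → ℝ := fun i => P.pB.pairing (P.A (S.x i)) y

/-- The cost vector `(⟨xᵢ, c⟩)ᵢ`. -/
def cvec : Fin n → ℝ := fun i => P.pX.pairing (S.x i) P.c

/-- The ball `{α ∈ ℝⁿ : ‖α‖_R ≤ θ_P}`. -/
def _root_.Discretization.ball : Set (Fin n → ℝ) := {α | S.R n α ≤ S.θP n}

/-- The dual norm `‖·‖_{R*}` on `ℝⁿ`. -/
def _root_.Discretization.dualR (v : Fin n → ℝ) : ℝ :=
  sSup {r : ℝ | ∃ α : Fin n → ℝ, S.R n α ≤ 1 ∧ r = α ⬝ᵥ v}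

/-- `ϱ_n = sup {‖α‖_{ℓ₁} : ‖α‖_R ≤ 1}`. -/
def _root_.Discretization.ratio : ℝ :=
  sSup {r : ℝ | ∃ α : Fin n → ℝ, S.R n α ≤ 1 ∧ r = ∑ i, |α i|}

/-- The ball `{∑ αᵢ xᵢ : ‖α‖_R ≤ θ_P}` in `X`. -/
def _root_.Discretization.ballX : Set X :=
  (fun α : Fin n → ℝ => ∑ i, α i • S.x i) '' S.ball n

/-- `p` is a projection of `x` onto the set `T`, that is, a nearest point in `T`. -/
def _root_.IsProjection (T : Set X) (x p : X) : Prop :=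
  p ∈ T ∧ ∀ p' ∈ T, ‖p - x‖ ≤ ‖p' - x‖

def semiFeasibleSet : Set (Fin n → ℝ) := {α | P.An S n α - P.b ∈ P.K ∧ α ∈ S.ball n}

/-- The optimal value `J_n`. -/
def semiValue : ℝ := sInf ((fun α => α ⬝ᵥ P.cvec S n) '' P.semiFeasibleSet S n)

/-- The regularity assumption on the semi-infinite program, with constant `γ`. -/
structure IsRegular (γ : ℝ) : Prop where
  feasible : (P.semiFeasibleSet S n).Nonempty
  γ_pos : 0 < γ
  inf_sup : ∀ y ∈ P.dualCone, γ * P.pB.dualNorm y ≤ S.dualR n (P.AnAdj S n y)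
  large : ‖P.b‖ < γ * S.θP n

/-- The bound `θ_D` on the dual optimizers, for a lower bound `JLB` on `J_n`. -/
def θD (γ JLB : ℝ) : ℝ :=
  (S.θP n * S.dualR n (P.cvec S n) - JLB) / (γ * S.θP n - ‖P.b‖)

/-! ### The scenario program -/

/-- The extreme points of `{y ∈ K* : ‖y‖_* = 1}`. -/
def extremeRays : Set Y := extremePoints ℝ {y : Y | y ∈ P.dualCone ∧ P.pB.dualNorm y = 1}

/-- The support function `v ↦ sup {⟨v, y⟩ : y ∈ 𝒦}` of the set `𝒦` of extreme points. -/
def supportFun (v : B) : ℝ := sSup ((fun y => P.pB.pairing v y) '' P.extremeRays)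

/-- Every normalized element of `K*` lies in the `σ(Y, B)`-closed convex hull of `𝒦`. -/
def GeneratedByExtremeRays : Prop :=
  ∀ y ∈ P.dualCone, P.pB.dualNorm y = 1 →
    y ∈ @closure (WeakBilin P.pB.pairing.flip) inferInstance (convexHull ℝ P.extremeRays)

def scenarioFeasibleSet {N : ℕ} (ω : Fin N → Y) : Set (Fin n → ℝ) :=
  {α | (∀ j, P.pB.pairing P.b (ω j) ≤ α ⬝ᵥ P.AnAdj S n (ω j)) ∧ α ∈ S.ball n}

/-- The optimal value `J_{n,N}` for the samples `ω = (y_1, …, y_N)`. -/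
def scenarioValue {N : ℕ} (ω : Fin N → Y) : ℝ :=
  sInf ((fun α => α ⬝ᵥ P.cvec S n) '' P.scenarioFeasibleSet S n ω)

/-- `α` is the unique minimizer of the scenario program for the samples `ω`. -/
def IsUniqueScenarioOptimizer {N : ℕ} (ω : Fin N → Y) (α : Fin n → ℝ) : Prop :=
  α ∈ P.scenarioFeasibleSet S n ω ∧
    ∀ α' ∈ P.scenarioFeasibleSet S n ω, α' ≠ α → α ⬝ᵥ P.cvec S n < α' ⬝ᵥ P.cvec S n

section Probability

variable [MeasurableSpace Y] (μ : Measure Y)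

/-- `p(α, ζ) = ℙ[y : σ_𝒦(-A_n α + b) < ⟨-A_n α + b, y⟩ + ζ]`. -/
def tailProb (α : Fin n → ℝ) (ζ : ℝ) : ℝ :=
  μ.real {y | P.supportFun (-P.An S n α + P.b) < P.pB.pairing (-P.An S n α + P.b) y + ζ}

/-- `h ≥ 0` is a tail bound: `h(α, ε) ≥ sup {ζ ≥ 0 : p(α, ζ) ≤ ε}`. The level `ε = 1` is left
out, since there the supremum is infinite. -/
def IsTailBound (h : (Fin n → ℝ) → ℝ → ℝ) : Prop :=
  ∀ α : Fin n → ℝ, ∀ ε : ℝ, 0 ≤ ε → ε < 1 →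
    0 ≤ h α ε ∧ ∀ ζ : ℝ, 0 ≤ ζ → P.tailProb S n μ α ζ ≤ ε → ζ ≤ h α ε

/-- `g : [0, ∞) → [0, 1]` is non-decreasing, and `g(r)` is a lower bound for the measure of the
open dual-norm balls of radius `r` centred in `𝒦`. -/
def IsBallBound (g : ℝ → ℝ) : Prop :=
  MonotoneOn g (Ici 0) ∧ (∀ r : ℝ, 0 ≤ r → 0 ≤ g r ∧ g r ≤ 1) ∧
    ∀ κ ∈ P.extremeRays, ∀ r : ℝ, 0 ≤ r → g r ≤ μ.real {y | P.pB.dualNorm (y - κ) < r}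

end Probability

/-- The least `N` with `∑_{i<n} (N choose i) εⁱ (1-ε)^{N-i} ≤ β` (infinite if there is none). -/
def _root_.sampleBound (n : ℕ) (ε β : ℝ) : ℕ∞ :=
  sInf ((fun N : ℕ => (N : ℕ∞)) ''
    {N : ℕ | ∑ i ∈ Finset.range n, (N.choose i : ℝ) * ε ^ i * (1 - ε) ^ (N - i) ≤ β})

/-- `z_n = (θ_D (θ_P ϱ_n ‖A‖ + ‖b‖))⁻¹`. -/
def zn (γ JLB : ℝ) : ℝ :=
  (P.θD S n γ JLB * (S.θP n * S.ratio n * ‖P.A‖ + ‖P.b‖))⁻¹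

/-! ### The smoothing algorithm -/

/-- The set `𝒴 = {y ∈ K* : ‖y‖_* ≤ θ_D}`, with `θ = θ_D`. -/
def dualBall (θ : ℝ) : Set Y := {y | y ∈ P.dualCone ∧ P.pB.dualNorm y ≤ θ}

/-- `prox` is a prox-function: nonnegative and strongly convex on `𝒴`. -/
def IsProx (θ : ℝ) (prox : Y → ℝ) : Prop :=
  (∀ y ∈ P.dualBall θ, 0 ≤ prox y) ∧
    ∃ m : ℝ, 0 < m ∧ StrongConvexWrt P.pB.dualNorm (P.dualBall θ) m prox

/-- `y = y_η^⋆(α)`: `y` maximizes `⟨b - A_n α, y⟩ - η d(y)` over `𝒴`. -/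
def IsProxMaximizer (θ : ℝ) (prox : Y → ℝ) (η : ℝ) (α : Fin n → ℝ) (y : Y) : Prop :=
  y ∈ P.dualBall θ ∧ ∀ y' ∈ P.dualBall θ,
    P.pB.pairing (P.b - P.An S n α) y' - η * prox y' ≤
      P.pB.pairing (P.b - P.An S n α) y - η * prox y

/-- `β = 𝕋(q, α)`: `β` minimizes `q · β + ‖β - α‖_R² / (2ϑ)` over the ball. -/
def _root_.Discretization.IsT (ϑ : ℝ) (q α β : Fin n → ℝ) : Prop :=
  β ∈ S.ball n ∧ ∀ β' ∈ S.ball n,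
    q ⬝ᵥ β + 1 / (2 * ϑ) * S.R n (β - α) ^ 2 ≤ q ⬝ᵥ β' + 1 / (2 * ϑ) * S.R n (β' - α) ^ 2

/-- The sequences `w, z, a` (for `w^(k), z^(k), α^(k)`) are generated by the fast gradient
algorithm with regularization parameter `η` and constants `L`, `ϑ`, from any `w^(0)` in the
ball. -/
structure IsAlgorithmRun (yη : (Fin n → ℝ) → Y) (η L ϑ : ℝ)
    (w z a : ℕ → Fin n → ℝ) : Prop where
  init : w 0 ∈ S.ball n
  step_z : ∀ k, S.IsT n ϑ (∑ j ∈ Finset.range (k + 1),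
    (((j : ℝ) + 1) / 2) • ((η / L) • (P.cvec S n - P.AnAdj S n (yη (w j))))) 0 (z k)
  step_a : ∀ k, S.IsT n ϑ
    ((1 / ϑ) • ((η / L) • (P.cvec S n - P.AnAdj S n (yη (w k))))) (w k) (a k)
  step_w : ∀ k : ℕ, w (k + 1) =
    (2 / ((k : ℝ) + 3)) • z k + (((k : ℝ) + 1) / ((k : ℝ) + 3)) • a k

/-- `ŷ_η = ∑_{j ≤ k} 2(j+1)/((k+1)(k+2)) y_j`, where `y_j = y_η^⋆(w^(j))`. -/
def _root_.weightedMean (y : ℕ → Y) (k : ℕ) : Y :=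
  ∑ j ∈ Finset.range (k + 1),
    (2 * ((j : ℝ) + 1) / (((k : ℝ) + 1) * ((k : ℝ) + 2))) • y j

/-- `J^LB_{n,η}`, the objective of the dual program at `y = ŷ_η`. -/
def lowerValue (y : Y) : ℝ :=
  P.pB.pairing P.b y - S.θP n * S.dualR n (P.AnAdj S n y - P.cvec S n)

/-- `J^UB_{n,η} = α · c + sup_{y ∈ 𝒴} ⟨b - A_n α, y⟩` at `α = α̂_η`. -/
def upperValue (θ : ℝ) (α : Fin n → ℝ) : ℝ :=
  α ⬝ᵥ P.cvec S n + sSup ((fun y => P.pB.pairing (P.b - P.An S n α) y) '' P.dualBall θ)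

end InfiniteLP

end

/-!
The proof has a deterministic part and a probabilistic part.

*Duality.* The ball of coefficients is compact and the cone is weakly closed, so the semi-infinite
program has no duality gap (`InfiniteLP.exists_dual_gt`, by separation in `ℝ × B`). By the
regularity condition, dual vectors with a large Lagrangian have norm at most `θ_D`. Hence
`θ_D` is an exact penalty parameter (`InfiniteLP.semiValue_le_penalty`): for `α` in the ball, the
semi-infinite value `J_n` exceeds the cost of `α` by at most `θ_D` times the violation of the conic
constraint at `α`. Taking for `α` the projection of the optimizer, the last iterate of the
algorithm, and the scenario minimizer gives `J_n - J ≤ D (‖c‖_* + θ_D ‖A‖) n^{-1/d}`,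
`J_n ≤ J^UB`, and `J_n ≤ J_{n,N} + θ_D σ⁺`, where `σ` is the largest violation of a normalized
constraint. Since `J ≤ J_n`, `J^LB ≤ J_n` (weak duality) and `J_{n,N} ≤ J_n` (relaxation), only
`σ` and the gap `J^UB - J^LB` remain to be estimated.

*Smoothing.* The gap is the sum of an optimization error, bounded by the estimate sequence of the
fast gradient method (`Discretization.fast_gradient_estimate`), and of a smoothing error. The latter
is an integral over the smoothing parameter of the logarithmic bound on the prox terms, evaluated
along a geometric sequence (`le_prox_max_add_of_log_le`).

*Scenario bound.* The violation probability of the scenario minimizer exceeds `ε` with probability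
at most `∑_{i<n} (N choose i) ε^i (1-ε)^{N-i}` (`measure_lt_violation_le`). After adding a small
random relaxation to the constraints and a small quadratic term to the objective, almost surely no
constraint is tight at a minimizer that does not depend on it. By Helly's theorem the minimizer is
then determined by its support constraints, at most `n` in number. Completing them to exactly `n`
constraints by means of random marks gives, for every sample size, exactly one `n`-subset that is
compatible with the other constraints (`ConvexScenario.existsUnique_compatible`). Counting these
subsets determines all moments of the conditional probability of compatibility, which therefore has
a Beta law (`map_compatible_eq_betaLaw`), and an incomplete Beta integral is a binomial tail. The
perturbation is removed by convergence of the minimizers and Fatou's lemma. A small violation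
probability bounds `σ` through the tail bound `h` or through the ball bound `g`.
-/

noncomputable section

/-! ### Finite-dimensional norms -/

namespace Discretization

variable {X : Type*} [NormedAddCommGroup X] [NormedSpace ℝ X] (S : Discretization X) (n : ℕ)

theorem continuous_R : Continuous (S.R n) := by
  have h := (S.R n).convexOn
  exact continuousOn_univ.1 (h.continuousOn isOpen_univ)

/-- All norms on `ℝⁿ` are equivalent. -/
theorem exists_norm_le : ∃ K : ℝ, 0 < K ∧ ∀ α : Fin n → ℝ, ‖α‖ ≤ K * S.R n α := by
  by_cases hs : (Metric.sphere (0 : Fin n → ℝ) 1).Nonempty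
  · obtain ⟨α₀, h₀, hmin⟩ := (isCompact_sphere (0 : Fin n → ℝ) 1).exists_isMinOn hs
      (S.continuous_R n).continuousOn
    have hpos : 0 < S.R n α₀ := by
      refine lt_of_le_of_ne (apply_nonneg _ _) fun h => ?_
      have := S.R_definite n α₀ h.symm
      simp [this] at h₀
    refine ⟨(S.R n α₀)⁻¹, inv_pos.2 hpos, fun α => ?_⟩
    by_cases hα : α = 0
    · simp [hα]
    have hn : 0 < ‖α‖ := norm_pos_iff.2 hα
    have h1 := hmin (a := ‖α‖⁻¹ • α) (by simp [norm_smul, hn.ne'])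
    change S.R n α₀ ≤ S.R n (‖α‖⁻¹ • α) at h1
    rw [map_smul_eq_mul, norm_inv, norm_norm, ← div_eq_inv_mul, le_div_iff₀ hn] at h1
    rwa [← div_eq_inv_mul, le_div_iff₀ hpos, mul_comm]
  · refine ⟨1, one_pos, fun α => ?_⟩
    have hα : α = 0 := by
      by_contra hα
      exact hs ⟨‖α‖⁻¹ • α, by simp [norm_smul, (norm_pos_iff.2 hα).ne']⟩
    simp [hα]

theorem isCompact_ball : IsCompact (S.ball n) := by
  obtain ⟨K, hK, h⟩ := S.exists_norm_le n
  refine Metric.isCompact_of_isClosed_isBounded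
    (isClosed_le (S.continuous_R n) continuous_const) ?_
  refine (Metric.isBounded_closedBall (x := 0) (r := K * S.θP n)).subset fun α hα => ?_
  rw [mem_closedBall_zero_iff]
  exact (h α).trans (mul_le_mul_of_nonneg_left hα hK.le)

theorem convex_ball : Convex ℝ (S.ball n) := by
  have := (S.R n).convexOn.convex_le (S.θP n)
  simpa [ball] using this

theorem bddAbove_of_continuous {f : (Fin n → ℝ) → ℝ} (hf : Continuous f) :
    BddAbove {r : ℝ | ∃ α : Fin n → ℝ, S.R n α ≤ 1 ∧ r = f α} := by
  obtain ⟨K, hK, h⟩ := S.exists_norm_le n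
  have hc : IsCompact (Metric.closedBall (0 : Fin n → ℝ) K) := isCompact_closedBall _ _
  refine (hc.bddAbove_image hf.continuousOn).mono ?_
  rintro r ⟨α, hα, rfl⟩
  exact mem_image_of_mem _ (mem_closedBall_zero_iff.2
    ((h α).trans (by nlinarith)))

theorem continuous_dot (v : Fin n → ℝ) : Continuous fun α : Fin n → ℝ => α ⬝ᵥ v := by
  unfold dotProduct; fun_prop

theorem dot_le (α v : Fin n → ℝ) : α ⬝ᵥ v ≤ S.R n α * S.dualR n v := by
  have key : ∀ α, S.R n α ≤ 1 → α ⬝ᵥ v ≤ S.dualR n v := fun α hα =>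
    le_csSup (S.bddAbove_of_continuous n (continuous_dot n v)) ⟨α, hα, rfl⟩
  by_cases h0 : S.R n α = 0
  · have := S.R_definite n α h0
    simp [this]
  have hpos : 0 < S.R n α := lt_of_le_of_ne (apply_nonneg _ _) (Ne.symm h0)
  have h1 := key ((S.R n α)⁻¹ • α) (by simp [map_smul_eq_mul, abs_of_pos hpos, h0])
  rw [smul_dotProduct, smul_eq_mul, inv_mul_le_iff₀ hpos] at h1
  exact h1

theorem dualR_nonneg (v : Fin n → ℝ) : 0 ≤ S.dualR n v :=
  le_csSup (S.bddAbove_of_continuous n (continuous_dot n v)) ⟨0, by simp, by simp⟩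

theorem dualR_le {v : Fin n → ℝ} {r : ℝ} (h : ∀ α, S.R n α ≤ 1 → α ⬝ᵥ v ≤ r) :
    S.dualR n v ≤ r := by
  refine csSup_le ⟨0, 0, by simp, by simp⟩ ?_
  rintro _ ⟨α, hα, rfl⟩
  exact h α hα

theorem sum_abs_le (α : Fin n → ℝ) : ∑ i, |α i| ≤ S.R n α * S.ratio n := by
  have key : ∀ α, S.R n α ≤ 1 → ∑ i, |α i| ≤ S.ratio n := fun α hα =>
    le_csSup (S.bddAbove_of_continuous n (by fun_prop)) ⟨α, hα, rfl⟩
  by_cases h0 : S.R n α = 0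
  · have := S.R_definite n α h0
    simp [this]
  have hpos : 0 < S.R n α := lt_of_le_of_ne (apply_nonneg _ _) (Ne.symm h0)
  have h1 := key ((S.R n α)⁻¹ • α) (by simp [map_smul_eq_mul, abs_of_pos hpos, h0])
  simp only [Pi.smul_apply, smul_eq_mul, abs_mul, ← Finset.mul_sum, abs_inv, abs_of_pos hpos]
    at h1
  rwa [inv_mul_le_iff₀ hpos] at h1

theorem ratio_nonneg : 0 ≤ S.ratio n :=
  le_csSup (S.bddAbove_of_continuous n (by fun_prop)) ⟨0, by simp, by simp⟩

end Discretization

/-! ### Dual pairs -/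

namespace DualPair

variable {V W : Type*} [NormedAddCommGroup V] [NormedSpace ℝ V]
    [AddCommGroup W] [Module ℝ W] (p : DualPair V W)

theorem pairing_le (v : V) (w : W) : p.pairing v w ≤ ‖v‖ * p.dualNorm w := by
  by_cases h0 : v = 0
  · simp [h0]
  have hpos : 0 < ‖v‖ := norm_pos_iff.2 h0
  have h1 : p.pairing (‖v‖⁻¹ • v) w ≤ p.dualNorm w :=
    le_csSup (p.bounded w) ⟨_, by simp [norm_smul, hpos.ne'], rfl⟩
  rwa [map_smul, LinearMap.smul_apply, smul_eq_mul, inv_mul_le_iff₀ hpos] at h1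

theorem abs_pairing_le (v : V) (w : W) : |p.pairing v w| ≤ ‖v‖ * p.dualNorm w := by
  refine abs_le.2 ⟨?_, p.pairing_le v w⟩
  have := p.pairing_le (-v) w
  simp only [map_neg, LinearMap.neg_apply, norm_neg] at this
  linarith

theorem dualNorm_nonneg (w : W) : 0 ≤ p.dualNorm w :=
  le_csSup (p.bounded w) ⟨0, by simp, by simp⟩

theorem dualNorm_le {w : W} {r : ℝ} (h : ∀ v, ‖v‖ ≤ 1 → p.pairing v w ≤ r) :
    p.dualNorm w ≤ r := by
  refine csSup_le ⟨0, 0, by simp, by simp⟩ ?_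
  rintro _ ⟨v, hv, rfl⟩
  exact h v hv

theorem dualNorm_smul_le {t : ℝ} (ht : 0 ≤ t) (w : W) : p.dualNorm (t • w) ≤ t * p.dualNorm w := by
  refine p.dualNorm_le fun v hv => ?_
  rw [map_smul, smul_eq_mul]
  have := p.pairing_le v w
  have h0 := p.dualNorm_nonneg w
  exact mul_le_mul_of_nonneg_left (by nlinarith) ht

theorem dualNorm_zero : p.dualNorm 0 = 0 :=
  le_antisymm (p.dualNorm_le fun v _ => by simp) (p.dualNorm_nonneg 0)

theorem dualNorm_smul {t : ℝ} (ht : 0 ≤ t) (w : W) : p.dualNorm (t • w) = t * p.dualNorm w := by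
  refine le_antisymm (p.dualNorm_smul_le ht w) ?_
  rcases ht.eq_or_lt with rfl | ht
  · simp [p.dualNorm_zero]
  · have := p.dualNorm_smul_le (inv_nonneg.2 ht.le) (t • w)
    rwa [smul_smul, inv_mul_cancel₀ ht.ne', one_smul, ← div_eq_inv_mul, le_div_iff₀ ht,
      mul_comm] at this

end DualPair

/-! ### Duality for the semi-infinite program -/

namespace InfiniteLP

variable {X C B Y : Type*}
  [NormedAddCommGroup X] [NormedSpace ℝ X] [AddCommGroup C] [Module ℝ C]
  [NormedAddCommGroup B] [NormedSpace ℝ B] [AddCommGroup Y] [Module ℝ Y]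
  (P : InfiniteLP X C B Y) (S : Discretization X) (n : ℕ)

theorem mem_dualCone {y : Y} : y ∈ P.dualCone ↔ ∀ v ∈ P.K, 0 ≤ P.pB.pairing v y :=
  PointedCone.mem_dual

theorem An_add (α α' : Fin n → ℝ) : P.An S n (α + α') = P.An S n α + P.An S n α' := by
  simp [An, add_smul, Finset.sum_add_distrib]

theorem An_smul (t : ℝ) (α : Fin n → ℝ) : P.An S n (t • α) = t • P.An S n α := by
  simp [An, Finset.smul_sum, smul_smul]

theorem pairing_An (α : Fin n → ℝ) (y : Y) :
    P.pB.pairing (P.An S n α) y = α ⬝ᵥ P.AnAdj S n y := by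
  simp [An, AnAdj, dotProduct]

theorem An_eq (α : Fin n → ℝ) : P.An S n α = P.A (∑ i, α i • S.x i) := by
  simp [An]

theorem dot_cvec (α : Fin n → ℝ) :
    α ⬝ᵥ P.cvec S n = P.pX.pairing (∑ i, α i • S.x i) P.c := by
  simp [cvec, dotProduct]

theorem norm_An_le (α : Fin n → ℝ) : ‖P.An S n α‖ ≤ (∑ i, |α i|) * ‖P.A‖ := by
  rw [An, Finset.sum_mul]
  refine (norm_sum_le _ _).trans (Finset.sum_le_sum fun i _ => ?_)
  rw [norm_smul, Real.norm_eq_abs]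
  refine mul_le_mul_of_nonneg_left ?_ (abs_nonneg _)
  simpa [S.norm_x] using P.A.le_opNorm (S.x i)

theorem _root_.Discretization.bddBelow_dot {s : Set (Fin n → ℝ)} (hs : s ⊆ S.ball n)
    (v : Fin n → ℝ) : BddBelow ((fun α => α ⬝ᵥ v) '' s) :=
  (((S.isCompact_ball n).image (Discretization.continuous_dot n v)).bddBelow).mono
    (image_mono hs)

theorem semiValue_le {α : Fin n → ℝ} (hα : α ∈ P.semiFeasibleSet S n) :
    P.semiValue S n ≤ α ⬝ᵥ P.cvec S n := by
  exact csInf_le (S.bddBelow_dot n (fun α h => h.2) _) (mem_image_of_mem _ hα)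

variable {S n}

theorem le_semiValue {γ : ℝ} (hreg : P.IsRegular S n γ) {r : ℝ}
    (h : ∀ α ∈ P.semiFeasibleSet S n, r ≤ α ⬝ᵥ P.cvec S n) : r ≤ P.semiValue S n := by
  refine le_csInf (hreg.feasible.image _) ?_
  rintro _ ⟨α, hα, rfl⟩
  exact h α hα

theorem IsRegular.θP_pos {γ : ℝ} {P : InfiniteLP X C B Y} (hreg : P.IsRegular S n γ) :
    0 < S.θP n := by
  have := hreg.large
  have h2 := hreg.γ_pos
  have h1 := norm_nonneg P.b
  by_contra h
  nlinarith

theorem IsRegular.denom_pos {γ : ℝ} {P : InfiniteLP X C B Y} (hreg : P.IsRegular S n γ) :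
    0 < γ * S.θP n - ‖P.b‖ := sub_pos.2 hreg.large

theorem θD_nonneg {γ : ℝ} {P : InfiniteLP X C B Y} (hreg : P.IsRegular S n γ) {JLB : ℝ}
    (hJLB : JLB ≤ P.semiValue S n) : 0 ≤ P.θD S n γ JLB := by
  refine div_nonneg ?_ hreg.denom_pos.le
  obtain ⟨α, hα⟩ := hreg.feasible
  have h1 := P.semiValue_le S n hα
  have h2 := S.dot_le n α (P.cvec S n)
  have h3 := S.dualR_nonneg n (P.cvec S n)
  have h4 : S.R n α ≤ S.θP n := hα.2
  nlinarith

variable (S n)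

/-- Absence of a duality gap: every number below the value of the semi-infinite program is
exceeded by the Lagrangian of some dual vector on the whole ball. -/
theorem exists_dual_gt (hne : (P.semiFeasibleSet S n).Nonempty) {t : ℝ}
    (ht : t < P.semiValue S n) :
    ∃ y ∈ P.dualCone, ∀ α ∈ S.ball n,
      t < α ⬝ᵥ P.cvec S n + P.pB.pairing (P.b - P.An S n α) y := by
  let W := WeakBilin P.pB.pairing
  let T : (Fin n → ℝ) → ℝ × W := fun α => (α ⬝ᵥ P.cvec S n, (P.An S n α - P.b : B))
  have hTc : Continuous T := by
    refine (Discretization.continuous_dot n _).prodMk ?_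
    let u : Fin n → W := fun i => P.A (S.x i)
    let b' : W := P.b
    have : Continuous fun α : Fin n → ℝ => (∑ i, α i • u i) - b' := by fun_prop
    exact this
  have hE : IsCompact (T '' S.ball n) := (S.isCompact_ball n).image hTc
  have hEc : Convex ℝ (T '' S.ball n) := by
    rintro _ ⟨α, hα, rfl⟩ _ ⟨α', hα', rfl⟩ s s' hs hs' hss
    refine ⟨s • α + s' • α', S.convex_ball n hα hα' hs hs' hss, ?_⟩
    refine Prod.ext ?_ ?_
    · simp [T, add_dotProduct, smul_dotProduct]
    · change P.An S n (s • α + s' • α') - P.b =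
        s • (P.An S n α - P.b) + s' • (P.An S n α' - P.b)
      have : P.b = s • P.b + s' • P.b := by rw [← add_smul, hss, one_smul]
      rw [An_add, An_smul, An_smul]
      nth_rewrite 1 [this]
      module
  let K : Set W := (P.K : Set B)
  have hK : IsClosed K := P.weakly_closed
  let F : Set (ℝ × W) := Iic t ×ˢ K
  have hF : IsClosed F := isClosed_Iic.prod hK
  have hFc : Convex ℝ F := by
    have h2 : Convex ℝ (P.K : Set B) := P.K.convex
    exact (convex_Iic t).prod h2
  have hdisj : Disjoint (T '' S.ball n) F := by
    rw [disjoint_left]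
    rintro _ ⟨α, hα, rfl⟩ ⟨h1, h2⟩
    exact absurd (P.semiValue_le S n ⟨h2, hα⟩) (not_le.2 (lt_of_le_of_lt h1 ht))
  obtain ⟨f, u, v, hu, huv, hv⟩ := geometric_hahn_banach_compact_closed hEc hE hFc hF hdisj
  -- the functional splits as `f (r, v) = r * l - ⟨v, y⟩` after a change of sign
  obtain ⟨y, hy⟩ := LinearMap.dualEmbedding_surjective (B := P.pB.pairing)
    (f.comp (ContinuousLinearMap.inr ℝ ℝ W))
  have hy' : ∀ v : B, f (0, v) = P.pB.pairing v y := fun v =>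
    (DFunLike.congr_fun hy v).symm
  set l : ℝ := f (1, 0) with hl
  have hf : ∀ (r : ℝ) (v : B), f (r, v) = r * l + P.pB.pairing v y := by
    intro r v₀
    rw [← hy']
    let v : W := v₀
    change f ((r, v) : ℝ × W) = r * l + f ((0, v) : ℝ × W)
    have : ((r, v) : ℝ × W) = r • ((1, 0) : ℝ × W) + ((0, v) : ℝ × W) := by
      simp
    rw [hl, this, map_add, map_smul, smul_eq_mul]
  obtain ⟨α₀, hα₀⟩ := hne
  have hzero : (0 : B) ∈ P.K := P.K.zero_mem
  have hvt : v < t * l := by simpa [hf] using hv (t, (0 : B)) ⟨le_refl t, hzero⟩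
  -- the coefficient `l` is negative, by comparison at a feasible point
  have hlneg : l < 0 := by
    have h1 := hu (T α₀) (mem_image_of_mem _ hα₀.2)
    have h2 := hv (t, (P.An S n α₀ - P.b : B)) ⟨le_refl t, hα₀.1⟩
    have h3 : t < α₀ ⬝ᵥ P.cvec S n := lt_of_lt_of_le ht (P.semiValue_le S n hα₀)
    have h4 : f (T α₀) = _ := hf _ _
    rw [h4] at h1
    rw [hf] at h2
    nlinarith
  have hyK : ∀ k ∈ P.K, 0 ≤ P.pB.pairing k y := by
    intro k hk
    by_contra hneg
    push Not at hneg
    obtain ⟨N, hN⟩ := exists_nat_gt ((t * l - v) / -P.pB.pairing k y)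
    rw [div_lt_iff₀ (neg_pos.2 hneg)] at hN
    have hmem : ((N : ℝ) • k : B) ∈ P.K := P.K.smul_mem N.cast_nonneg hk
    have := hv (t, ((N : ℝ) • k : B)) ⟨le_refl t, hmem⟩
    rw [hf, map_smul, LinearMap.smul_apply, smul_eq_mul] at this
    linarith
  refine ⟨(-l)⁻¹ • y, ?_, fun α hα => ?_⟩
  · rw [mem_dualCone]
    intro k hk
    rw [map_smul, smul_eq_mul]
    exact mul_nonneg (inv_nonneg.2 (by linarith)) (hyK k hk)
  · have h1 : f (T α) = _ := hf _ _
    have h2 := hu (T α) (mem_image_of_mem _ hα)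
    rw [h1] at h2
    have h3 : P.pB.pairing (P.b - P.An S n α) y = -P.pB.pairing (P.An S n α - P.b) y := by
      rw [← neg_sub, map_neg, LinearMap.neg_apply]
    have hl' : 0 < -l := by linarith
    rw [map_smul, smul_eq_mul, h3]
    have : t * -l < (α ⬝ᵥ P.cvec S n) * -l + -P.pB.pairing (P.An S n α - P.b) y := by linarith
    calc t = t * -l * (-l)⁻¹ := (mul_inv_cancel_right₀ hl'.ne' t).symm
      _ < ((α ⬝ᵥ P.cvec S n) * -l + -P.pB.pairing (P.An S n α - P.b) y) * (-l)⁻¹ :=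
          mul_lt_mul_of_pos_right this (inv_pos.2 hl')
      _ = _ := by rw [add_mul, mul_inv_cancel_right₀ hl'.ne', mul_comm (-l)⁻¹]

variable {S n}

/-- Exact penalization: dual vectors with a large Lagrangian have norm at most `θ_D`, up to an
error that vanishes in the limit. Hence the semi-infinite value is bounded by the objective at
any point of the ball, plus `θ_D` times its violation of the conic constraint. -/
theorem semiValue_le_penalty {γ : ℝ} (hreg : P.IsRegular S n γ) {JLB : ℝ}
    (hJLB : JLB ≤ P.semiValue S n) {α : Fin n → ℝ} (hα : α ∈ S.ball n) {M : ℝ} (hM : 0 ≤ M)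
    (h : ∀ y ∈ P.dualCone, P.pB.pairing (P.b - P.An S n α) y ≤ M * P.pB.dualNorm y) :
    P.semiValue S n ≤ α ⬝ᵥ P.cvec S n + P.θD S n γ JLB * M := by
  have hden := hreg.denom_pos
  set q := γ * S.θP n - ‖P.b‖ with hq
  have key : ∀ δ > 0, P.semiValue S n ≤
      α ⬝ᵥ P.cvec S n + P.θD S n γ JLB * M + δ * (1 + M / q) := by
    intro δ hδ
    obtain ⟨y, hy, hyα⟩ := P.exists_dual_gt S n hreg.feasible
      (t := P.semiValue S n - δ) (by linarith)
    have hnorm : q * P.pB.dualNorm y ≤ S.θP n * S.dualR n (P.cvec S n) - JLB + δ := by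
      have h1 := hreg.inf_sup y hy
      have hbound : S.dualR n (P.AnAdj S n y) * S.θP n ≤
          S.θP n * S.dualR n (P.cvec S n) + ‖P.b‖ * P.pB.dualNorm y - (P.semiValue S n - δ) := by
        rw [← le_div_iff₀ hreg.θP_pos]
        refine S.dualR_le n fun α' hα' => ?_
        rw [le_div_iff₀ hreg.θP_pos]
        have hmem : S.θP n • α' ∈ S.ball n := by
          change S.R n _ ≤ _
          rw [map_smul_eq_mul, Real.norm_of_nonneg hreg.θP_pos.le]
          nlinarith [hreg.θP_pos]
        have h2 := hyα _ hmem
        have h3 := S.dot_le n (S.θP n • α') (P.cvec S n)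
        have h4 := P.pB.pairing_le P.b y
        have h5 : S.R n (S.θP n • α') ≤ S.θP n := hmem
        have h6 := mul_le_mul_of_nonneg_right h5 (S.dualR_nonneg n (P.cvec S n))
        rw [map_sub, LinearMap.sub_apply, pairing_An, smul_dotProduct (S.θP n) α' (P.AnAdj S n y),
          smul_eq_mul] at h2
        linarith
      have h5 := mul_le_mul_of_nonneg_right h1 hreg.θP_pos.le
      rw [hq]
      linarith
    have h1 := hyα α hα
    have h2 := h y hy
    have h3 : P.pB.dualNorm y ≤ P.θD S n γ JLB + δ / q := by
      rw [θD, ← hq, ← add_div, le_div_iff₀ hden]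
      linarith
    have h4 := mul_le_mul_of_nonneg_left h3 hM
    have : M * (P.θD S n γ JLB + δ / q) = P.θD S n γ JLB * M + δ * (M / q) := by
      field_simp
    linarith
  have hc : 0 < 1 + M / q := by positivity
  refine le_of_forall_pos_le_add fun ε hε => ?_
  have := key (ε / (1 + M / q)) (by positivity)
  rwa [div_mul_cancel₀ _ hc.ne'] at this

/-- Weak duality for the semi-infinite program. -/
theorem lowerValue_le_semiValue {γ : ℝ} (hreg : P.IsRegular S n γ) {y : Y}
    (hy : y ∈ P.dualCone) : P.lowerValue S n y ≤ P.semiValue S n := by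
  refine P.le_semiValue hreg fun α hα => ?_
  have h1 := (P.mem_dualCone).1 hy _ hα.1
  have h2 := S.dot_le n α (P.AnAdj S n y - P.cvec S n)
  have h3 : S.R n α ≤ S.θP n := hα.2
  have h4 := mul_le_mul_of_nonneg_right h3 (S.dualR_nonneg n (P.AnAdj S n y - P.cvec S n))
  rw [map_sub, LinearMap.sub_apply, pairing_An] at h1
  rw [dotProduct_sub] at h2
  rw [lowerValue]
  linarith

theorem value_eq {xstar : X} (hx : P.IsOptimizer xstar) :
    P.value = P.pX.pairing xstar P.c := by
  refine le_antisymm (csInf_le ⟨P.pX.pairing xstar P.c, ?_⟩ (mem_image_of_mem _ hx.1))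
    (le_csInf ⟨_, mem_image_of_mem _ hx.1⟩ ?_)
  · rintro _ ⟨x, h, rfl⟩
    exact hx.2 x h
  · rintro _ ⟨x, h, rfl⟩
    exact hx.2 x h

theorem value_le_semiValue {xstar : X} (hx : P.IsOptimizer xstar) {γ : ℝ}
    (hreg : P.IsRegular S n γ) : P.value ≤ P.semiValue S n := by
  refine P.le_semiValue hreg fun α hα => ?_
  rw [P.value_eq hx, dot_cvec]
  refine hx.2 _ ?_
  have := hα.1
  rwa [An_eq] at this

/-- The approximation error of the finite-dimensional restriction: the projection of the optimizer
violates the constraint by at most `‖A‖` times its distance to the optimizer. -/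
theorem semiValue_le_value {xstar p : X} (hx : P.IsOptimizer xstar) {γ : ℝ}
    (hreg : P.IsRegular S n γ) {JLB : ℝ} (hJLB : JLB ≤ P.semiValue S n)
    (hp : p ∈ S.ballX n) : P.semiValue S n ≤
      P.value + (P.pX.dualNorm P.c + P.θD S n γ JLB * ‖P.A‖) * ‖xstar - p‖ := by
  obtain ⟨α, hα, rfl⟩ := hp
  set p : X := ∑ i, α i • S.x i with hpdef
  have h := P.semiValue_le_penalty hreg hJLB hα (M := ‖P.A‖ * ‖xstar - p‖) (by positivity) ?_
  · have h2 := P.pX.pairing_le (p - xstar) P.c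
    rw [map_sub, LinearMap.sub_apply, norm_sub_rev] at h2
    rw [P.value_eq hx]
    rw [dot_cvec, ← hpdef] at h
    linarith
  · intro y hy
    have h1 := (P.mem_dualCone).1 hy _ hx.1
    have h2 : P.b - P.An S n α = P.A (xstar - p) - (P.A xstar - P.b) := by
      rw [An_eq, map_sub]; abel
    rw [h2, map_sub, LinearMap.sub_apply]
    have h3 := P.pB.pairing_le (P.A (xstar - p)) y
    have h4 := mul_le_mul_of_nonneg_right (P.A.le_opNorm (xstar - p)) (P.pB.dualNorm_nonneg y)
    linarith

theorem bddAbove_pairing_dualBall (v : B) (θ : ℝ) :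
    BddAbove ((fun y => P.pB.pairing v y) '' P.dualBall θ) := by
  refine ⟨‖v‖ * θ, ?_⟩
  rintro _ ⟨y, hy, rfl⟩
  exact (P.pB.pairing_le v y).trans (mul_le_mul_of_nonneg_left hy.2 (norm_nonneg v))

theorem semiValue_le_upperValue {γ : ℝ} (hreg : P.IsRegular S n γ) {JLB : ℝ}
    (hJLB : JLB ≤ P.semiValue S n) {α : Fin n → ℝ} (hα : α ∈ S.ball n) :
    P.semiValue S n ≤ P.upperValue S n (P.θD S n γ JLB) α := by
  set θ := P.θD S n γ JLB with hθ
  have hθ0 : 0 ≤ θ := θD_nonneg hreg hJLB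
  set s := sSup ((fun y => P.pB.pairing (P.b - P.An S n α) y) '' P.dualBall θ) with hs
  have hle : ∀ y ∈ P.dualBall θ, P.pB.pairing (P.b - P.An S n α) y ≤ s := fun y hy =>
    le_csSup (P.bddAbove_pairing_dualBall _ θ) (mem_image_of_mem _ hy)
  have h0 : 0 ≤ s := by
    simpa using hle 0 ⟨P.dualCone.zero_mem, by simpa [P.pB.dualNorm_zero] using hθ0⟩
  change _ ≤ α ⬝ᵥ P.cvec S n + s
  rcases hθ0.eq_or_lt with h | hpos
  · have := P.semiValue_le_penalty hreg hJLB hα (M := ‖P.b - P.An S n α‖) (norm_nonneg _)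
      (fun y _ => P.pB.pairing_le _ _)
    rw [← hθ, ← h] at this
    linarith
  · have := P.semiValue_le_penalty hreg hJLB hα (M := s / θ) (by positivity) ?_
    · rwa [← hθ, mul_div_cancel₀ _ hpos.ne'] at this
    intro y hy
    rcases (P.pB.dualNorm_nonneg y).eq_or_lt with h | hy0
    · have := P.pB.pairing_le (P.b - P.An S n α) y
      rw [← h] at this ⊢
      linarith
    · have hmem : (θ / P.pB.dualNorm y) • y ∈ P.dualBall θ := by
        refine ⟨P.dualCone.smul_mem (by positivity) hy, ?_⟩
        rw [P.pB.dualNorm_smul (by positivity), div_mul_cancel₀ _ hy0.ne']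
      have := hle _ hmem
      rw [map_smul, smul_eq_mul] at this
      rw [div_mul_eq_mul_div, le_div_iff₀ hpos]
      rw [div_mul_eq_mul_div, div_le_iff₀ hy0] at this
      linarith

theorem bddAbove_pairing_extremeRays (v : B) :
    BddAbove ((fun y => P.pB.pairing v y) '' P.extremeRays) := by
  refine ⟨‖v‖, ?_⟩
  rintro _ ⟨y, hy, rfl⟩
  have := P.pB.pairing_le v y
  rwa [(extremePoints_subset hy).2, mul_one] at this

theorem pairing_le_supportFun (v : B) {y : Y} (hy : y ∈ P.extremeRays) :
    P.pB.pairing v y ≤ P.supportFun v :=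
  le_csSup (P.bddAbove_pairing_extremeRays v) (mem_image_of_mem _ hy)

/-- A normalized cone is generated by its extreme points, so the support function controls the
pairing on the whole dual cone. -/
theorem pairing_le_supportFun_mul (hgen : P.GeneratedByExtremeRays) (v : B) {y : Y}
    (hy : y ∈ P.dualCone) :
    P.pB.pairing v y ≤ max (P.supportFun v) 0 * P.pB.dualNorm y := by
  rcases (P.pB.dualNorm_nonneg y).eq_or_lt with h | hy0
  · have := P.pB.pairing_le v y
    rw [← h] at this ⊢
    linarith
  set y' := (P.pB.dualNorm y)⁻¹ • y with hy'
  have hcl := hgen y' (P.dualCone.smul_mem (by positivity) hy)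
    (by rw [hy', P.pB.dualNorm_smul (by positivity), inv_mul_cancel₀ hy0.ne'])
  let e : WeakBilin P.pB.pairing.flip → ℝ := fun y => P.pB.pairing v y
  have hcont : Continuous e := WeakBilin.eval_continuous P.pB.pairing.flip v
  have hclosed : IsClosed {y : WeakBilin P.pB.pairing.flip | e y ≤ P.supportFun v} :=
    isClosed_le hcont continuous_const
  have hsub : (convexHull ℝ P.extremeRays : Set Y) ⊆
      {y : Y | P.pB.pairing v y ≤ P.supportFun v} := by
    refine convexHull_min (fun y hy => P.pairing_le_supportFun v hy) ?_
    exact convex_halfSpace_le (P.pB.pairing v).isLinear _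
  have h1 : P.pB.pairing v y' ≤ P.supportFun v := 
    closure_minimal (X := WeakBilin P.pB.pairing.flip) hsub hclosed hcl
  rw [hy', map_smul, smul_eq_mul, inv_mul_le_iff₀ hy0] at h1
  refine h1.trans ?_
  rw [mul_comm]
  exact mul_le_mul_of_nonneg_right (le_max_left _ _) hy0.le

/-! ### The scenario program as a relaxation -/

theorem scenarioValue_eq {N : ℕ} {ω : Fin N → Y} {α : Fin n → ℝ}
    (h : P.IsUniqueScenarioOptimizer S n ω α) :
    P.scenarioValue S n ω = α ⬝ᵥ P.cvec S n := by
  have hle : ∀ α' ∈ P.scenarioFeasibleSet S n ω, α ⬝ᵥ P.cvec S n ≤ α' ⬝ᵥ P.cvec S n := by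
    intro α' h'
    by_cases he : α' = α
    · rw [he]
    · exact (h.2 α' h' he).le
  refine le_antisymm (csInf_le ⟨α ⬝ᵥ P.cvec S n, ?_⟩ (mem_image_of_mem _ h.1))
    (le_csInf ⟨_, mem_image_of_mem _ h.1⟩ ?_)
  · rintro _ ⟨x, h, rfl⟩
    exact hle x h
  · rintro _ ⟨x, h, rfl⟩
    exact hle x h

theorem le_dot_AnAdj {α : Fin n → ℝ} (hα : α ∈ P.semiFeasibleSet S n) {y : Y}
    (hy : y ∈ P.extremeRays) : P.pB.pairing P.b y ≤ α ⬝ᵥ P.AnAdj S n y := by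
  have := (P.mem_dualCone).1 (extremePoints_subset hy).1 _ hα.1
  rw [map_sub, LinearMap.sub_apply, pairing_An] at this
  linarith

theorem scenarioValue_le_semiValue {γ : ℝ} (hreg : P.IsRegular S n γ) {N : ℕ} {ω : Fin N → Y}
    (hω : ∀ j, ω j ∈ P.extremeRays) : P.scenarioValue S n ω ≤ P.semiValue S n := by
  refine P.le_semiValue hreg fun α hα => csInf_le (S.bddBelow_dot n (fun α h => h.2) _)
    (mem_image_of_mem _ ⟨fun j => P.le_dot_AnAdj hα (hω j), hα.2⟩)

/-- The loss of the scenario relaxation is at most `θ_D` times the worst violation of its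
minimizer. -/
theorem semiValue_le_scenarioValue {γ : ℝ} (hreg : P.IsRegular S n γ) {JLB : ℝ}
    (hJLB : JLB ≤ P.semiValue S n) (hgen : P.GeneratedByExtremeRays) {N : ℕ} {ω : Fin N → Y}
    {α : Fin n → ℝ} (h : P.IsUniqueScenarioOptimizer S n ω α) :
    P.semiValue S n ≤ P.scenarioValue S n ω +
      P.θD S n γ JLB * max (P.supportFun (P.b - P.An S n α)) 0 := by
  rw [P.scenarioValue_eq h]
  exact P.semiValue_le_penalty hreg hJLB h.1.2 (le_max_right _ _)
    fun y hy => P.pairing_le_supportFun_mul hgen _ hy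

end InfiniteLP

/-! ### Smooth minimization by the fast gradient method -/

/-- A minimizer of a strongly convex function has quadratic growth. -/
theorem StrongConvexWrt.quadratic_growth {E : Type*} [AddCommGroup E] [Module ℝ E]
    {nrm : E → ℝ} {s : Set E} {m : ℝ} {f : E → ℝ} (hf : StrongConvexWrt nrm s m f)
    {y z : E} (hz : z ∈ s) (hy : y ∈ s) (hmin : ∀ x ∈ s, f z ≤ f x) :
    f z + m / 2 * nrm (y - z) ^ 2 ≤ f y := by
  have key : ∀ t : ℝ, 0 < t → t < 1 → m / 2 * nrm (y - z) ^ 2 * (1 - t) ≤ f y - f z := by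
    intro t ht0 ht1
    have h1 := hf.2 y hy z hz t (1 - t) ht0.le (by linarith) (by ring)
    have h2 := hmin _ (hf.1 hy hz ht0.le (by linarith : 0 ≤ 1 - t) (by ring))
    have h3 : t * (m / 2 * nrm (y - z) ^ 2 * (1 - t)) ≤ t * (f y - f z) := by
      linear_combination h1 + h2
    exact le_of_mul_le_mul_left h3 ht0
  have hlim : Filter.Tendsto (fun t : ℝ => m / 2 * nrm (y - z) ^ 2 * (1 - t))
      (nhdsWithin 0 (Ioi 0)) (nhds (m / 2 * nrm (y - z) ^ 2 * (1 - 0))) :=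
    ((Continuous.tendsto (by fun_prop) 0).mono_left nhdsWithin_le_nhds)
  have := le_of_tendsto hlim (b := f y - f z) (by
    filter_upwards [Ioo_mem_nhdsGT (zero_lt_one' ℝ)] with t ht using key t ht.1 ht.2)
  linarith

namespace Discretization

variable {X : Type*} [NormedAddCommGroup X] [NormedSpace ℝ X] {S : Discretization X} {n : ℕ}

theorem IsT.min_scaled {ϑ l : ℝ} {q α β : Fin n → ℝ} (h : S.IsT n ϑ q α β) (hl : 0 ≤ l)
    {β' : Fin n → ℝ} (hβ' : β' ∈ S.ball n) :
    (l • q) ⬝ᵥ β + l / (2 * ϑ) * S.R n (β - α) ^ 2 ≤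
      (l • q) ⬝ᵥ β' + l / (2 * ϑ) * S.R n (β' - α) ^ 2 := by
  have := mul_le_mul_of_nonneg_left (h.2 β' hβ') hl
  simp only [smul_dotProduct, smul_eq_mul]
  calc _ = l * (q ⬝ᵥ β + 1 / (2 * ϑ) * S.R n (β - α) ^ 2) := by ring
    _ ≤ _ := this
    _ = _ := by ring

/-- A Lipschitz subgradient gives a quadratic upper bound. The increment is estimated along `m`
equal steps of the segment, and `m` tends to infinity, so no derivative is needed. -/
theorem le_quadratic_of_lipschitz_subgradient {f : (Fin n → ℝ) → ℝ}
    {g : (Fin n → ℝ) → Fin n → ℝ} {l : ℝ}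
    (hsub : ∀ α ∈ S.ball n, ∀ α' ∈ S.ball n, f α + (α' - α) ⬝ᵥ g α ≤ f α')
    (hlip : ∀ α ∈ S.ball n, ∀ α' ∈ S.ball n, S.dualR n (g α - g α') ≤ l * S.R n (α - α'))
    {α α' : Fin n → ℝ} (hα : α ∈ S.ball n) (hα' : α' ∈ S.ball n) :
    f α' ≤ f α + (α' - α) ⬝ᵥ g α + l / 2 * S.R n (α' - α) ^ 2 := by
  set h := α' - α with hh
  have hp : ∀ t : ℝ, 0 ≤ t → t ≤ 1 → α + t • h ∈ S.ball n := by
    intro t h0 h1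
    have : α + t • h = (1 - t) • α + t • α' := by rw [hh]; module
    rw [this]
    exact S.convex_ball n hα hα' (by linarith) h0 (by ring)
  have hgrad : ∀ t : ℝ, 0 ≤ t → t ≤ 1 →
      h ⬝ᵥ g (α + t • h) ≤ h ⬝ᵥ g α + l * t * S.R n h ^ 2 := by
    intro t h0 h1
    have h2 := S.dot_le n h (g (α + t • h) - g α)
    have h3 := hlip _ (hp t h0 h1) α hα
    rw [add_sub_cancel_left, map_smul_eq_mul, Real.norm_of_nonneg h0] at h3
    rw [dotProduct_sub] at h2
    have h4 := mul_le_mul_of_nonneg_left h3 (apply_nonneg (S.R n) h)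
    linear_combination h2 + h4
  have key : ∀ m : ℕ, 0 < m → ∀ i : ℕ, i ≤ m → f (α + ((i : ℝ) / m) • h) ≤
      f α + (i / m : ℝ) * (h ⬝ᵥ g α) + l * S.R n h ^ 2 * ((i * (i + 1) : ℝ) / (2 * m ^ 2)) := by
    intro m hm i
    have hm' : (0 : ℝ) < m := by exact_mod_cast hm
    induction i with
    | zero => intro _; simp
    | succ i ih =>
      intro hi
      have ih := ih (by omega)
      have hi' : ((i : ℝ) + 1) / m ≤ 1 := by
        rw [div_le_one hm']; exact_mod_cast hi
      have hi0 : (i : ℝ) / m ≤ 1 := le_trans (by gcongr; linarith) hi'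
      have h0 : (0 : ℝ) ≤ ((i : ℝ) + 1) / m := by positivity
      push_cast
      have h1 := hsub _ (hp _ h0 hi') _ (hp ((i : ℝ) / m) (by positivity) hi0)
      have h2 := hgrad _ h0 hi'
      have h3 : α + ((i : ℝ) / m) • h - (α + (((i : ℝ) + 1) / m) • h) = -(1 / m : ℝ) • h := by
        rw [add_sub_add_left_eq_sub, ← sub_smul]; congr 1; ring
      rw [h3, smul_dotProduct, smul_eq_mul] at h1
      have h4 := mul_le_mul_of_nonneg_left h2 (by positivity : (0 : ℝ) ≤ 1 / m)
      have e1 : l * S.R n h ^ 2 * (((i + 1) * (i + 1 + 1) : ℝ) / (2 * m ^ 2)) =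
          l * S.R n h ^ 2 * ((i * (i + 1) : ℝ) / (2 * m ^ 2)) +
          1 / m * (l * ((i + 1) / m) * S.R n h ^ 2) := by
        field_simp; ring
      have e2 : ((i : ℝ) + 1) / m * (h ⬝ᵥ g α) = i / m * (h ⬝ᵥ g α) + 1 / m * (h ⬝ᵥ g α) := by
        ring
      linarith
  have hlim : Filter.Tendsto
      (fun m : ℕ => f α + h ⬝ᵥ g α + l * S.R n h ^ 2 * (1 / 2 + 1 / 2 * (1 / ((m : ℝ) + 1))))
      Filter.atTop (nhds (f α + h ⬝ᵥ g α + l * S.R n h ^ 2 * (1 / 2 + 1 / 2 * 0))) :=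
    (((tendsto_one_div_add_atTop_nhds_zero_nat).const_mul _).const_add _ |>.const_mul _).const_add _
  have := ge_of_tendsto' hlim (b := f α') fun m => by
    have h1 := key (m + 1) (by omega) (m + 1) le_rfl
    have hm : ((m + 1 : ℕ) : ℝ) ≠ 0 := by positivity
    rw [div_self hm, one_smul, hh, add_sub_cancel, ← hh, one_mul] at h1
    refine h1.trans (le_of_eq ?_)
    push_cast at hm ⊢
    congr 2
    field_simp
  linarith

/-- The strong convexity parameter of `‖·‖² / 2` is at most `1`. -/
theorem strongConvex_param_le_one (hn : 1 ≤ n) {ϑ : ℝ}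
    (hsc : StrongConvexWrt (S.R n) univ ϑ (fun α => 1 / 2 * S.R n α ^ 2)) : ϑ ≤ 1 := by
  set y : Fin n → ℝ := fun _ => 1 with hy
  have hy0 : S.R n y ≠ 0 := fun h => by
    have := congrFun (S.R_definite n y h) ⟨0, hn⟩
    simp [hy] at this
  have h1 := hsc.2 y (mem_univ _) 0 (mem_univ _) (1 / 2) (1 / 2) (by norm_num) (by norm_num)
    (by norm_num)
  simp only [smul_zero, add_zero, sub_zero, map_smul_eq_mul, map_zero] at h1
  rw [Real.norm_of_nonneg (by norm_num)] at h1
  have h2 : 0 < S.R n y ^ 2 := by positivity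
  by_contra h
  nlinarith

/-- The estimate sequence of the fast gradient method: after `k` steps the value of `f` is bounded
by the weighted average of its linear minorants. An arbitrary starting point in the ball costs
`l θ_P² / 2`, which adds to the prox term `l θ_P² / (2 ϑ)`. -/
theorem fast_gradient_estimate (hn : 1 ≤ n) {f : (Fin n → ℝ) → ℝ}
    {g : (Fin n → ℝ) → Fin n → ℝ} {l ϑ : ℝ} (hl : 0 < l) (hϑ : 0 < ϑ)
    (hsub : ∀ α ∈ S.ball n, ∀ α' ∈ S.ball n, f α + (α' - α) ⬝ᵥ g α ≤ f α')
    (hlip : ∀ α ∈ S.ball n, ∀ α' ∈ S.ball n, S.dualR n (g α - g α') ≤ l * S.R n (α - α'))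
    (hsc : StrongConvexWrt (S.R n) univ ϑ (fun α => 1 / 2 * S.R n α ^ 2))
    {w z a : ℕ → Fin n → ℝ} (hw : ∀ k, w k ∈ S.ball n)
    (hz : ∀ k, S.IsT n ϑ (∑ j ∈ Finset.range (k + 1), (((j : ℝ) + 1) / 2) • (l⁻¹ • g (w j))) 0
      (z k))
    (ha : ∀ k, S.IsT n ϑ ((1 / ϑ) • (l⁻¹ • g (w k))) (w k) (a k))
    (hstep : ∀ k : ℕ, w (k + 1) =
      (2 / ((k : ℝ) + 3)) • z k + (((k : ℝ) + 1) / ((k : ℝ) + 3)) • a k)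
    (k : ℕ) {β : Fin n → ℝ} (hβ : β ∈ S.ball n) :
    ((k : ℝ) + 1) * (k + 2) / 4 * f (a k) ≤
      ∑ j ∈ Finset.range (k + 1), ((j : ℝ) + 1) / 2 * (f (w j) + (β - w j) ⬝ᵥ g (w j)) +
        l / ϑ * S.θP n ^ 2 := by
  have hϑ1 := strongConvex_param_le_one hn hsc
  set θ := S.θP n with hθ
  have hRθ : ∀ α ∈ S.ball n, S.R n α ^ 2 ≤ θ ^ 2 := fun α hα =>
    pow_le_pow_left₀ (apply_nonneg _ _) hα 2
  let ψ : ℕ → (Fin n → ℝ) → ℝ := fun k β =>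
    ∑ j ∈ Finset.range (k + 1), ((j : ℝ) + 1) / 2 * (f (w j) + (β - w j) ⬝ᵥ g (w j)) +
      l / ϑ * (1 / 2 * S.R n β ^ 2)
  have hψlin : ∀ k β, ψ k β =
      (∑ j ∈ Finset.range (k + 1), ((j : ℝ) + 1) / 2 * (f (w j) - w j ⬝ᵥ g (w j))) +
      ((l • ∑ j ∈ Finset.range (k + 1), (((j : ℝ) + 1) / 2) • (l⁻¹ • g (w j))) ⬝ᵥ β +
        l / (2 * ϑ) * S.R n (β - 0) ^ 2) := by
    intro k β
    have : (l • ∑ j ∈ Finset.range (k + 1), (((j : ℝ) + 1) / 2) • (l⁻¹ • g (w j))) ⬝ᵥ β =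
        ∑ j ∈ Finset.range (k + 1), ((j : ℝ) + 1) / 2 * (β ⬝ᵥ g (w j)) := by
      rw [smul_dotProduct, sum_dotProduct, smul_eq_mul, Finset.mul_sum]
      refine Finset.sum_congr rfl fun j _ => ?_
      rw [smul_dotProduct, smul_dotProduct, smul_eq_mul, smul_eq_mul, dotProduct_comm β]
      field_simp
    rw [this, ← add_assoc, ← Finset.sum_add_distrib, sub_zero]
    simp only [ψ]
    congr 1
    · refine Finset.sum_congr rfl fun j _ => ?_
      rw [sub_dotProduct]; ring
    · field_simp
  have hψmin : ∀ k, ∀ β ∈ S.ball n, ψ k (z k) ≤ ψ k β := by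
    intro k β hβ
    rw [hψlin, hψlin]
    exact add_le_add_right ((hz k).min_scaled hl.le hβ) _
  have hψconv : ∀ k, StrongConvexWrt (S.R n) (S.ball n) l (ψ k) := by
    intro k
    refine ⟨S.convex_ball n, fun y _ y' _ t t' ht ht' htt => ?_⟩
    have h1 := hsc.2 y (mem_univ _) y' (mem_univ _) t t' ht ht' htt
    have h2 := mul_le_mul_of_nonneg_left h1 (by positivity : 0 ≤ l / ϑ)
    have e1 : l / ϑ * (t * (1 / 2 * S.R n y ^ 2) + t' * (1 / 2 * S.R n y' ^ 2) -
        ϑ / 2 * (t * t') * S.R n (y - y') ^ 2) = t * (l / ϑ * (1 / 2 * S.R n y ^ 2)) +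
        t' * (l / ϑ * (1 / 2 * S.R n y' ^ 2)) - l / 2 * (t * t') * S.R n (y - y') ^ 2 := by
      field_simp
    have e2 : ∑ j ∈ Finset.range (k + 1),
          ((j : ℝ) + 1) / 2 * (f (w j) + (t • y + t' • y' - w j) ⬝ᵥ g (w j)) =
        t * (∑ j ∈ Finset.range (k + 1), ((j : ℝ) + 1) / 2 * (f (w j) + (y - w j) ⬝ᵥ g (w j))) +
        t' * ∑ j ∈ Finset.range (k + 1),
          ((j : ℝ) + 1) / 2 * (f (w j) + (y' - w j) ⬝ᵥ g (w j)) := by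
      rw [Finset.mul_sum, Finset.mul_sum, ← Finset.sum_add_distrib]
      refine Finset.sum_congr rfl fun j _ => ?_
      simp only [sub_dotProduct, add_dotProduct, smul_dotProduct, smul_eq_mul]
      obtain rfl : t' = 1 - t := by linarith
      ring
    simp only [ψ]
    rw [e1] at h2
    rw [e2]
    linarith
  -- the gradient step decreases `f` below its quadratic model at every point of the ball
  have hmodel : ∀ k, ∀ β ∈ S.ball n,
      f (a k) ≤ f (w k) + (β - w k) ⬝ᵥ g (w k) + l / 2 * S.R n (β - w k) ^ 2 := by
    intro k β hβ
    have h1 := le_quadratic_of_lipschitz_subgradient hsub hlip (hw k) (ha k).1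
    have h2 := (ha k).min_scaled (l := l * ϑ) (by positivity) hβ
    have e1 : (l * ϑ) • ((1 / ϑ) • (l⁻¹ • g (w k))) = g (w k) := by
      rw [smul_smul, smul_smul]
      convert one_smul ℝ (g (w k)) using 2
      field_simp
    have e2 : l * ϑ / (2 * ϑ) = l / 2 := by field_simp
    rw [e1, e2, dotProduct_comm _ (a k), dotProduct_comm _ β] at h2
    rw [sub_dotProduct] at h1 ⊢
    linarith
  have key : ∀ k : ℕ, ((k : ℝ) + 1) * (k + 2) / 4 * f (a k) ≤ ψ k (z k) + l / 2 * θ ^ 2 := by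
    intro k
    induction k with
    | zero =>
      have h1 := hmodel 0 _ (hz 0).1
      have h2 : S.R n (z 0 - w 0) ^ 2 ≤ 2 * S.R n (z 0) ^ 2 + 2 * θ ^ 2 := by
        have h3 := map_sub_le_add (S.R n) (z 0) (w 0)
        have h4 := hRθ _ (hw 0)
        have h5 := pow_le_pow_left₀ (apply_nonneg _ _) h3 2
        nlinarith [sq_nonneg (S.R n (z 0) - S.R n (w 0))]
      have h6 : l * S.R n (z 0) ^ 2 ≤ l / ϑ * S.R n (z 0) ^ 2 := by
        gcongr
        rw [le_div_iff₀ hϑ]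
        nlinarith
      have h7 := mul_le_mul_of_nonneg_left h2 hl.le
      simp only [ψ, zero_add, Finset.sum_range_one, Nat.cast_zero]
      linarith
    | succ k ih =>
      set A : ℝ := ((k : ℝ) + 1) * (k + 2) / 4 with hA
      have hA0 : 0 ≤ A := by positivity
      have hk3 : (0 : ℝ) < (k : ℝ) + 3 := by positivity
      set β := z (k + 1) with hβdef
      have hβ : β ∈ S.ball n := (hz (k + 1)).1
      have hgrow := (hψconv k).quadratic_growth (hz k).1 hβ (hψmin k)
      have hrec : ψ (k + 1) β = ψ k β + ((k : ℝ) + 2) / 2 *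
          (f (w (k + 1)) + (β - w (k + 1)) ⬝ᵥ g (w (k + 1))) := by
        simp only [ψ]
        rw [Finset.sum_range_succ _ (k + 1)]
        push_cast
        ring
      have hsub' := mul_le_mul_of_nonneg_left (hsub _ (hw (k + 1)) _ (ha k).1) hA0
      -- the point `u` of the segment from `a k` to `z (k+1)` at which the model is evaluated
      set u : Fin n → ℝ := (2 / ((k : ℝ) + 3)) • β + (((k : ℝ) + 1) / (k + 3)) • a k with hu
      have hub : u ∈ S.ball n :=
        S.convex_ball n hβ (ha k).1 (by positivity) (by positivity) (by field_simp; ring)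
      have hmod := hmodel (k + 1) u hub
      have huw : u - w (k + 1) = (2 / ((k : ℝ) + 3)) • (β - z k) := by
        rw [hstep, hu]; module
      have hcomb : A * ((a k - w (k + 1)) ⬝ᵥ g (w (k + 1))) +
          ((k : ℝ) + 2) / 2 * ((β - w (k + 1)) ⬝ᵥ g (w (k + 1))) =
          (((k : ℝ) + 2) * (k + 3) / 4) * ((u - w (k + 1)) ⬝ᵥ g (w (k + 1))) := by
        rw [hu]
        simp only [sub_dotProduct, add_dotProduct, smul_dotProduct, smul_eq_mul, hA]
        field_simp
        ring
      rw [huw, map_smul_eq_mul, Real.norm_of_nonneg (by positivity : 0 ≤ 2 / ((k : ℝ) + 3)),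
        ← huw] at hmod
      have hA1 : (0 : ℝ) ≤ ((k : ℝ) + 2) * (k + 3) / 4 := by positivity
      have hmod' := mul_le_mul_of_nonneg_left hmod hA1
      have hcoef : ((k : ℝ) + 2) * (k + 3) / 4 *
          (l / 2 * (2 / ((k : ℝ) + 3) * S.R n (β - z k)) ^ 2) ≤
          l / 2 * S.R n (β - z k) ^ 2 := by
        have e : ((k : ℝ) + 2) * (k + 3) / 4 *
          (l / 2 * (2 / ((k : ℝ) + 3) * S.R n (β - z k)) ^ 2) =
          ((k : ℝ) + 2) / (k + 3) * (l / 2 * S.R n (β - z k) ^ 2) := by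
          field_simp
          ring
        rw [e]
        refine mul_le_of_le_one_left (by positivity) ?_
        rw [div_le_one hk3]
        linarith
      have e3 : ((k : ℝ) + 2) * (k + 3) / 4 = A + ((k : ℝ) + 2) / 2 := by rw [hA]; ring
      push_cast
      rw [hrec]
      have e4 : ((k : ℝ) + 1 + 1) * (k + 1 + 2) / 4 * f (a (k + 1)) =
          ((k : ℝ) + 2) * (k + 3) / 4 * f (a (k + 1)) := by ring
      have e5 : ((k : ℝ) + 2) * (k + 3) / 4 * f (w (k + 1)) =
        A * f (w (k + 1)) + ((k : ℝ) + 2) / 2 * f (w (k + 1)) := by rw [e3]; ring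
      rw [e4]
      linarith
  have h1 := key k
  have h2 := hψmin k β hβ
  have h3 := hRθ _ hβ
  have h4 : l / ϑ * (1 / 2 * S.R n β ^ 2) ≤ l / ϑ * (1 / 2 * θ ^ 2) := by gcongr
  have h5 : l / 2 * θ ^ 2 ≤ l / ϑ * (1 / 2 * θ ^ 2) := by
    have : l ≤ l / ϑ := by rw [le_div_iff₀ hϑ]; nlinarith
    nlinarith [sq_nonneg θ]
  simp only [ψ] at h1 h2
  linarith

end Discretization

/-! ### The smoothing error -/

/-- Removing the prox term costs at most `C₀ s (log (c₀ / s) + 1)`. With `φ(s)` the maximum of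
`F - s p`, the increments satisfy `φ(q s) - φ(s) ≤ (1 - q) s p(y_{q s})`; along the geometric
sequence `s q^m` the resulting bounds telescope, and `q` tends to `1` at the end. -/
theorem le_prox_max_add_of_log_le {Y : Type*} {T : Set Y} {F p : Y → ℝ} {y : ℝ → Y}
    (hmem : ∀ s, 0 < s → y s ∈ T)
    (hmax : ∀ s, 0 < s → ∀ y' ∈ T, F y' - s * p y' ≤ F (y s) - s * p (y s))
    {c₀ C₀ : ℝ} (hc : 0 < c₀) (hC : 0 < C₀)
    (hp : ∀ s, 0 < s → p (y s) ≤ C₀ * max (Real.log (c₀ * s⁻¹)) 1)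
    {s : ℝ} (hs : 0 < s) (hlog : 1 ≤ Real.log (c₀ * s⁻¹)) {y' : Y} (hy' : y' ∈ T) :
    F y' ≤ F (y s) - s * p (y s) + C₀ * s * (Real.log (c₀ * s⁻¹) + 1) := by
  set φ : ℝ → ℝ := fun s => F (y s) - s * p (y s) with hφ
  have hlogs : ∀ r, 0 < r → Real.log (c₀ * r⁻¹) = Real.log c₀ - Real.log r := fun r hr => by
    rw [Real.log_mul hc.ne' (inv_ne_zero hr.ne'), Real.log_inv]; ring
  have key : ∀ q : ℝ, 0 < q → q < 1 →
      F y' ≤ φ s + C₀ * s * (Real.log (c₀ * s⁻¹) + 1 / q) := by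
    intro q hq0 hq1
    set Λ := -Real.log q / (1 - q) with hΛ
    have h1q : 0 < 1 - q := by linarith
    have hΛq : Λ ≤ 1 / q := by
      rw [hΛ, div_le_div_iff₀ h1q hq0, ← Real.log_inv]
      have h1 := Real.log_le_sub_one_of_pos (inv_pos.2 hq0)
      have h2 := mul_le_mul_of_nonneg_right h1 hq0.le
      rw [sub_mul, inv_mul_cancel₀ hq0.ne'] at h2
      linarith
    have hΛ0 : 0 ≤ Λ := div_nonneg (neg_nonneg.2 (Real.log_nonpos hq0.le hq1.le)) h1q.le
    let Ψ : ℝ → ℝ := fun r => C₀ * r * (Real.log (c₀ * r⁻¹) + Λ)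
    have hpos : ∀ m : ℕ, 0 < s * q ^ m := fun m => by positivity
    have hle : ∀ m : ℕ, s * q ^ m ≤ s := fun m =>
      mul_le_of_le_one_right hs.le (pow_le_one₀ hq0.le hq1.le)
    have hlogm : ∀ m : ℕ, 1 ≤ Real.log (c₀ * (s * q ^ m)⁻¹) := fun m => by
      rw [hlogs _ (hpos m)]
      rw [hlogs _ hs] at hlog
      linarith [Real.log_le_log (hpos m) (hle m)]
    have hstep : ∀ m : ℕ, φ (s * q ^ (m + 1)) + Ψ (s * q ^ (m + 1)) ≤
        φ (s * q ^ m) + Ψ (s * q ^ m) := by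
      intro m
      have h1 := hp _ (hpos (m + 1))
      rw [max_eq_left (hlogm (m + 1))] at h1
      have h2 := hmax _ (hpos m) _ (hmem _ (hpos (m + 1)))
      set r := s * q ^ m with hr
      have hr0 : 0 < r := hpos m
      have hrq : s * q ^ (m + 1) = q * r := by rw [hr]; ring
      rw [hrq] at h1 h2 ⊢
      have hqr : 0 < q * r := by positivity
      have hlq : Real.log q = -(Λ * (1 - q)) := by rw [hΛ]; field_simp
      have h3 := mul_le_mul_of_nonneg_left h1 (by positivity : 0 ≤ r * (1 - q))
      have h4 : Real.log (c₀ * (q * r)⁻¹) = Real.log (c₀ * r⁻¹) + Λ * (1 - q) := by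
        rw [hlogs _ hqr, hlogs _ hr0, Real.log_mul hq0.ne' hr0.ne', hlq]; ring
      simp only [hφ, Ψ]
      rw [h4] at h3 ⊢
      linear_combination h2 + h3
    have htel : ∀ m : ℕ, φ (s * q ^ m) + Ψ (s * q ^ m) ≤ φ s + Ψ s := by
      intro m
      induction m with
      | zero => simp
      | succ m ih => exact (hstep m).trans ih
    have hΨ0 : ∀ m : ℕ, 0 ≤ Ψ (s * q ^ m) := fun m =>
      mul_nonneg (mul_pos hC (hpos m)).le (by linarith [hlogm m])
    have hbound : ∀ m : ℕ, F y' - s * q ^ m * p y' ≤ φ s + Ψ s := fun m => by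
      linarith [hmax _ (hpos m) _ hy', htel m, hΨ0 m]
    have hlim : Filter.Tendsto (fun m : ℕ => F y' - s * q ^ m * p y') Filter.atTop
        (nhds (F y' - s * 0 * p y')) :=
      (((tendsto_pow_atTop_nhds_zero_of_lt_one hq0.le hq1).const_mul s).mul_const _).const_sub _
    have h1 := le_of_tendsto' hlim hbound
    have h2 : Ψ s ≤ C₀ * s * (Real.log (c₀ * s⁻¹) + 1 / q) :=
      mul_le_mul_of_nonneg_left (by linarith) (by positivity)
    linarith
  have hlim : Filter.Tendsto (fun q : ℝ => φ s + C₀ * s * (Real.log (c₀ * s⁻¹) + 1 / q))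
      (nhdsWithin 1 (Iio 1)) (nhds (φ s + C₀ * s * (Real.log (c₀ * s⁻¹) + 1 / 1))) := by
    refine Filter.Tendsto.mono_left ?_ nhdsWithin_le_nhds
    have : ContinuousAt (fun q : ℝ => φ s + C₀ * s * (Real.log (c₀ * s⁻¹) + 1 / q)) 1 := by
      fun_prop (disch := norm_num)
    exact this
  have := ge_of_tendsto hlim (b := F y') (by
    filter_upwards [Ioo_mem_nhdsLT (zero_lt_one' ℝ)] with q hq using key q hq.1 hq.2)
  simpa using this

/-- The smoothing error without a restriction on the parameter: beyond `c₀ / e` the prox terms are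
bounded by `C₀`, so a single step back to `c₀ / e` suffices. -/
theorem le_prox_max_add {Y : Type*} {T : Set Y} {F p : Y → ℝ} {y : ℝ → Y}
    (hmem : ∀ s, 0 < s → y s ∈ T)
    (hmax : ∀ s, 0 < s → ∀ y' ∈ T, F y' - s * p y' ≤ F (y s) - s * p (y s))
    {c₀ C₀ : ℝ} (hc : 0 < c₀) (hC : 0 < C₀)
    (hp : ∀ s, 0 < s → p (y s) ≤ C₀ * max (Real.log (c₀ * s⁻¹)) 1)
    {s : ℝ} (hs : 0 < s) {y' : Y} (hy' : y' ∈ T) :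
    F y' ≤ F (y s) - s * p (y s) + C₀ * (s + c₀ / Real.exp 1) := by
  have he := Real.exp_pos 1
  rcases le_total 1 (Real.log (c₀ * s⁻¹)) with h | h
  · have h1 := le_prox_max_add_of_log_le hmem hmax hc hC hp hs h hy'
    have h2 : Real.log (c₀ * s⁻¹) ≤ c₀ * s⁻¹ / Real.exp 1 := by
      have := Real.log_le_sub_one_of_pos (x := c₀ * s⁻¹ / Real.exp 1) (by positivity)
      rw [Real.log_div (by positivity) he.ne', Real.log_exp] at this
      linarith
    have h3 : s * Real.log (c₀ * s⁻¹) ≤ c₀ / Real.exp 1 := by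
      refine (mul_le_mul_of_nonneg_left h2 hs.le).trans (le_of_eq ?_)
      field_simp
    have h4 := mul_le_mul_of_nonneg_left h3 hC.le
    linarith
  · set s₁ := c₀ / Real.exp 1 with hs₁
    have hs₁0 : 0 < s₁ := by positivity
    have hl₁ : Real.log (c₀ * s₁⁻¹) = 1 := by
      rw [hs₁, inv_div, mul_div_cancel₀ _ hc.ne', Real.log_exp]
    have hle : s₁ ≤ s := by
      rw [Real.log_le_iff_le_exp (by positivity)] at h
      rw [hs₁, div_le_iff₀ he, mul_comm s]
      rwa [← div_eq_mul_inv, div_le_iff₀ hs] at h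
    have h1 := le_prox_max_add_of_log_le hmem hmax hc hC hp hs₁0 hl₁.ge hy'
    have h2 := hmax s hs _ (hmem s₁ hs₁0)
    have h3 := hp s₁ hs₁0
    rw [hl₁, max_self, mul_one] at h3
    have h4 := mul_le_mul_of_nonneg_left h3 (sub_nonneg.2 hle)
    rw [hl₁] at h1
    linarith

/-- With `s = ε / (2 C₀ M)`, `M = max (2 log (2 c₀ C₀ / ε)) 1`, the smoothing error is at most
`0.84 ε`. The case `M < 1.2` needs the second estimate above. -/
theorem le_prox_max_add_eps {Y : Type*} {T : Set Y} {F p : Y → ℝ} {y : ℝ → Y}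
    (hmem : ∀ s, 0 < s → y s ∈ T) (hp0 : ∀ y ∈ T, 0 ≤ p y)
    (hmax : ∀ s, 0 < s → ∀ y' ∈ T, F y' - s * p y' ≤ F (y s) - s * p (y s))
    {c₀ C₀ : ℝ} (hc : 0 < c₀) (hC : 0 < C₀)
    (hp : ∀ s, 0 < s → p (y s) ≤ C₀ * max (Real.log (c₀ * s⁻¹)) 1)
    {ε η : ℝ} (hε : 0 < ε) (hη : 0 < η)
    (hle : η ≤ ε / (2 * C₀ * max (2 * Real.log (2 * c₀ * C₀ * ε⁻¹)) 1)) {y' : Y} (hy' : y' ∈ T) :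
    F y' ≤ F (y η) - η * p (y η) + 21 / 25 * ε := by
  set u := 2 * c₀ * C₀ * ε⁻¹ with hu
  have hu0 : 0 < u := by positivity
  set M := max (2 * Real.log u) 1 with hM
  have hM1 : 1 ≤ M := le_max_right _ _
  have hM0 : 0 < M := by linarith
  set s := ε / (2 * C₀ * M) with hs
  have hs0 : 0 < s := by positivity
  have hCs : C₀ * s = ε / (2 * M) := by rw [hs]; field_simp
  have hlogu : Real.log u ≤ M / 2 := by linarith [le_max_left (2 * Real.log u) 1]
  have hcs : c₀ * s⁻¹ = u * M := by rw [hs, hu]; field_simp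
  -- the smoothed maximum decreases in the parameter
  have hmono : F (y s) - s * p (y s) ≤ F (y η) - η * p (y η) := by
    have h1 := hmax η hη _ (hmem s hs0)
    have h2 := mul_le_mul_of_nonneg_right hle (hp0 _ (hmem s hs0))
    linarith
  suffices h : F y' ≤ F (y s) - s * p (y s) + 21 / 25 * ε by linarith
  have hsecond : C₀ * (s + c₀ / Real.exp 1) = ε / 2 * (1 / M + u / Real.exp 1) := by
    rw [mul_add, hCs, hu]; field_simp
  rcases le_total (6 / 5) M with h | h
  · rcases le_total 1 (Real.log (c₀ * s⁻¹)) with hl | hl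
    · have h1 := le_prox_max_add_of_log_le hmem hmax hc hC hp hs0 hl hy'
      have h2 : Real.log (c₀ * s⁻¹) + 1 ≤ 3 / 2 * M := by
        rw [hcs, Real.log_mul hu0.ne' hM0.ne']
        linarith [Real.log_le_sub_one_of_pos hM0]
      have h3 : C₀ * s * (Real.log (c₀ * s⁻¹) + 1) ≤ ε / (2 * M) * (3 / 2 * M) := by
        rw [hCs]; gcongr
      have h4 : ε / (2 * M) * (3 / 2 * M) = 3 / 4 * ε := by field_simp; ring
      linarith
    · have h1 := le_prox_max_add hmem hmax hc hC hp hs0 hy'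
      have h2 : c₀ / Real.exp 1 ≤ s := by
        rw [Real.log_le_iff_le_exp (by positivity), ← div_eq_mul_inv, div_le_iff₀ hs0] at hl
        rw [div_le_iff₀ (Real.exp_pos 1)]
        linarith
      have h3 : C₀ * (s + c₀ / Real.exp 1) ≤ C₀ * s * 2 := by
        have := mul_le_mul_of_nonneg_left h2 hC.le
        linarith
      have h4 : C₀ * s * 2 ≤ 21 / 25 * ε := by
        rw [hCs, div_mul_eq_mul_div, div_le_iff₀ (by positivity)]
        nlinarith
      linarith
  · have h1 := le_prox_max_add hmem hmax hc hC hp hs0 hy'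
    have h2 : u ≤ Real.exp (3 / 5) := by
      rw [← Real.log_le_iff_le_exp hu0]; linarith
    have h3 : u / Real.exp 1 ≤ 17 / 25 := by
      have h4 : u / Real.exp 1 ≤ Real.exp (-(2 / 5)) := by
        rw [div_le_iff₀ (Real.exp_pos 1), ← Real.exp_add]
        exact h2.trans_eq (by norm_num)
      refine h4.trans ?_
      rw [Real.exp_neg, inv_le_comm₀ (Real.exp_pos _) (by norm_num)]
      have := Real.quadratic_le_exp_of_nonneg (x := 2 / 5) (by norm_num)
      norm_num at this ⊢
      linarith
    have h4 : 1 / M ≤ 1 := by rw [div_le_one hM0]; exact hM1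
    rw [hsecond] at h1
    have h5 := mul_le_mul_of_nonneg_left (add_le_add h4 h3) (by positivity : 0 ≤ ε / 2)
    linarith

namespace InfiniteLP

variable {X C B Y : Type*}
  [NormedAddCommGroup X] [NormedSpace ℝ X] [AddCommGroup C] [Module ℝ C]
  [NormedAddCommGroup B] [NormedSpace ℝ B] [AddCommGroup Y] [Module ℝ Y]
  {P : InfiniteLP X C B Y} {S : Discretization X} {n : ℕ}

theorem IsAlgorithmRun.w_mem {yη : (Fin n → ℝ) → Y} {η L ϑ : ℝ} {w z a : ℕ → Fin n → ℝ}
    (h : P.IsAlgorithmRun S n yη η L ϑ w z a) (k : ℕ) : w k ∈ S.ball n := by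
  cases k with
  | zero => exact h.init
  | succ k =>
    rw [h.step_w]
    exact S.convex_ball n (h.step_z k).1 (h.step_a k).1 (by positivity) (by positivity)
      (by field_simp; ring)

theorem weightedMean_mem {y : ℕ → Y} {K : PointedCone ℝ Y} (hy : ∀ j, y j ∈ K) (k : ℕ) :
    weightedMean y k ∈ K :=
  sum_mem fun j _ => K.smul_mem (by positivity) (hy j)

/-- The fast gradient method applied to the smoothed penalty function: its value at the last
iterate is close to the dual objective at the weighted mean of the prox maximizers. -/
theorem IsAlgorithmRun.smoothed_le {θ η L ϑ : ℝ} {prox : Y → ℝ}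
    {yη : (Fin n → ℝ) → Y} {w z a : ℕ → Fin n → ℝ}
    (h : P.IsAlgorithmRun S n yη η L ϑ w z a) (hn : 1 ≤ n) (hθP : 0 < S.θP n)
    (hη : 0 < η) (hL : 0 < L) (hϑ : 0 < ϑ)
    (hprox : ∀ y ∈ P.dualBall θ, 0 ≤ prox y)
    (hy : ∀ α ∈ S.ball n, P.IsProxMaximizer S n θ prox η α (yη α))
    (hLip : ∀ α ∈ S.ball n, ∀ α' ∈ S.ball n,
      S.dualR n (P.AnAdj S n (yη α) - P.AnAdj S n (yη α')) ≤ L / η * S.R n (α - α'))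
    (hsc : StrongConvexWrt (S.R n) univ ϑ (fun α => 1 / 2 * S.R n α ^ 2)) (k : ℕ) :
    a k ⬝ᵥ P.cvec S n + (P.pB.pairing (P.b - P.An S n (a k)) (yη (a k)) - η * prox (yη (a k))) ≤
      P.lowerValue S n (weightedMean (fun j => yη (w j)) k) +
        L / η / ϑ * S.θP n ^ 2 / (((k : ℝ) + 1) * (k + 2) / 4) := by
  set f : (Fin n → ℝ) → ℝ := fun α =>
    α ⬝ᵥ P.cvec S n + (P.pB.pairing (P.b - P.An S n α) (yη α) - η * prox (yη α)) with hf
  set g : (Fin n → ℝ) → Fin n → ℝ := fun α => P.cvec S n - P.AnAdj S n (yη α) with hg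
  have hlin : ∀ α β : Fin n → ℝ, f α + (β - α) ⬝ᵥ g α =
      β ⬝ᵥ P.cvec S n + (P.pB.pairing (P.b - P.An S n β) (yη α) - η * prox (yη α)) := by
    intro α β
    simp only [hf, hg, map_sub, LinearMap.sub_apply, pairing_An, sub_dotProduct, dotProduct_sub]
    ring
  have hsub : ∀ α ∈ S.ball n, ∀ α' ∈ S.ball n, f α + (α' - α) ⬝ᵥ g α ≤ f α' := by
    intro α hα α' hα'
    rw [hlin]
    exact add_le_add_right ((hy α' hα').2 _ (hy α hα).1) _
  have hlip : ∀ α ∈ S.ball n, ∀ α' ∈ S.ball n,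
      S.dualR n (g α - g α') ≤ L / η * S.R n (α - α') := by
    intro α hα α' hα'
    have h1 := hLip α' hα' α hα
    rw [map_sub_rev (S.R n)] at h1
    simpa [hg] using h1
  have hw := h.w_mem
  have hinv : (L / η)⁻¹ = η / L := inv_div _ _
  set A : ℝ := ((k : ℝ) + 1) * (k + 2) / 4 with hA
  have hA0 : 0 < A := by positivity
  set ŷ := weightedMean (fun j => yη (w j)) k with hŷ
  have hmean : ∀ v : B, A * P.pB.pairing v ŷ =
      ∑ j ∈ Finset.range (k + 1), ((j : ℝ) + 1) / 2 * P.pB.pairing v (yη (w j)) := by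
    intro v
    rw [hŷ, weightedMean, map_sum, Finset.mul_sum]
    refine Finset.sum_congr rfl fun j _ => ?_
    rw [map_smul, smul_eq_mul, hA]
    field_simp
    ring
  have hsum : ∑ j ∈ Finset.range (k + 1), ((j : ℝ) + 1) / 2 = A := by
    have : ∀ m : ℕ, ∑ j ∈ Finset.range (m + 1), ((j : ℝ) + 1) / 2 =
        ((m : ℝ) + 1) * (m + 2) / 4 := by
      intro m
      induction m with
      | zero => norm_num
      | succ m ih =>
        rw [Finset.sum_range_succ, ih]
        push_cast
        ring
    exact this k
  have hest : ∀ β ∈ S.ball n, A * f (a k) ≤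
      A * (β ⬝ᵥ P.cvec S n + P.pB.pairing (P.b - P.An S n β) ŷ) + L / η / ϑ * S.θP n ^ 2 := by
    intro β hβ
    refine (Discretization.fast_gradient_estimate hn (div_pos hL hη) hϑ hsub hlip hsc hw
      (by simpa [hinv] using h.step_z) (by simpa [hinv] using h.step_a) h.step_w k hβ).trans ?_
    refine add_le_add_left ?_ _
    rw [mul_add, hmean, ← hsum, Finset.sum_mul, ← Finset.sum_add_distrib]
    refine Finset.sum_le_sum fun j _ => ?_
    rw [hlin, ← mul_add]
    refine mul_le_mul_of_nonneg_left ?_ (by positivity)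
    have := mul_nonneg hη.le (hprox _ (hy _ (hw j)).1)
    linarith
  set e := L / η / ϑ * S.θP n ^ 2 with he
  have hdual : S.dualR n (P.AnAdj S n ŷ - P.cvec S n) ≤
      (P.pB.pairing P.b ŷ + e / A - f (a k)) / S.θP n := by
    refine S.dualR_le n fun α hα => ?_
    rw [le_div_iff₀ hθP]
    have hmem : S.θP n • α ∈ S.ball n := by
      change S.R n _ ≤ _
      rw [map_smul_eq_mul, Real.norm_of_nonneg hθP.le]
      exact mul_le_of_le_one_right hθP.le hα
    have h1 := hest _ hmem
    have h2 : f (a k) ≤ (S.θP n • α) ⬝ᵥ P.cvec S n +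
        P.pB.pairing (P.b - P.An S n (S.θP n • α)) ŷ + e / A := by
      refine le_of_mul_le_mul_left ?_ hA0
      rw [mul_add _ _ (e / A), mul_div_cancel₀ _ hA0.ne']
      exact h1
    rw [map_sub, LinearMap.sub_apply, pairing_An, smul_dotProduct, smul_dotProduct, smul_eq_mul,
      smul_eq_mul] at h2
    rw [dotProduct_sub]
    linarith
  rw [le_div_iff₀ hθP] at hdual
  change f (a k) ≤ _
  rw [lowerValue]
  linarith

/-- Convergence of the smoothing algorithm. The smoothing error takes `0.84 ε` of the accuracy, the
optimization error `0.16 ε = 4 / 25 ε`. -/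
theorem IsAlgorithmRun.upperValue_le {θ η L ϑ : ℝ} {prox : Y → ℝ}
    {ystar : ℝ → (Fin n → ℝ) → Y} {w z a : ℕ → Fin n → ℝ}
    (h : P.IsAlgorithmRun S n (ystar η) η L ϑ w z a) (hn : 1 ≤ n) (hθP : 0 < S.θP n)
    (hη : 0 < η) (hL : 0 < L) (hϑ : 0 < ϑ)
    (hprox : ∀ y ∈ P.dualBall θ, 0 ≤ prox y)
    (hy : ∀ s : ℝ, 0 < s → ∀ α ∈ S.ball n, P.IsProxMaximizer S n θ prox s α (ystar s α))
    (hLip : ∀ α ∈ S.ball n, ∀ α' ∈ S.ball n,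
      S.dualR n (P.AnAdj S n (ystar η α) - P.AnAdj S n (ystar η α')) ≤ L / η * S.R n (α - α'))
    (hsc : StrongConvexWrt (S.R n) univ ϑ (fun α => 1 / 2 * S.R n α ^ 2)) {k : ℕ}
    {c₀ C₀ ε : ℝ} (hc : 0 < c₀) (hC : 0 < C₀) (hε : 0 < ε)
    (hlog : ∀ s : ℝ, 0 < s → ∀ α ∈ S.ball n,
      prox (ystar s α) ≤ C₀ * max (Real.log (c₀ * s⁻¹)) 1)
    (hηε : η ≤ ε / (2 * C₀ * max (2 * Real.log (2 * c₀ * C₀ * ε⁻¹)) 1))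
    (hk : 5 * S.θP n * Real.sqrt (L / (ϑ * η * ε)) ≤ (k : ℝ)) :
    P.upperValue S n θ (a k) ≤ P.lowerValue S n (weightedMean (fun j => ystar η (w j)) k) + ε := by
  have ha : a k ∈ S.ball n := (h.step_a k).1
  have h1 := h.smoothed_le hn hθP hη hL hϑ hprox (hy η hη) hLip hsc k
  have h2 : sSup ((fun y => P.pB.pairing (P.b - P.An S n (a k)) y) '' P.dualBall θ) ≤
      P.pB.pairing (P.b - P.An S n (a k)) (ystar η (a k)) - η * prox (ystar η (a k)) +
        21 / 25 * ε := by
    refine csSup_le (Nonempty.image _ ⟨_, (hy η hη _ ha).1⟩) ?_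
    rintro _ ⟨y', hy', rfl⟩
    exact le_prox_max_add_eps (y := fun s => ystar s (a k)) (fun s hs => (hy s hs _ ha).1) hprox
      (fun s hs => (hy s hs _ ha).2) hc hC (fun s hs => hlog s hs _ ha) hε hη hηε hy'
  have h3 : L / η / ϑ * S.θP n ^ 2 / (((k : ℝ) + 1) * (k + 2) / 4) ≤ 4 / 25 * ε := by
    have h4 := pow_le_pow_left₀ (by positivity) hk 2
    rw [mul_pow, Real.sq_sqrt (by positivity)] at h4
    have h5 : (5 * S.θP n) ^ 2 * (L / (ϑ * η * ε)) = 25 / ε * (L / η / ϑ * S.θP n ^ 2) := by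
      field_simp
      ring
    rw [h5, div_mul_eq_mul_div, div_le_iff₀ hε] at h4
    rw [div_le_iff₀ (by positivity)]
    have hk0 : (0 : ℝ) ≤ k := k.cast_nonneg
    nlinarith
  rw [upperValue]
  linarith

end InfiniteLP

/-! ### Binomial tails -/

/-- The lower binomial tail `ℙ[Bin(N, ε) < n]`. -/
def binomTail (n N : ℕ) (ε : ℝ) : ℝ :=
  ∑ i ∈ Finset.range n, (N.choose i : ℝ) * ε ^ i * (1 - ε) ^ (N - i)

theorem binomTail_succ_succ (n N : ℕ) (ε : ℝ) :
    binomTail (n + 1) (N + 1) ε = (1 - ε) * binomTail (n + 1) N ε + ε * binomTail n N ε := by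
  have h : ∀ i : ℕ, ((N + 1).choose (i + 1) : ℝ) * ε ^ (i + 1) * (1 - ε) ^ (N + 1 - (i + 1)) =
      (1 - ε) * ((N.choose (i + 1) : ℝ) * ε ^ (i + 1) * (1 - ε) ^ (N - (i + 1))) +
        ε * ((N.choose i : ℝ) * ε ^ i * (1 - ε) ^ (N - i)) := by
    intro i
    rw [Nat.choose_succ_succ, Nat.add_sub_add_right]
    push_cast
    rcases lt_or_ge i N with h | h
    · rw [show N - i = N - (i + 1) + 1 by omega, pow_succ (1 - ε)]
      ring
    · rw [Nat.choose_eq_zero_of_lt (show N < i + 1 by omega)]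
      push_cast
      ring
  rw [binomTail, binomTail, binomTail, Finset.sum_range_succ', Finset.sum_range_succ' _ n,
    mul_add, Finset.mul_sum, Finset.mul_sum, Finset.sum_congr rfl fun i _ => h i,
    Finset.sum_add_distrib]
  simp [pow_succ]
  ring

theorem binomTail_le_succ (n N : ℕ) {ε : ℝ} (h0 : 0 ≤ ε) (h1 : ε ≤ 1) :
    binomTail n N ε ≤ binomTail (n + 1) N ε := by
  rw [binomTail, binomTail, Finset.sum_range_succ]
  have : 0 ≤ 1 - ε := by linarith
  exact le_add_of_nonneg_right (by positivity)

/-- The tail decreases with the number of trials. -/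
theorem binomTail_antitone (n : ℕ) {ε : ℝ} (h0 : 0 ≤ ε) (h1 : ε ≤ 1) :
    Antitone fun N => binomTail n N ε := by
  refine antitone_nat_of_succ_le fun N => ?_
  cases n with
  | zero => simp [binomTail]
  | succ n =>
    rw [binomTail_succ_succ]
    nlinarith [binomTail_le_succ n N h0 h1]

theorem binomTail_eq_one {n N : ℕ} (h : N < n) (ε : ℝ) : binomTail n N ε = 1 := by
  have h1 := (add_pow ε (1 - ε) N).symm
  rw [add_sub_cancel, one_pow] at h1
  refine Eq.trans ?_ h1
  rw [binomTail]
  refine (Finset.sum_subset (Finset.range_mono h) fun i _ hi => ?_).symm.trans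
    (Finset.sum_congr rfl fun i _ => by ring)
  rw [Finset.mem_range, not_lt] at hi
  rw [Nat.choose_eq_zero_of_lt (by omega)]
  simp

theorem continuous_binomTail (n N : ℕ) : Continuous (binomTail n N) := by
  unfold binomTail; fun_prop

theorem binomTail_zero {n : ℕ} (hn : 1 ≤ n) (N : ℕ) : binomTail n N 0 = 1 := by
  obtain ⟨m, rfl⟩ : ∃ m, n = m + 1 := ⟨n - 1, by omega⟩
  rw [binomTail, Finset.sum_range_succ', Finset.sum_eq_zero fun i _ => by simp]
  simp

theorem binomTail_one {n N : ℕ} (h : n ≤ N) : binomTail n N 1 = 0 := by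
  refine Finset.sum_eq_zero fun i hi => ?_
  rw [Finset.mem_range] at hi
  simp [show N - i ≠ 0 by omega]

theorem hasDerivAt_binomTail (m k : ℕ) (t : ℝ) :
    HasDerivAt (fun t => binomTail (m + 1) (m + 1 + k) (1 - t))
      ((m + 1 + k).choose (m + 1) * ((m + 1) * (1 - t) ^ m * t ^ k)) t := by
  have key : ∀ (N m : ℕ), HasDerivAt (fun t => binomTail (m + 1) N (1 - t))
      (N.choose (m + 1) * ((m + 1) * (1 - t) ^ m * t ^ (N - (m + 1)))) t := by
    intro N m
    induction m with
    | zero =>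
      simp only [binomTail, zero_add, Finset.sum_range_one, Nat.choose_zero_right, Nat.cast_one,
        pow_zero, mul_one, one_mul, sub_sub_cancel, Nat.sub_zero, Nat.choose_one_right,
        Nat.cast_zero]
      exact hasDerivAt_pow N t
    | succ m ih =>
      have h1 : HasDerivAt (fun t : ℝ => (1 - t)) (-1) t := by
        simpa using (hasDerivAt_id t).const_sub 1
      have h2 : HasDerivAt (fun t : ℝ => (N.choose (m + 1) : ℝ) * (1 - t) ^ (m + 1) *
          t ^ (N - (m + 1))) _ t :=
        ((h1.fun_pow (m + 1)).const_mul (N.choose (m + 1) : ℝ)).mul (hasDerivAt_pow (N - (m + 1)) t)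
      have h3 := ih.add h2
      refine (h3.congr_deriv ?_).congr_of_eventuallyEq (Filter.Eventually.of_forall fun s => ?_)
      · have h4 : ((N.choose (m + 1 + 1) : ℝ)) * (m + 1 + 1) =
            N.choose (m + 1) * ((N - (m + 1) : ℕ) : ℝ) := by
          exact_mod_cast Nat.choose_succ_right_eq N (m + 1)
        have h5 : N - (m + 1) - 1 = N - (m + 1 + 1) := by omega
        rw [h5]
        push_cast
        linear_combination (-(1 - t) ^ (m + 1) * t ^ (N - (m + 1 + 1))) * h4
      · simp only [binomTail, Pi.add_apply]
        rw [Finset.sum_range_succ _ (m + 1)]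
        simp
  simpa using key (m + 1 + k) m

/-- The incomplete Beta integral is a binomial tail. -/
theorem integral_beta (m k : ℕ) (s : ℝ) :
    (m + 1 + k).choose (m + 1) * ∫ t in (0 : ℝ)..s, (m + 1) * (1 - t) ^ m * t ^ k =
      binomTail (m + 1) (m + 1 + k) (1 - s) := by
  rw [← intervalIntegral.integral_const_mul,
    intervalIntegral.integral_eq_sub_of_hasDerivAt (fun t _ => hasDerivAt_binomTail m k t)
      (Continuous.intervalIntegrable (by fun_prop) _ _), sub_zero, binomTail_one (by omega),
    sub_zero]

/-! ### Probability measures on the unit interval are determined by their moments -/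

theorem ext_of_moments {P Q : Measure ℝ} [IsFiniteMeasure P] [IsFiniteMeasure Q]
    (hP : ∀ᵐ x ∂P, x ∈ Icc (0 : ℝ) 1) (hQ : ∀ᵐ x ∂Q, x ∈ Icc (0 : ℝ) 1)
    (h : ∀ k : ℕ, ∫ x, x ^ k ∂P = ∫ x, x ^ k ∂Q) : P = Q := by
  have hint : ∀ {μ : Measure ℝ} [IsFiniteMeasure μ], (∀ᵐ x ∂μ, x ∈ Icc (0 : ℝ) 1) →
      ∀ {f : ℝ → ℝ}, Continuous f → Integrable f μ := by
    intro μ _ hμ f hf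
    obtain ⟨K, hK⟩ := (isCompact_Icc (a := (0 : ℝ)) (b := 1)).exists_bound_of_continuousOn
      hf.continuousOn
    exact Integrable.of_bound hf.aestronglyMeasurable K (hμ.mono fun x hx => hK x hx)
  have hpoly : ∀ p : Polynomial ℝ, ∫ x, p.eval x ∂P = ∫ x, p.eval x ∂Q := by
    intro p
    simp only [Polynomial.eval_eq_sum_range]
    rw [integral_finsetSum _ fun i _ => hint hP (by fun_prop),
      integral_finsetSum _ fun i _ => hint hQ (by fun_prop)]
    refine Finset.sum_congr rfl fun i _ => ?_
    rw [integral_const_mul, integral_const_mul, h]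
  refine ext_of_forall_integral_eq_of_IsFiniteMeasure fun f => ?_
  have hclose : ∀ ε > 0, |∫ x, f x ∂P - ∫ x, f x ∂Q| ≤ ε * (P.real univ + Q.real univ) := by
    intro ε hε
    obtain ⟨p, hp⟩ := exists_polynomial_near_of_continuousOn 0 1 f f.continuous.continuousOn ε hε
    have hb : ∀ {μ : Measure ℝ} [IsFiniteMeasure μ], (∀ᵐ x ∂μ, x ∈ Icc (0 : ℝ) 1) →
        |∫ x, p.eval x ∂μ - ∫ x, f x ∂μ| ≤ ε * μ.real univ := by
      intro μ _ hμ
      rw [← integral_sub (hint hμ p.continuous) (hint hμ f.continuous)]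
      exact norm_integral_le_of_norm_le_const (f := fun x => p.eval x - f x)
        (hμ.mono fun x hx => (hp x hx).le)
    have h1 := hb hP
    have h2 := hb hQ
    rw [hpoly] at h1
    rw [abs_le] at h1 h2 ⊢
    constructor <;> linarith
  have hzero : |∫ x, f x ∂P - ∫ x, f x ∂Q| ≤ 0 := by
    refine le_of_forall_pos_le_add fun ε hε => ?_
    set K := P.real univ + Q.real univ with hK
    have hK0 : 0 ≤ K := by positivity
    refine (hclose (ε / (K + 1)) (by positivity)).trans ?_
    rw [zero_add, div_mul_eq_mul_div, div_le_iff₀ (by positivity)]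
    nlinarith
  exact sub_eq_zero.1 (abs_nonpos_iff.1 hzero)

/-! ### Sample compression -/

section Compression

variable {Z : Type*} [MeasurableSpace Z] (ν : Measure Z) [IsProbabilityMeasure ν]

theorem measurePreserving_split {n k M : ℕ} (σ : Fin n ⊕ Fin k ≃ Fin M) :
    MeasurePreserving (fun z : Fin M → Z =>
      ((fun i => z (σ (Sum.inl i)), fun j => z (σ (Sum.inr j))) : (Fin n → Z) × (Fin k → Z)))
      (Measure.pi fun _ => ν) ((Measure.pi fun _ => ν).prod (Measure.pi fun _ => ν)) :=
  (measurePreserving_sumPiEquivProdPi (X := fun _ : Fin n ⊕ Fin k => Z) fun _ => ν).comp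
    (measurePreserving_arrowCongr' (fun _ : Fin M => ν) (fun _ : Fin n ⊕ Fin k => ν) σ.symm
      (MeasurableEquiv.refl Z) fun _ => MeasurePreserving.id ν)

/-- The subtuple of `z` with indices in `I`. -/
def subtuple {n M : ℕ} (I : {I : Finset (Fin M) // I.card = n}) (z : Fin M → Z) : Fin n → Z :=
  fun i => z (I.1.orderEmbOfFin I.2 i)

variable {n : ℕ} {R : (Fin n → Z) → Z → Prop}

/-- Given the subtuple with indices in `I`, the other samples are independent, and each is
compatible with it with the same conditional probability. -/
theorem lintegral_compatible (hR : MeasurableSet {x : (Fin n → Z) × Z | R x.1 x.2}) {k M : ℕ}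
    (hM : M = n + k) (I : {I : Finset (Fin M) // I.card = n}) {g : (Fin n → Z) → ENNReal}
    (hg : Measurable g) :
    MeasurableSet {z : Fin M → Z | ∀ j ∉ I.1, R (subtuple I z) (z j)} ∧
    ∫⁻ z in {z : Fin M → Z | ∀ j ∉ I.1, R (subtuple I z) (z j)}, g (subtuple I z)
        ∂(Measure.pi fun _ => ν) =
      ∫⁻ w, g w * ν {z' | R w z'} ^ k ∂(Measure.pi fun _ => ν) := by
  have hc : I.1ᶜ.card = k := by rw [Finset.card_compl, I.2, Fintype.card_fin]; omega
  let σ : Fin n ⊕ Fin k ≃ Fin M := finSumEquivOfFinset I.2 hc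
  let T : (Fin M → Z) → (Fin n → Z) × (Fin k → Z) := fun z =>
    (fun i => z (σ (Sum.inl i)), fun j => z (σ (Sum.inr j)))
  have hT : MeasurePreserving T (Measure.pi fun _ => ν)
    ((Measure.pi fun _ => ν).prod (Measure.pi fun _ => ν)) := measurePreserving_split ν σ
  have hT1 : ∀ z, (T z).1 = subtuple I z := fun z => by
    funext i
    simp [T, σ, subtuple]
  let E : Set ((Fin n → Z) × (Fin k → Z)) := {x | ∀ j, R x.1 (x.2 j)}
  have hE : MeasurableSet E := by
    have : E = ⋂ j, (fun x : (Fin n → Z) × (Fin k → Z) => (x.1, x.2 j)) ⁻¹'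
        {x : (Fin n → Z) × Z | R x.1 x.2} := by ext; simp [E]
    rw [this]
    refine MeasurableSet.iInter fun j => ?_
    exact (measurable_fst.prodMk ((measurable_pi_apply j).comp measurable_snd)) hR
  have hset : {z : Fin M → Z | ∀ j ∉ I.1, R (subtuple I z) (z j)} = T ⁻¹' E := by
    ext z
    simp only [mem_ofPred_eq, mem_preimage, E, hT1]
    constructor
    · intro h j
      refine h _ ?_
      have := Finset.mem_compl.1 (Finset.orderEmbOfFin_mem I.1ᶜ hc j)
      rwa [← finSumEquivOfFinset_inr I.2 hc] at this
    · intro h j hj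
      have hj' : j ∈ I.1ᶜ := Finset.mem_compl.2 hj
      rw [← Finset.mem_coe, ← Finset.range_orderEmbOfFin I.1ᶜ hc] at hj'
      obtain ⟨i, rfl⟩ := hj'
      simpa [T, σ] using h i
  rw [hset]
  refine ⟨hT.measurable hE, ?_⟩
  have h1 : ∀ z, (T ⁻¹' E).indicator (fun z => g (subtuple I z)) z =
      E.indicator (fun x => g x.1) (T z) := by
    intro z
    by_cases h : T z ∈ E
    · rw [indicator_of_mem (show z ∈ T ⁻¹' E from h), indicator_of_mem h, hT1]
    · rw [indicator_of_notMem (show z ∉ T ⁻¹' E from h), indicator_of_notMem h]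
  have hmeas : Measurable (E.indicator fun x : (Fin n → Z) × (Fin k → Z) => g x.1) :=
    (hg.comp measurable_fst).indicator hE
  rw [← lintegral_indicator (hT.measurable hE), lintegral_congr h1, hT.lintegral_comp hmeas,
    lintegral_prod _ hmeas.aemeasurable]
  refine lintegral_congr fun w => ?_
  have hpi : {v : Fin k → Z | ∀ j, R w (v j)} = univ.pi fun _ => {z' | R w z'} := by
    ext; simp
  have hm : MeasurableSet {v : Fin k → Z | ∀ j, R w (v j)} :=
    (measurable_const.prodMk measurable_id) hE
  have h2 : ∀ v : Fin k → Z, E.indicator (fun x => g x.1) (w, v) =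
      {v : Fin k → Z | ∀ j, R w (v j)}.indicator (fun _ => g w) v := fun v => by
    simp only [indicator, E, mem_ofPred_eq]
  rw [lintegral_congr h2, lintegral_indicator hm, lintegral_const, Measure.restrict_apply_univ,
    hpi, Measure.pi_pi, Finset.prod_const, Finset.card_univ, Fintype.card_fin]

/-- If for every sample size exactly one `n`-subset is compatible with the rest of the sample, the
moments of the conditional probability of compatibility are those of a Beta law. -/
theorem choose_mul_moment (hR : MeasurableSet {x : (Fin n → Z) × Z | R x.1 x.2})
    (huniq : ∀ M : ℕ, n ≤ M → ∀ᵐ z ∂(Measure.pi fun _ : Fin M => ν),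
      ∃! I : {I : Finset (Fin M) // I.card = n}, ∀ j ∉ I.1, R (subtuple I z) (z j)) (k : ℕ) :
    ((n + k).choose n : ENNReal) *
      ∫⁻ w, ν {z' | R w z'} ^ k ∂(Measure.pi fun _ : Fin n => ν) = 1 := by
  classical
  let E : {I : Finset (Fin (n + k)) // I.card = n} → Set (Fin (n + k) → Z) := fun I =>
    {z | ∀ j ∉ I.1, R (subtuple I z) (z j)}
  have hE := fun I => lintegral_compatible ν hR (k := k) rfl I (g := fun _ => 1) measurable_const
  have h1 : ∀ᵐ z ∂(Measure.pi fun _ : Fin (n + k) => ν),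
      ∑ I, (E I).indicator (fun _ => (1 : ENNReal)) z = 1 := by
    filter_upwards [huniq (n + k) (by omega)] with z hz
    obtain ⟨I, hI, hI'⟩ := hz
    rw [Finset.sum_eq_single I]
    · exact indicator_of_mem (show z ∈ E I from hI) _
    · intro J _ hJ
      exact indicator_of_notMem (fun h : z ∈ E J => hJ (hI' J h)) _
    · simp
  have h2 := lintegral_congr_ae h1
  rw [lintegral_finsetSum _ fun I _ => (measurable_const.indicator (hE I).1), lintegral_one,
    measure_univ] at h2
  rw [← h2]
  have h3 : ∀ I, ∫⁻ z, (E I).indicator (fun _ => (1 : ENNReal)) z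
      ∂(Measure.pi fun _ : Fin (n + k) => ν) =
      ∫⁻ w, ν {z' | R w z'} ^ k ∂(Measure.pi fun _ : Fin n => ν) := by
    intro I
    rw [lintegral_indicator (hE I).1, (hE I).2]
    simp
  rw [Finset.sum_congr rfl fun I _ => h3 I, Finset.sum_const, Finset.card_univ,
    Fintype.card_finset_len, Fintype.card_fin, nsmul_eq_mul]

end Compression

section Compression

variable {Z : Type*} [MeasurableSpace Z] (ν : Measure Z) [IsProbabilityMeasure ν]

/-- The law with density `(m + 1) (1 - t) ^ m` on the unit interval. -/
def betaLaw (m : ℕ) : Measure ℝ :=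
  (volume.restrict (Icc 0 1)).withDensity fun t => ENNReal.ofReal ((m + 1) * (1 - t) ^ m)

theorem lintegral_betaLaw (m : ℕ) {f : ℝ → ENNReal} (hf : Measurable f) :
    ∫⁻ t, f t ∂betaLaw m =
      ∫⁻ t in Icc (0 : ℝ) 1, ENNReal.ofReal ((m + 1) * (1 - t) ^ m) * f t :=
  lintegral_withDensity_eq_lintegral_mul _ (by fun_prop) hf

theorem ae_betaLaw (m : ℕ) : ∀ᵐ t ∂betaLaw m, t ∈ Icc (0 : ℝ) 1 :=
  (withDensity_absolutelyContinuous _ _).ae_le (ae_restrict_mem measurableSet_Icc)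

theorem choose_mul_lintegral_betaLaw (m k : ℕ) {s : ℝ} (hs0 : 0 ≤ s) (hs1 : s ≤ 1) :
    ((m + 1 + k).choose (m + 1) : ENNReal) *
      ∫⁻ t, (Iio s).indicator (fun t => ENNReal.ofReal t ^ k) t ∂betaLaw m =
      ENNReal.ofReal (binomTail (m + 1) (m + 1 + k) (1 - s)) := by
  have hmeas : Measurable ((Iio s).indicator fun t : ℝ => ENNReal.ofReal t ^ k) :=
    (by fun_prop : Measurable fun t : ℝ => ENNReal.ofReal t ^ k).indicator measurableSet_Iio
  have h1 : ∫⁻ t, (Iio s).indicator (fun t => ENNReal.ofReal t ^ k) t ∂betaLaw m =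
      ∫⁻ t in Ico (0 : ℝ) s, ENNReal.ofReal ((m + 1) * (1 - t) ^ m * t ^ k) := by
    rw [lintegral_betaLaw m hmeas, ← lintegral_indicator measurableSet_Icc,
      ← lintegral_indicator measurableSet_Ico]
    refine lintegral_congr fun t => ?_
    by_cases h : t ∈ Ico (0 : ℝ) s
    · have h' : t ∈ Icc (0 : ℝ) 1 := ⟨h.1, h.2.le.trans hs1⟩
      rw [indicator_of_mem h, indicator_of_mem h', indicator_of_mem (show t ∈ Iio s from h.2),
        ← ENNReal.ofReal_pow h.1, ← ENNReal.ofReal_mul]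
      have := sub_nonneg.2 h'.2
      positivity
    · rw [indicator_of_notMem h]
      by_cases h' : t ∈ Icc (0 : ℝ) 1
      · rw [indicator_of_mem h', indicator_of_notMem (fun hs : t ∈ Iio s => h ⟨h'.1, hs⟩), mul_zero]
      · rw [indicator_of_notMem h']
  rw [h1, ← integral_beta, intervalIntegral.integral_of_le hs0, ← integral_Ico_eq_integral_Ioc,
    ENNReal.ofReal_mul (Nat.cast_nonneg _), ENNReal.ofReal_natCast,
    ofReal_integral_eq_lintegral_ofReal]
  · exact ((by fun_prop : Continuous fun t : ℝ => (m + 1) * (1 - t) ^ m * t ^ k).integrableOn_Icc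
      (a := 0) (b := s)).mono_set Ico_subset_Icc_self
  · filter_upwards [ae_restrict_mem measurableSet_Ico] with t ht
    have h2 : 0 ≤ 1 - t := by linarith [ht.2]
    have h3 := ht.1
    simp only [Pi.zero_apply]
    positivity

theorem choose_mul_moment_betaLaw (m k : ℕ) :
    ((m + 1 + k).choose (m + 1) : ENNReal) * ∫⁻ t, ENNReal.ofReal t ^ k ∂betaLaw m = 1 := by
  have h := choose_mul_lintegral_betaLaw m k zero_le_one le_rfl
  rw [sub_self, binomTail_zero (by omega), ENNReal.ofReal_one] at h
  rw [← h]
  congr 1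
  refine lintegral_congr_ae ?_
  have h1 : ∀ᵐ t ∂betaLaw m, t ≠ 1 := by
    refine (withDensity_absolutelyContinuous _ _).ae_le (ae_restrict_of_ae ?_)
    exact Measure.ae_ne volume 1
  filter_upwards [ae_betaLaw m, h1] with t ht ht1
  rw [indicator_of_mem (show t ∈ Iio 1 from lt_of_le_of_ne ht.2 ht1)]

instance (m : ℕ) : IsProbabilityMeasure (betaLaw m) := by
  constructor
  have := choose_mul_moment_betaLaw m 0
  simpa using this

variable {m : ℕ} {R : (Fin (m + 1) → Z) → Z → Prop}

/-- Exact compression to `m + 1` samples forces the conditional probability of compatibility to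
have a Beta law. -/
theorem map_compatible_eq_betaLaw (hR : MeasurableSet {x : (Fin (m + 1) → Z) × Z | R x.1 x.2})
    (huniq : ∀ M : ℕ, m + 1 ≤ M → ∀ᵐ z ∂(Measure.pi fun _ : Fin M => ν),
      ∃! I : {I : Finset (Fin M) // I.card = m + 1}, ∀ j ∉ I.1, R (subtuple I z) (z j)) :
    Measure.map (fun w => ν.real {z' | R w z'}) (Measure.pi fun _ : Fin (m + 1) => ν) =
      betaLaw m := by
  have hp : Measurable fun w => ν {z' | R w z'} := measurable_measure_prodMk_left hR
  have hpr : Measurable fun w => ν.real {z' | R w z'} := hp.ennreal_toReal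
  have : IsProbabilityMeasure (Measure.map (fun w => ν.real {z' | R w z'})
      (Measure.pi fun _ : Fin (m + 1) => ν)) := Measure.isProbabilityMeasure_map hpr.aemeasurable
  refine ext_of_moments ?_ (ae_betaLaw m) fun k => ?_
  · refine (ae_map_iff hpr.aemeasurable (p := fun x => x ∈ Icc (0 : ℝ) 1) measurableSet_Icc).2 ?_
    exact Filter.Eventually.of_forall fun w => ⟨measureReal_nonneg, measureReal_le_one⟩
  · have hC : ((m + 1 + k).choose (m + 1) : ENNReal) ≠ 0 := by
      exact_mod_cast (Nat.choose_pos (by omega)).ne'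
    have hC' : ((m + 1 + k).choose (m + 1) : ENNReal) ≠ ⊤ := ENNReal.natCast_ne_top _
    have h1 := choose_mul_moment ν hR huniq k
    have h2 := choose_mul_moment_betaLaw m k
    have h3 := (ENNReal.mul_right_inj hC hC').1 (h1.trans h2.symm)
    rw [integral_map hpr.aemeasurable (by fun_prop)]
    have e1 : ∀ w, ν.real {z' | R w z'} ^ k = (ν {z' | R w z'} ^ k).toReal := fun w => by
      rw [ENNReal.toReal_pow]; rfl
    rw [integral_congr_ae (Filter.Eventually.of_forall e1),
      integral_toReal (hp.pow_const k).aemeasurable (Filter.Eventually.of_forall fun w =>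
        ENNReal.pow_lt_top (measure_lt_top _ _)), h3,
      ← integral_toReal (by fun_prop) (Filter.Eventually.of_forall fun w =>
        ENNReal.pow_lt_top ENNReal.ofReal_lt_top)]
    refine integral_congr_ae ?_
    filter_upwards [ae_betaLaw m] with t ht
    rw [ENNReal.toReal_pow, ENNReal.toReal_ofReal ht.1]

/-- The generalization bound of an exact compression scheme. -/
theorem measure_compression_le (hR : MeasurableSet {x : (Fin (m + 1) → Z) × Z | R x.1 x.2})
    (huniq : ∀ M : ℕ, m + 1 ≤ M → ∀ᵐ z ∂(Measure.pi fun _ : Fin M => ν),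
      ∃! I : {I : Finset (Fin M) // I.card = m + 1}, ∀ j ∉ I.1, R (subtuple I z) (z j))
    {N : ℕ} (hN : m + 1 ≤ N) {ε : ℝ} (h0 : 0 ≤ ε) (h1 : ε ≤ 1) :
    (Measure.pi fun _ : Fin N => ν) {z | ∃ I : {I : Finset (Fin N) // I.card = m + 1},
      (∀ j ∉ I.1, R (subtuple I z) (z j)) ∧ ε < ν.real {z' | ¬ R (subtuple I z) z'}} ≤
      ENNReal.ofReal (binomTail (m + 1) N ε) := by
  classical
  obtain ⟨k, rfl⟩ := Nat.exists_eq_add_of_le hN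
  have hp : Measurable fun w => ν {z' | R w z'} := measurable_measure_prodMk_left hR
  have hpr : Measurable fun w => ν.real {z' | R w z'} := hp.ennreal_toReal
  let G : Set (Fin (m + 1) → Z) := {w | ν.real {z' | R w z'} < 1 - ε}
  have hG : MeasurableSet G := measurableSet_lt hpr measurable_const
  have hg : Measurable (G.indicator fun _ => (1 : ENNReal)) := measurable_const.indicator hG
  have hsub : {z : Fin (m + 1 + k) → Z | ∃ I : {I : Finset (Fin (m + 1 + k)) // I.card = m + 1},
      (∀ j ∉ I.1, R (subtuple I z) (z j)) ∧ ε < ν.real {z' | ¬ R (subtuple I z) z'}} ⊆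
      ⋃ I : {I : Finset (Fin (m + 1 + k)) // I.card = m + 1},
        {z | ∀ j ∉ I.1, R (subtuple I z) (z j)} ∩ subtuple I ⁻¹' G := by
    rintro z ⟨I, hI, hI'⟩
    refine mem_iUnion.2 ⟨I, hI, ?_⟩
    have hm : MeasurableSet {z' | R (subtuple I z) z'} :=
      (measurable_const.prodMk measurable_id) hR
    have hc : ν.real {z' | ¬ R (subtuple I z) z'} = 1 - ν.real {z' | R (subtuple I z) z'} :=
      probReal_compl_eq_one_sub hm
    change ν.real {z' | R (subtuple I z) z'} < 1 - ε
    linarith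
  refine (measure_mono hsub).trans ((measure_iUnion_fintype_le _ _).trans ?_)
  have hterm : ∀ I : {I : Finset (Fin (m + 1 + k)) // I.card = m + 1},
      (Measure.pi fun _ : Fin (m + 1 + k) => ν)
        ({z | ∀ j ∉ I.1, R (subtuple I z) (z j)} ∩ subtuple I ⁻¹' G) =
      ∫⁻ t, (Iio (1 - ε)).indicator (fun t => ENNReal.ofReal t ^ k) t ∂betaLaw m := by
    intro I
    obtain ⟨hE, hint⟩ := lintegral_compatible ν hR (k := k) rfl I hg
    have hst : Measurable (subtuple (Z := Z) I) := by unfold subtuple; fun_prop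
    rw [← map_compatible_eq_betaLaw ν hR huniq, lintegral_map
      ((by fun_prop : Measurable fun t : ℝ => ENNReal.ofReal t ^ k).indicator measurableSet_Iio)
      hpr, inter_comm, ← Measure.restrict_apply (hst hG), ← lintegral_indicator_one (hst hG)]
    refine Eq.trans ?_ (hint.trans (lintegral_congr fun w => ?_))
    · rfl
    · by_cases h : w ∈ G
      · rw [indicator_of_mem h, indicator_of_mem (show ν.real _ ∈ Iio (1 - ε) from h), one_mul,
          Measure.real, ENNReal.ofReal_toReal (measure_ne_top _ _)]
      · rw [indicator_of_notMem h, indicator_of_notMem (show ν.real _ ∉ Iio (1 - ε) from h),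
          zero_mul]
  rw [Finset.sum_congr rfl fun I _ => hterm I, Finset.sum_const, Finset.card_univ,
    Fintype.card_finset_len, Fintype.card_fin, nsmul_eq_mul,
    choose_mul_lintegral_betaLaw m k (by linarith) (by linarith), sub_sub_cancel]

end Compression

/-! ### Convex programs with random half-space constraints -/

/-- A strictly convex program over a compact convex set in `ℝⁿ`, with constraints
`level z ≤ normal z ⬝ᵥ x` indexed by `z ∈ Z`. The point `center` satisfies all constraints. The
numbers `mark z` rank the constraints; they are used to complete a set of support constraints to
a set of exactly `n` constraints. -/
structure ConvexScenario (n : ℕ) (Z : Type*) [MeasurableSpace Z] where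
  dom : Set (Fin n → ℝ)
  isCompact_dom : IsCompact dom
  convex_dom : Convex ℝ dom
  obj : (Fin n → ℝ) → ℝ
  continuous_obj : Continuous obj
  strictConvexOn_obj : StrictConvexOn ℝ univ obj
  normal : Z → Fin n → ℝ
  measurable_normal : Measurable normal
  level : Z → ℝ
  measurable_level : Measurable level
  center : Fin n → ℝ
  center_mem : center ∈ dom
  level_le : ∀ z, level z ≤ normal z ⬝ᵥ center
  mark : Z → ℝ
  measurable_mark : Measurable mark

namespace ConvexScenario

variable {n : ℕ} {Z : Type*} [MeasurableSpace Z] (Q : ConvexScenario n Z) {ι : Type*}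

/-- The points that satisfy the constraints with indices in `J`. -/
def feas (z : ι → Z) (J : Finset ι) : Set (Fin n → ℝ) :=
  {x | x ∈ Q.dom ∧ ∀ j ∈ J, Q.level (z j) ≤ Q.normal (z j) ⬝ᵥ x}

theorem continuous_dotProduct_right (v : Fin n → ℝ) : Continuous fun x : Fin n → ℝ => v ⬝ᵥ x := by
  unfold dotProduct; fun_prop

theorem isCompact_feas (z : ι → Z) (J : Finset ι) : IsCompact (Q.feas z J) := by
  have : Q.feas z J = Q.dom ∩ ⋂ j ∈ J, {x | Q.level (z j) ≤ Q.normal (z j) ⬝ᵥ x} := by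
    ext; simp [feas]
  rw [this]
  exact Q.isCompact_dom.inter_right (isClosed_biInter fun j _ =>
    isClosed_le continuous_const (continuous_dotProduct_right _))

theorem convex_halfSpace (v : Fin n → ℝ) (r : ℝ) : Convex ℝ {x : Fin n → ℝ | r ≤ v ⬝ᵥ x} :=
  convex_halfSpace_ge ⟨fun x y => dotProduct_add v x y, fun c x => dotProduct_smul c v x⟩ r

theorem convex_feas (z : ι → Z) (J : Finset ι) : Convex ℝ (Q.feas z J) := by
  have : Q.feas z J = Q.dom ∩ ⋂ j ∈ J, {x | Q.level (z j) ≤ Q.normal (z j) ⬝ᵥ x} := by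
    ext; simp [feas]
  rw [this]
  exact Q.convex_dom.inter (convex_iInter₂ fun j _ => convex_halfSpace _ _)

theorem center_mem_feas (z : ι → Z) (J : Finset ι) : Q.center ∈ Q.feas z J :=
  ⟨Q.center_mem, fun _ _ => Q.level_le _⟩

theorem exists_minimizer (z : ι → Z) (J : Finset ι) :
    ∃ x ∈ Q.feas z J, ∀ y ∈ Q.feas z J, Q.obj x ≤ Q.obj y := by
  obtain ⟨x, hx, hmin⟩ := (Q.isCompact_feas z J).exists_isMinOn ⟨_, Q.center_mem_feas z J⟩
    Q.continuous_obj.continuousOn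
  exact ⟨x, hx, fun y hy => hmin hy⟩

/-- The minimizer under the constraints with indices in `J`. -/
def sol (z : ι → Z) (J : Finset ι) : Fin n → ℝ := (Q.exists_minimizer z J).choose

theorem sol_mem (z : ι → Z) (J : Finset ι) : Q.sol z J ∈ Q.feas z J :=
  (Q.exists_minimizer z J).choose_spec.1

theorem obj_sol_le {z : ι → Z} {J : Finset ι} {y : Fin n → ℝ} (hy : y ∈ Q.feas z J) :
    Q.obj (Q.sol z J) ≤ Q.obj y :=
  (Q.exists_minimizer z J).choose_spec.2 y hy

/-- Strict convexity: the minimizer is unique. -/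
theorem eq_sol {z : ι → Z} {J : Finset ι} {x : Fin n → ℝ} (hx : x ∈ Q.feas z J)
    (h : Q.obj x ≤ Q.obj (Q.sol z J)) : x = Q.sol z J := by
  by_contra hne
  have h1 := Q.strictConvexOn_obj.2 (mem_univ x) (mem_univ (Q.sol z J)) hne
    (by norm_num : (0 : ℝ) < 1 / 2) (by norm_num : (0 : ℝ) < 1 / 2) (by norm_num)
  have h2 := Q.obj_sol_le (Q.convex_feas z J hx (Q.sol_mem z J)
    (by norm_num : (0 : ℝ) ≤ 1 / 2) (by norm_num : (0 : ℝ) ≤ 1 / 2) (by norm_num))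
  simp only [smul_eq_mul] at h1
  linarith

theorem sol_congr {κ : Type*} {z : ι → Z} {J : Finset ι} {t : κ → Z} {K : Finset κ}
    (h : Q.feas t K = Q.feas z J) : Q.sol t K = Q.sol z J :=
  Q.eq_sol (h ▸ Q.sol_mem t K) (Q.obj_sol_le (h ▸ Q.sol_mem z J))

theorem feas_anti (z : ι → Z) {J J' : Finset ι} (h : J ⊆ J') : Q.feas z J' ⊆ Q.feas z J :=
  fun _ hx => ⟨hx.1, fun j hj => hx.2 j (h hj)⟩

/-- Constraints satisfied by the minimizer do not change it. -/
theorem sol_eq_of_mem {z : ι → Z} {J J' : Finset ι} (h : J ⊆ J') (hm : Q.sol z J ∈ Q.feas z J') :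
    Q.sol z J' = Q.sol z J :=
  Q.eq_sol (Q.feas_anti z h (Q.sol_mem z J')) (Q.obj_sol_le hm)

theorem sol_eq_of_between {z : ι → Z} {J J' J'' : Finset ι} (h : J ⊆ J') (h' : J' ⊆ J'')
    (he : Q.sol z J = Q.sol z J'') : Q.sol z J' = Q.sol z J'' := by
  rw [← he]
  refine Q.sol_eq_of_mem h ?_
  rw [he]
  exact Q.feas_anti z h' (Q.sol_mem z J'')

theorem sol_comp {κ : Type*} (z : ι → Z) (e : κ ↪ ι) (K : Finset κ) :
    Q.sol (fun i => z (e i)) K = Q.sol z (K.map e) :=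
  Q.sol_congr (by ext; simp [feas])

theorem sol_update [DecidableEq ι] (z : ι → Z) {J : Finset ι} {j : ι} (hj : j ∉ J) (z' : Z) :
    Q.sol (Function.update z j z') J = Q.sol z J := by
  refine Q.sol_congr ?_
  ext x
  refine and_congr_right fun _ => forall₂_congr fun i hi => ?_
  have hij : i ≠ j := fun h => hj (h ▸ hi)
  rw [Function.update_of_ne hij]


/-- A constraint that is not tight at the minimizer can be removed. -/
theorem sol_erase_of_lt [DecidableEq ι] {z : ι → Z} {J : Finset ι} {j : ι}
    (h : Q.level (z j) < Q.normal (z j) ⬝ᵥ Q.sol z J) : Q.sol z (J.erase j) = Q.sol z J := by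
  set x := Q.sol z J with hx
  set y := Q.sol z (J.erase j) with hy
  by_contra hne
  have hxe : x ∈ Q.feas z (J.erase j) := Q.feas_anti z (Finset.erase_subset _ _) (Q.sol_mem z J)
  have hobj : Q.obj y ≤ Q.obj x := Q.obj_sol_le hxe
  -- close to `x`, the segment from `x` to `y` remains feasible
  have hcont : Continuous fun s : ℝ => Q.normal (z j) ⬝ᵥ ((1 - s) • x + s • y) :=
    (continuous_dotProduct_right _).comp (by fun_prop)
  have hev : ∀ᶠ s in nhdsWithin (0 : ℝ) (Ioi 0),
      Q.level (z j) < Q.normal (z j) ⬝ᵥ ((1 - s) • x + s • y) := by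
    refine nhdsWithin_le_nhds (hcont.continuousAt.eventually (lt_mem_nhds ?_))
    simpa using h
  obtain ⟨s, hs, hs0, hs1⟩ := (hev.and (Ioo_mem_nhdsGT (zero_lt_one' ℝ))).exists
  have hseg : (1 - s) • x + s • y ∈ Q.feas z (J.erase j) :=
    Q.convex_feas z _ hxe (Q.sol_mem z _) (by linarith) hs0.le (by ring)
  have hmem : (1 - s) • x + s • y ∈ Q.feas z J := by
    refine ⟨hseg.1, fun i hi => ?_⟩
    by_cases hij : i = j
    · rw [hij]; exact hs.le
    · exact hseg.2 i (Finset.mem_erase.2 ⟨hij, hi⟩)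
  have h1 := Q.obj_sol_le hmem
  have h2 := Q.strictConvexOn_obj.2 (mem_univ x) (mem_univ y) (Ne.symm hne)
    (by linarith : 0 < 1 - s) hs0 (by ring)
  simp only [smul_eq_mul] at h2
  nlinarith

/-- Helly's theorem: the minimizer is determined by at most `n` constraints. -/
theorem exists_basis (z : ι → Z) (J : Finset ι) :
    ∃ B ⊆ J, B.card ≤ n ∧ Q.sol z B = Q.sol z J := by
  classical
  by_contra! hcon
  set r := Q.obj (Q.sol z J) with hr
  let F : Option ι → Set (Fin n → ℝ) := fun o =>
    o.elim {x | x ∈ Q.dom ∧ Q.obj x < r} fun j => {x | x ∈ Q.dom ∧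
      Q.level (z j) ≤ Q.normal (z j) ⬝ᵥ x}
  have hconv : ∀ o ∈ J.insertNone, Convex ℝ (F o) := by
    intro o _
    cases o with
    | none =>
      have := (Q.strictConvexOn_obj.convexOn.subset (subset_univ _) Q.convex_dom).convex_lt r
      exact this
    | some j => exact Q.convex_dom.inter (convex_halfSpace _ _)
  have hinter : ∀ I ⊆ J.insertNone, I.card ≤ Module.finrank ℝ (Fin n → ℝ) + 1 →
      (⋂ o ∈ I, F o).Nonempty := by
    intro I hI hcard
    rw [Module.finrank_fin_fun] at hcard
    by_cases hnone : none ∈ I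
    · set B := I.eraseNone with hB
      have hBJ : B ⊆ J := by
        intro j hj
        have := hI (Finset.mem_eraseNone.1 hj)
        simpa using this
      have hBc : B.card ≤ n := by
        have := Finset.card_eraseNone_eq_card_erase I
        rw [Finset.card_erase_of_mem hnone, ← hB] at this
        omega
      have hlt : Q.obj (Q.sol z B) < r := by
        refine lt_of_le_of_ne (Q.obj_sol_le (Q.feas_anti z hBJ (Q.sol_mem z J))) fun he => ?_
        exact hcon B hBJ hBc
          (Q.eq_sol (Q.feas_anti z hBJ (Q.sol_mem z J)) he.ge).symm
      refine ⟨Q.sol z B, mem_iInter₂.2 fun o ho => ?_⟩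
      cases o with
      | none => exact ⟨(Q.sol_mem z B).1, hlt⟩
      | some j => exact ⟨(Q.sol_mem z B).1, (Q.sol_mem z B).2 j (Finset.mem_eraseNone.2 ho)⟩
    · refine ⟨Q.center, mem_iInter₂.2 fun o ho => ?_⟩
      cases o with
      | none => exact absurd ho hnone
      | some j => exact ⟨Q.center_mem, Q.level_le _⟩
  obtain ⟨x, hx⟩ := Convex.helly_theorem' hconv hinter
  rw [mem_iInter₂] at hx
  have h0 := hx none (by simp)
  have hmem : x ∈ Q.feas z J := ⟨h0.1, fun j hj => (hx (some j) (by simpa using hj)).2⟩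
  exact absurd (Q.obj_sol_le hmem) (not_le.2 h0.2)

/-- The support constraints: those whose removal changes the minimizer. -/
def supp [DecidableEq ι] (z : ι → Z) (J : Finset ι) : Finset ι := by
  classical exact J.filter fun i => Q.sol z (J.erase i) ≠ Q.sol z J

theorem mem_supp [DecidableEq ι] {z : ι → Z} {J : Finset ι} {i : ι} :
    i ∈ Q.supp z J ↔ i ∈ J ∧ Q.sol z (J.erase i) ≠ Q.sol z J := by
  simp [supp]

/-- No constraint is tight at a minimizer in whose definition it does not take part. -/
def Generic (z : ι → Z) : Prop :=
  ∀ (B : Finset ι) (j : ι), j ∉ B → Q.normal (z j) ⬝ᵥ Q.sol z B ≠ Q.level (z j)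

/-- In the generic case a minimal basis consists of all support constraints: the constraints
outside another basis are not tight, so they could be removed from the minimal one. -/
theorem Generic.supp_spec {Q : ConvexScenario n Z} [DecidableEq ι] {z : ι → Z} (hz : Q.Generic z)
    (J : Finset ι) : (Q.supp z J).card ≤ n ∧ Q.sol z (Q.supp z J) = Q.sol z J := by
  classical
  let T := J.powerset.filter fun B => B.card ≤ n ∧ Q.sol z B = Q.sol z J
  have hT : T.Nonempty := by
    obtain ⟨B, hB, h⟩ := Q.exists_basis z J
    exact ⟨B, Finset.mem_filter.2 ⟨Finset.mem_powerset.2 hB, h⟩⟩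
  obtain ⟨B, hB, hmin⟩ := T.exists_min_image Finset.card hT
  obtain ⟨hBJ, hBc, hBs⟩ := Finset.mem_filter.1 hB
  rw [Finset.mem_powerset] at hBJ
  suffices h : Q.supp z J = B by rw [h]; exact ⟨hBc, hBs⟩
  ext i
  rw [mem_supp]
  constructor
  · rintro ⟨hi, hne⟩
    by_contra hiB
    exact hne (Q.sol_eq_of_between (Finset.subset_erase.2 ⟨hBJ, hiB⟩) (Finset.erase_subset _ _) hBs)
  · intro hi
    refine ⟨hBJ hi, fun he => ?_⟩
    obtain ⟨B', hB', -, hs'⟩ := Q.exists_basis z (J.erase i)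
    have hi' : i ∉ B' := fun h => Finset.notMem_erase i J (hB' h)
    have hne := hz B' i hi'
    rw [hs', he, ← hBs] at hne
    have hlt : Q.level (z i) < Q.normal (z i) ⬝ᵥ Q.sol z B :=
      lt_of_le_of_ne ((Q.sol_mem z B).2 i hi) (Ne.symm hne)
    have hmem : B.erase i ∈ T := by
      refine Finset.mem_filter.2 ⟨Finset.mem_powerset.2 ((Finset.erase_subset _ _).trans hBJ),
        (Finset.card_le_card (Finset.erase_subset _ _)).trans hBc, ?_⟩
      rw [Q.sol_erase_of_lt hlt, hBs]
    exact absurd (hmin _ hmem) (not_le.2 (Finset.card_erase_lt_of_mem hi))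

/-- A constraint is compatible with `n` given constraints if their minimizer satisfies it and
if its mark is below the marks of those of them that are not support constraints. -/
def Compatible (t : Fin n → Z) (z' : Z) : Prop :=
  Q.level z' ≤ Q.normal z' ⬝ᵥ Q.sol t Finset.univ ∧
    ∀ i, Q.sol t (Finset.univ.erase i) = Q.sol t Finset.univ → Q.mark z' < Q.mark (t i)

theorem compatible_subtuple {M : ℕ} (I : {I : Finset (Fin M) // I.card = n}) (z : Fin M → Z)
    (z' : Z) : Q.Compatible (subtuple I z) z' ↔
      Q.level z' ≤ Q.normal z' ⬝ᵥ Q.sol z I ∧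
        ∀ i ∈ I.1, Q.sol z (I.1.erase i) = Q.sol z I → Q.mark z' < Q.mark (z i) := by
  set e := (I.1.orderEmbOfFin I.2).toEmbedding with he
  have hmap : Finset.univ.map e = I.1 := by
    simp [he]
  have h1 : Q.sol (subtuple I z) Finset.univ = Q.sol z I := by
    have := Q.sol_comp z e Finset.univ
    rwa [hmap] at this
  have h2 : ∀ i, Q.sol (subtuple I z) (Finset.univ.erase i) = Q.sol z (I.1.erase (e i)) := by
    intro i
    have := Q.sol_comp z e (Finset.univ.erase i)
    rwa [Finset.map_erase, hmap] at this
  rw [Compatible, h1]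
  refine and_congr_right fun _ => ⟨fun h i hi hs => ?_, fun h i hs => ?_⟩
  · rw [← hmap, Finset.mem_map] at hi
    obtain ⟨k, -, rfl⟩ := hi
    exact h k (by rw [h2, hs])
  · refine h (e i) ?_ (by rw [← h2, hs])
    rw [← hmap]
    exact Finset.mem_map_of_mem _ (Finset.mem_univ i)

/-- Exactness of the compression: the only compatible `n`-set consists of the support constraints
and of the remaining constraints with the largest marks. -/
theorem existsUnique_compatible {M : ℕ} (hM : n ≤ M) {z : Fin M → Z} (hz : Q.Generic z)
    (hmark : Function.Injective fun i => Q.mark (z i)) :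
    ∃! I : {I : Finset (Fin M) // I.card = n}, ∀ j ∉ I.1, Q.Compatible (subtuple I z) (z j) := by
  classical
  set B := Q.supp z Finset.univ with hB
  obtain ⟨hBc, hBs⟩ := hz.supp_spec Finset.univ
  have hsub : ∀ I : Finset (Fin M), Q.sol z I = Q.sol z Finset.univ → B ⊆ I := by
    intro I hI i hi
    by_contra hiI
    exact (Q.mem_supp.1 hi).2 (Q.sol_eq_of_between
      (Finset.subset_erase.2 ⟨Finset.subset_univ I, hiI⟩) (Finset.subset_univ _) hI)
  have hsol : ∀ I : Finset (Fin M), B ⊆ I → Q.sol z I = Q.sol z Finset.univ := fun I hI =>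
    Q.sol_eq_of_between hI (Finset.subset_univ I) hBs
  have herase : ∀ I : Finset (Fin M), B ⊆ I → ∀ i ∈ I,
      (Q.sol z (I.erase i) = Q.sol z I ↔ i ∉ B) := by
    intro I hI i _
    rw [hsol I hI]
    constructor
    · intro h hi
      exact Finset.notMem_erase i I (hsub _ h hi)
    · intro hi
      exact hsol _ (Finset.subset_erase.2 ⟨hI, hi⟩)
  -- the characterization of compatible sets
  have hchar : ∀ I : {I : Finset (Fin M) // I.card = n},
      (∀ j ∉ I.1, Q.Compatible (subtuple I z) (z j)) ↔
        B ⊆ I.1 ∧ ∀ j ∉ I.1, ∀ i ∈ I.1, i ∉ B → Q.mark (z j) < Q.mark (z i) := by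
    intro I
    simp only [compatible_subtuple]
    constructor
    · intro h
      have hmem : Q.sol z I.1 ∈ Q.feas z Finset.univ := by
        refine ⟨(Q.sol_mem z I.1).1, fun j _ => ?_⟩
        by_cases hj : j ∈ I.1
        · exact (Q.sol_mem z I.1).2 j hj
        · exact (h j hj).1
      have hBI := hsub I.1 (Q.sol_eq_of_mem (Finset.subset_univ _) hmem).symm
      exact ⟨hBI, fun j hj i hi hiB => (h j hj).2 i hi ((herase I.1 hBI i hi).2 hiB)⟩
    · rintro ⟨hBI, h⟩ j hj
      refine ⟨?_, fun i hi hs => h j hj i hi ((herase I.1 hBI i hi).1 hs)⟩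
      rw [hsol I.1 hBI]
      exact (Q.sol_mem z Finset.univ).2 j (Finset.mem_univ j)
  let T := (Finset.univ.powersetCard n).filter fun I : Finset (Fin M) => B ⊆ I
  have hT : T.Nonempty := by
    obtain ⟨I, hI, -, hc⟩ := Finset.exists_subsuperset_card_eq (Finset.subset_univ B) hBc
      (by simpa using hM)
    exact ⟨I, Finset.mem_filter.2 ⟨Finset.mem_powersetCard.2 ⟨Finset.subset_univ _, hc⟩, hI⟩⟩
  obtain ⟨I, hI, hmax⟩ := T.exists_max_image (fun I => ∑ i ∈ I, Q.mark (z i)) hT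
  obtain ⟨hI1, hBI⟩ := Finset.mem_filter.1 hI
  have hIc := (Finset.mem_powersetCard.1 hI1).2
  have h : ∀ j ∉ I, ∀ i ∈ I, i ∉ B → Q.mark (z j) < Q.mark (z i) := by
    intro j hj i hi hiB
    -- otherwise exchanging `i` for `j` would increase the sum of the marks
    by_contra hlt
    have hji : j ≠ i := fun h => hj (h ▸ hi)
    have hlt' : Q.mark (z i) < Q.mark (z j) :=
      lt_of_le_of_ne (not_lt.1 hlt) fun h => hji (hmark h).symm
    have hje : j ∉ I.erase i := fun h => hj (Finset.mem_of_mem_erase h)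
    have hmem : insert j (I.erase i) ∈ T := by
      refine Finset.mem_filter.2 ⟨Finset.mem_powersetCard.2 ⟨Finset.subset_univ _, ?_⟩, ?_⟩
      · rw [Finset.card_insert_of_notMem hje, Finset.card_erase_add_one hi, hIc]
      · exact (Finset.subset_erase.2 ⟨hBI, hiB⟩).trans (Finset.subset_insert _ _)
    have h1 := hmax _ hmem
    rw [Finset.sum_insert hje] at h1
    have h2 := Finset.add_sum_erase I (fun i => Q.mark (z i)) hi
    linarith
  refine ⟨⟨I, hIc⟩, (hchar _).2 ⟨hBI, h⟩, fun I' hI' => ?_⟩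
  obtain ⟨hBI', h'⟩ := (hchar I').1 hI'
  have hss : I ⊆ I'.1 := by
    intro i hi
    by_contra hi'
    have hne : ¬ I'.1 ⊆ I := fun hs =>
      hi' (Finset.eq_of_subset_of_card_le hs (by rw [hIc, I'.2]) ▸ hi)
    obtain ⟨i', h1, h2⟩ := Finset.not_subset.1 hne
    exact lt_asymm (h i' h2 i hi fun hB' => hi' (hBI' hB'))
      (h' i hi' i' h1 fun hB' => h2 (hBI hB'))
  exact Subtype.ext (Finset.eq_of_subset_of_card_le hss (by rw [hIc, I'.2])).symm

end ConvexScenario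

/-! ### The exact violation probability in the nondegenerate case -/

/-- A set is null as soon as its sections in one coordinate are null. -/
theorem measure_pi_eq_zero_of_update {ι Z : Type*} [Fintype ι] [DecidableEq ι] [MeasurableSpace Z]
    (ν : Measure Z) [IsProbabilityMeasure ν] {s : Set (ι → Z)} (hs : MeasurableSet s) (j : ι)
    (h : ∀ z, ν {z' | Function.update z j z' ∈ s} = 0) : Measure.pi (fun _ : ι => ν) s = 0 := by
  have hne : Nonempty Z := by
    by_contra hZ
    rw [not_nonempty_iff] at hZ
    have := measure_univ (μ := ν)
    simp [univ_eq_empty_iff.2 hZ] at this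
  obtain ⟨z₀⟩ := hne
  rw [← lintegral_indicator_one hs, lintegral_eq_lmarginal_univ (fun _ => z₀),
    lmarginal_erase' _ (measurable_one.indicator hs) (Finset.mem_univ j)]
  have : (fun x : ι → Z => ∫⁻ z', s.indicator (1 : (ι → Z) → ENNReal) (Function.update x j z') ∂ν) =
      fun _ => 0 := by
    funext x
    have hm : MeasurableSet {z' | Function.update x j z' ∈ s} :=
      (measurable_update x) hs
    rw [← h x, ← lintegral_indicator_one hm]
    rfl
  rw [this]
  simp [lmarginal]

namespace ConvexScenario

variable {n : ℕ} {Z : Type*} [MeasurableSpace Z] (Q : ConvexScenario n Z)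

/-- The data for which some point of the compact set `K` satisfies the constraints in `J` form a
closed set, as a projection along a compact factor. -/
theorem isClosed_exists_feasible {ι : Type*} (J : Finset ι) {K : Set (Fin n → ℝ)}
    (hK : IsCompact K) :
    IsClosed {d : ι → (Fin n → ℝ) × ℝ | ∃ x ∈ K, ∀ j ∈ J, (d j).2 ≤ (d j).1 ⬝ᵥ x} := by
  have : CompactSpace K := isCompact_iff_compactSpace.1 hK
  let E : Set (K × (ι → (Fin n → ℝ) × ℝ)) :=
    {p | ∀ j ∈ J, (p.2 j).2 ≤ (p.2 j).1 ⬝ᵥ (p.1 : Fin n → ℝ)}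
  have hE : IsClosed E := by
    have : E = ⋂ j ∈ J, {p | (p.2 j).2 ≤ (p.2 j).1 ⬝ᵥ (p.1 : Fin n → ℝ)} := by
      ext; simp [E]
    rw [this]
    refine isClosed_biInter fun j _ => isClosed_le (by fun_prop) ?_
    exact continuous_finsetSum _ fun i _ => ((continuous_apply i).comp (continuous_fst.comp
      ((continuous_apply j).comp continuous_snd))).mul
        ((continuous_apply i).comp (continuous_subtype_val.comp continuous_fst))
  convert isClosedMap_snd_of_compactSpace _ hE using 1
  ext d
  constructor
  · rintro ⟨x, hx, h⟩
    exact ⟨(⟨x, hx⟩, d), h, rfl⟩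
  · rintro ⟨⟨x, d'⟩, h, rfl⟩
    exact ⟨x, x.2, h⟩

/-- The minimizer depends measurably on the constraints: it lies in a closed set `C` if and only if
every rational sublevel that contains a feasible point contains one in `C`. -/
theorem measurable_sol {ι : Type*} [Countable ι] (J : Finset ι) :
    Measurable fun z : ι → Z => Q.sol z J := by
  refine measurable_of_isClosed fun C hC => ?_
  let K : Set (Fin n → ℝ) → ℚ → Set (Fin n → ℝ) := fun C r => (Q.dom ∩ C) ∩ {x | Q.obj x ≤ r}
  have hK : ∀ C, IsClosed C → ∀ r, IsCompact (K C r) := fun C hC r =>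
    (Q.isCompact_dom.inter_right hC).inter_right (isClosed_le Q.continuous_obj continuous_const)
  let D : (ι → Z) → ι → (Fin n → ℝ) × ℝ := fun z j => (Q.normal (z j), Q.level (z j))
  have hD : Measurable D := by
    refine measurable_pi_lambda _ fun j => ?_
    exact (Q.measurable_normal.comp (measurable_pi_apply j)).prodMk
      (Q.measurable_level.comp (measurable_pi_apply j))
  let U : Set (Fin n → ℝ) → ℚ → Set (ι → Z) := fun C r =>
    D ⁻¹' {d | ∃ x ∈ K C r, ∀ j ∈ J, (d j).2 ≤ (d j).1 ⬝ᵥ x}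
  have hU : ∀ C, IsClosed C → ∀ r, MeasurableSet (U C r) := fun C hC r =>
    hD (isClosed_exists_feasible J (hK C hC r)).measurableSet
  have hset : (fun z => Q.sol z J) ⁻¹' C = ⋂ r : ℚ, (U univ r)ᶜ ∪ U C r := by
    ext z
    simp only [mem_preimage, mem_iInter, mem_union, mem_compl_iff]
    constructor
    · intro h r
      by_cases hr : z ∈ U univ r
      · right
        obtain ⟨x, hx, hxJ⟩ := hr
        exact ⟨Q.sol z J, ⟨⟨(Q.sol_mem z J).1, h⟩,
          (Q.obj_sol_le ⟨hx.1.1, hxJ⟩).trans hx.2⟩, (Q.sol_mem z J).2⟩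
      · exact Or.inl hr
    · intro h
      have hex : ∀ r : ℚ, Q.obj (Q.sol z J) < r → ∃ x ∈ Q.feas z J ∩ C, Q.obj x ≤ r := by
        intro r hr
        rcases h r with h | ⟨x, hx, hxJ⟩
        · exact absurd ⟨Q.sol z J, ⟨⟨(Q.sol_mem z J).1, mem_univ _⟩, hr.le⟩,
            (Q.sol_mem z J).2⟩ h
        · exact ⟨x, ⟨⟨hx.1.1, hxJ⟩, hx.1.2⟩, hx.2⟩
      obtain ⟨r₀, hr₀⟩ := exists_rat_gt (Q.obj (Q.sol z J))
      obtain ⟨x₀, hx₀, -⟩ := hex r₀ hr₀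
      obtain ⟨x, hx, hmin⟩ := ((Q.isCompact_feas z J).inter_right hC).exists_isMinOn ⟨x₀, hx₀⟩
        Q.continuous_obj.continuousOn
      have hle : Q.obj x ≤ Q.obj (Q.sol z J) := by
        refine le_of_forall_gt_imp_ge_of_dense fun s hs => ?_
        obtain ⟨r, hr1, hr2⟩ := exists_rat_btwn hs
        obtain ⟨y, hy, hyr⟩ := hex r hr1
        exact (hmin hy).trans (hyr.trans hr2.le)
      rw [← Q.eq_sol hx.1 hle]
      exact hx.2
  rw [hset]
  exact MeasurableSet.iInter fun r => (hU _ isClosed_univ r).compl.union (hU _ hC r)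

theorem measurable_normal_dotProduct {T : Type*} [MeasurableSpace T] {f : T → Z}
    {x : T → Fin n → ℝ} (hf : Measurable f) (hx : Measurable x) :
    Measurable fun t => Q.normal (f t) ⬝ᵥ x t := by
  unfold dotProduct
  exact Finset.measurable_sum _ fun i _ =>
    ((measurable_pi_apply i).comp (Q.measurable_normal.comp hf)).mul
      ((measurable_pi_apply i).comp hx)

theorem measurableSet_compatible :
    MeasurableSet {x : (Fin n → Z) × Z | Q.Compatible x.1 x.2} := by
  have hsol : ∀ J : Finset (Fin n), Measurable fun x : (Fin n → Z) × Z => Q.sol x.1 J := fun J =>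
    (Q.measurable_sol J).comp measurable_fst
  refine (measurableSet_le (Q.measurable_level.comp measurable_snd)
    (Q.measurable_normal_dotProduct measurable_snd (hsol _))).inter ?_
  have : {x : (Fin n → Z) × Z | ∀ i, Q.sol x.1 (Finset.univ.erase i) = Q.sol x.1 Finset.univ →
      Q.mark x.2 < Q.mark (x.1 i)} = ⋂ i,
      {x | Q.sol x.1 (Finset.univ.erase i) = Q.sol x.1 Finset.univ}ᶜ ∪
        {x | Q.mark x.2 < Q.mark (x.1 i)} := by
    ext x
    simp [imp_iff_not_or]
  change MeasurableSet {x : (Fin n → Z) × Z | ∀ i, Q.sol x.1 (Finset.univ.erase i) =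
    Q.sol x.1 Finset.univ → Q.mark x.2 < Q.mark (x.1 i)}
  rw [this]
  refine MeasurableSet.iInter fun i => ((measurableSet_eq_fun (hsol _) (hsol _)).compl).union ?_
  exact measurableSet_lt (Q.measurable_mark.comp measurable_snd)
    (Q.measurable_mark.comp ((measurable_pi_apply i).comp measurable_fst))

variable (ν : Measure Z) [IsProbabilityMeasure ν]

theorem ae_generic (htight : ∀ x : Fin n → ℝ, ν {z | Q.normal z ⬝ᵥ x = Q.level z} = 0) (M : ℕ) :
    ∀ᵐ z ∂(Measure.pi fun _ : Fin M => ν), Q.Generic z := by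
  simp only [Generic, ae_all_iff]
  intro B j hj
  have hs : MeasurableSet {z : Fin M → Z | Q.normal (z j) ⬝ᵥ Q.sol z B = Q.level (z j)} :=
    measurableSet_eq_fun (Q.measurable_normal_dotProduct (measurable_pi_apply j)
      (Q.measurable_sol B)) (Q.measurable_level.comp (measurable_pi_apply j))
  have h0 := measure_pi_eq_zero_of_update ν hs j fun z => by
    simp only [mem_ofPred_eq, Function.update_self, Q.sol_update z hj]
    exact htight (Q.sol z B)
  rw [measure_eq_zero_iff_ae_notMem] at h0
  exact h0

theorem ae_injective_mark (hmark : ∀ c : ℝ, ν {z | Q.mark z = c} = 0) (M : ℕ) :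
    ∀ᵐ z ∂(Measure.pi fun _ : Fin M => ν), Function.Injective fun i => Q.mark (z i) := by
  have : ∀ i j : Fin M, i ≠ j →
      ∀ᵐ z ∂(Measure.pi fun _ : Fin M => ν), Q.mark (z i) ≠ Q.mark (z j) := by
    intro i j hij
    have hs : MeasurableSet {z : Fin M → Z | Q.mark (z i) = Q.mark (z j)} :=
      measurableSet_eq_fun (Q.measurable_mark.comp (measurable_pi_apply i))
        (Q.measurable_mark.comp (measurable_pi_apply j))
    have h0 := measure_pi_eq_zero_of_update ν hs i fun z => by
      simp only [mem_ofPred_eq, Function.update_self, Function.update_of_ne hij.symm]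
      exact hmark _
    rw [measure_eq_zero_iff_ae_notMem] at h0
    exact h0
  have h2 : ∀ᵐ z ∂(Measure.pi fun _ : Fin M => ν), ∀ i j : Fin M, i ≠ j →
      Q.mark (z i) ≠ Q.mark (z j) := by
    simp only [ae_all_iff]
    exact this
  filter_upwards [h2] with z hz i j hij
  by_contra hne
  exact hz i j hne hij

end ConvexScenario

/-- In the nondegenerate case, the probability that the violation of the minimizer exceeds `ε` is
at most a binomial tail. -/
theorem ConvexScenario.measure_violation_le {m : ℕ} {Z : Type*} [MeasurableSpace Z]
    (Q : ConvexScenario (m + 1) Z) (ν : Measure Z) [IsProbabilityMeasure ν]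
    (htight : ∀ x : Fin (m + 1) → ℝ, ν {z | Q.normal z ⬝ᵥ x = Q.level z} = 0)
    (hmark : ∀ c : ℝ, ν {z | Q.mark z = c} = 0) {N : ℕ} (hN : m + 1 ≤ N) {ε : ℝ} (h0 : 0 ≤ ε)
    (h1 : ε ≤ 1) :
    (Measure.pi fun _ : Fin N => ν)
      {z | ε < ν.real {z' | Q.normal z' ⬝ᵥ Q.sol z Finset.univ < Q.level z'}} ≤
      ENNReal.ofReal (binomTail (m + 1) N ε) := by
  have hex : ∀ M : ℕ, m + 1 ≤ M → ∀ᵐ z ∂(Measure.pi fun _ : Fin M => ν),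
      ∃! I : {I : Finset (Fin M) // I.card = m + 1},
        ∀ j ∉ I.1, Q.Compatible (subtuple I z) (z j) := by
    intro M hM
    filter_upwards [Q.ae_generic ν htight M, Q.ae_injective_mark ν hmark M] with z hz hz'
    exact Q.existsUnique_compatible hM hz hz'
  refine (measure_mono_ae ?_).trans
    (measure_compression_le ν Q.measurableSet_compatible hex hN h0 h1)
  filter_upwards [hex N hN] with z hz hviol
  obtain ⟨I, hI, -⟩ := hz
  refine ⟨I, hI, lt_of_lt_of_le hviol (measureReal_mono fun z' hz' hc => ?_)⟩
  have hsol : Q.sol z Finset.univ = Q.sol z I := by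
    refine Q.sol_eq_of_mem (Finset.subset_univ _) ⟨(Q.sol_mem z I.1).1, fun j _ => ?_⟩
    by_cases hj : j ∈ I.1
    · exact (Q.sol_mem z I.1).2 j hj
    · exact ((Q.compatible_subtuple I z (z j)).1 (hI j hj)).1
  have h2 := ((Q.compatible_subtuple I z z').1 hc).1
  rw [← hsol] at h2
  exact absurd h2 (not_le.2 hz')

/-! ### The scenario bound for degenerate programs -/

/-- Fatou's lemma for sets. -/
theorem eventually_lt_measure {α : Type*} [MeasurableSpace α] {μ : Measure α} {S : ℕ → Set α}
    {T : Set α} (h : ∀ x ∈ T, ∀ᶠ k in Filter.atTop, x ∈ S k) {c : ENNReal} (hc : c < μ T) :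
    ∀ᶠ k in Filter.atTop, c < μ (S k) := by
  have hsub : T ⊆ ⋃ m : ℕ, ⋂ k ≥ m, S k := fun x hx => by
    obtain ⟨m, hm⟩ := Filter.eventually_atTop.1 (h x hx)
    exact mem_iUnion.2 ⟨m, mem_iInter₂.2 hm⟩
  have hmono : Monotone fun m : ℕ => ⋂ k ≥ m, S k := fun m m' hm =>
    biInter_subset_biInter_left fun k hk => le_trans hm hk
  have h1 := hc.trans_le (measure_mono hsub)
  rw [hmono.measure_iUnion] at h1
  obtain ⟨m, hm⟩ := lt_iSup_iff.1 h1
  exact Filter.eventually_atTop.2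
    ⟨m, fun k hk => hm.trans_le (measure_mono (biInter_subset_of_mem hk))⟩

theorem ae_pi_forall {N : ℕ} {Y : Type*} [MeasurableSpace Y] {μ : Measure Y}
    [IsProbabilityMeasure μ] {p : Y → Prop} (h : ∀ᵐ y ∂μ, p y) :
    ∀ᵐ ω ∂(Measure.pi fun _ : Fin N => μ), ∀ j, p (ω j) := by
  rw [ae_all_iff]
  intro j
  exact (measurePreserving_eval (fun _ : Fin N => μ) j).quasiMeasurePreserving.ae h

theorem strictConvexOn_linear_add_sq {n : ℕ} (c : Fin n → ℝ) {δ : ℝ} (hδ : 0 < δ) :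
    StrictConvexOn ℝ univ fun x : Fin n → ℝ => x ⬝ᵥ c + δ * (x ⬝ᵥ x) := by
  refine ⟨convex_univ, fun x _ y _ hxy s t hs ht hst => ?_⟩
  have hpos : 0 < (x - y) ⬝ᵥ (x - y) := by
    refine lt_of_le_of_ne (Finset.sum_nonneg fun i _ => mul_self_nonneg _) fun h => ?_
    exact hxy (sub_eq_zero.1 (dotProduct_self_eq_zero.1 h.symm))
  have h1 : 0 < δ * (s * t * ((x - y) ⬝ᵥ (x - y))) := by positivity
  obtain rfl : t = 1 - s := by linarith
  simp only [sub_dotProduct, dotProduct_sub, add_dotProduct, dotProduct_add, smul_dotProduct,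
    dotProduct_smul, smul_eq_mul, dotProduct_comm y x] at h1 ⊢
  linarith

section

variable {n : ℕ} {Y : Type*} [MeasurableSpace Y] {dom : Set (Fin n → ℝ)}
  (hdom : IsCompact dom) (hconv : Convex ℝ dom) (c : Fin n → ℝ)
  {a : Y → Fin n → ℝ} (ha : Measurable a) {b : Y → ℝ} (hb : Measurable b)
  {x₀ : Fin n → ℝ} (hx₀ : x₀ ∈ dom)

theorem measurable_dotProduct_const (ha : Measurable a) (x : Fin n → ℝ) :
    Measurable fun y => a y ⬝ᵥ x := by
  unfold dotProduct
  exact Finset.measurable_sum _ fun i _ => ((measurable_pi_apply i).comp ha).mul_const _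

/-- A nondegenerate perturbation of a linear program with random constraints: the level of the
constraint `y` is relaxed by `δ |u|`, with a random mark `u`, and a multiple of the squared
Euclidean norm is added to the objective. -/
def perturbedScenario (δ : ℝ) (hδ : 0 < δ) : ConvexScenario n (Y × ℝ) where
  dom := dom
  isCompact_dom := hdom
  convex_dom := hconv
  obj := fun x => x ⬝ᵥ c + δ * (x ⬝ᵥ x)
  continuous_obj := by unfold dotProduct; fun_prop
  strictConvexOn_obj := strictConvexOn_linear_add_sq c hδ
  normal := fun p => a p.1
  measurable_normal := ha.comp measurable_fst
  level := fun p => min (b p.1) (a p.1 ⬝ᵥ x₀) - δ * |p.2|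
  measurable_level := ((hb.min (measurable_dotProduct_const ha x₀)).comp measurable_fst).sub
    ((measurable_snd.abs).const_mul δ)
  center := x₀
  center_mem := hx₀
  level_le := fun p => by
    have h1 := min_le_right (b p.1) (a p.1 ⬝ᵥ x₀)
    have h2 : 0 ≤ δ * |p.2| := by positivity
    linarith
  mark := fun p => p.2
  measurable_mark := measurable_snd

variable (μ : Measure Y)

/-- The uniform distribution on the unit interval, as a measure on `ℝ`. -/
def unitLaw : Measure ℝ := volume.restrict (Icc 0 1)

instance : IsProbabilityMeasure unitLaw := ⟨by simp [unitLaw]⟩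

theorem unitLaw_eq_zero {s : Set ℝ} (hs : s.Countable) : unitLaw s = 0 :=
  nonpos_iff_eq_zero.1 ((Measure.restrict_apply_le _ s).trans (hs.measure_zero volume).le)

theorem perturbedScenario_tight (δ : ℝ) (hδ : 0 < δ) (x : Fin n → ℝ) :
    (μ.prod unitLaw) {p | (perturbedScenario hdom hconv c ha hb hx₀ δ hδ).normal p ⬝ᵥ x =
      (perturbedScenario hdom hconv c ha hb hx₀ δ hδ).level p} = 0 := by
  set Q := perturbedScenario hdom hconv c ha hb hx₀ δ hδ with hQ
  have hs : MeasurableSet {p | Q.normal p ⬝ᵥ x = Q.level p} :=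
    measurableSet_eq_fun (measurable_dotProduct_const Q.measurable_normal x) Q.measurable_level
  rw [Measure.measure_prod_null hs]
  refine Filter.Eventually.of_forall fun y => unitLaw_eq_zero ?_
  set r := (min (b y) (a y ⬝ᵥ x₀) - a y ⬝ᵥ x) / δ with hr
  refine ((countable_singleton (-r)).insert r).mono fun u hu => ?_
  have hu' : a y ⬝ᵥ x = min (b y) (a y ⬝ᵥ x₀) - δ * |u| := hu
  have h1 : |u| = r := by rw [hr, eq_div_iff hδ.ne']; linarith
  rcases abs_choice u with h | h
  · exact Or.inl (by rw [← h1, h])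
  · exact Or.inr (by rw [mem_singleton_iff, ← h1, h, neg_neg])

theorem prod_unitLaw_mark (r : ℝ) : (μ.prod unitLaw) {p : Y × ℝ | p.2 = r} = 0 := by
  have : {p : Y × ℝ | p.2 = r} = univ ×ˢ {r} := by ext; simp
  rw [this, Measure.prod_prod, unitLaw_eq_zero (countable_singleton r), mul_zero]

/-- If the unperturbed program has the unique minimizer `x`, the minimizers of the perturbed
programs converge to `x` as the perturbation vanishes. -/
theorem tendsto_perturbedScenario_sol {N : ℕ} (z : Fin N → Y × ℝ)
    (hz : ∀ j, b (z j).1 ≤ a (z j).1 ⬝ᵥ x₀) {x : Fin n → ℝ} (hxd : x ∈ dom)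
    (hxf : ∀ j, b (z j).1 ≤ a (z j).1 ⬝ᵥ x)
    (hx : ∀ x' ∈ dom, (∀ j, b (z j).1 ≤ a (z j).1 ⬝ᵥ x') → x' ≠ x → x ⬝ᵥ c < x' ⬝ᵥ c) :
    Filter.Tendsto (fun k : ℕ => (perturbedScenario hdom hconv c ha hb hx₀ (1 / ((k : ℝ) + 1))
      (by positivity)).sol z Finset.univ) Filter.atTop (nhds x) := by
  set Q : ℕ → ConvexScenario n (Y × ℝ) := fun k =>
    perturbedScenario hdom hconv c ha hb hx₀ (1 / ((k : ℝ) + 1)) (by positivity) with hQ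
  set s : ℕ → Fin n → ℝ := fun k => (Q k).sol z Finset.univ with hs
  have hmem : ∀ k, s k ∈ (Q k).feas z Finset.univ := fun k => (Q k).sol_mem z _
  refine hdom.tendsto_nhds_of_unique_mapClusterPt
    (Filter.Eventually.of_forall fun k => (hmem k).1) fun x' hx' hcl => ?_
  obtain ⟨φ, hφ, hlim⟩ := hcl.tendsto_subseq
  have h0 : Filter.Tendsto (fun k => 1 / ((φ k : ℝ) + 1)) Filter.atTop (nhds 0) :=
    tendsto_one_div_add_atTop_nhds_zero_nat.comp hφ.tendsto_atTop
  by_contra hne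
  refine absurd (hx x' hx' (fun j => ?_) hne) (not_lt.2 ?_)
  · have h1 : ∀ k, b (z j).1 - 1 / ((φ k : ℝ) + 1) * |(z j).2| ≤ a (z j).1 ⬝ᵥ s (φ k) := fun k => by
      have := (hmem (φ k)).2 j (Finset.mem_univ j)
      change min (b (z j).1) (a (z j).1 ⬝ᵥ x₀) - 1 / ((φ k : ℝ) + 1) * |(z j).2| ≤ _ at this
      rwa [min_eq_left (hz j)] at this
    have h2 := (h0.mul_const |(z j).2|).const_sub (b (z j).1)
    rw [zero_mul, sub_zero] at h2
    exact le_of_tendsto_of_tendsto' h2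
      (((ConvexScenario.continuous_dotProduct_right _).tendsto x').comp hlim) h1
  · have h1 : ∀ k, s (φ k) ⬝ᵥ c ≤ x ⬝ᵥ c + 1 / ((φ k : ℝ) + 1) * (x ⬝ᵥ x) := fun k => by
      have hxk : x ∈ (Q (φ k)).feas z Finset.univ := by
        refine ⟨hxd, fun j _ => ?_⟩
        change min (b (z j).1) (a (z j).1 ⬝ᵥ x₀) - 1 / ((φ k : ℝ) + 1) * |(z j).2| ≤
          a (z j).1 ⬝ᵥ x
        have h1 := min_le_left (b (z j).1) (a (z j).1 ⬝ᵥ x₀)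
        have h2 : 0 ≤ 1 / ((φ k : ℝ) + 1) * |(z j).2| := by positivity
        linarith [hxf j]
      have h2 : s (φ k) ⬝ᵥ c + 1 / ((φ k : ℝ) + 1) * (s (φ k) ⬝ᵥ s (φ k)) ≤
        x ⬝ᵥ c + 1 / ((φ k : ℝ) + 1) * (x ⬝ᵥ x) := (Q (φ k)).obj_sol_le hxk
      have h3 : 0 ≤ 1 / ((φ k : ℝ) + 1) * (s (φ k) ⬝ᵥ s (φ k)) :=
        mul_nonneg (by positivity) (Finset.sum_nonneg fun i _ => mul_self_nonneg _)
      linarith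
    have h2 := (h0.mul_const (x ⬝ᵥ x)).const_add (x ⬝ᵥ c)
    rw [zero_mul, add_zero] at h2
    have hc : Continuous fun x : Fin n → ℝ => x ⬝ᵥ c := by unfold dotProduct; fun_prop
    exact le_of_tendsto_of_tendsto' ((hc.tendsto x').comp hlim) h2 h1

end

/-- The scenario bound: the probability that the violation probability of the minimizer exceeds
`ε` is at most a binomial tail. The program is approximated by nondegenerate ones. The minimizers
converge, and by Fatou's lemma the violation probabilities do not drop in the limit. -/
theorem measure_lt_violation_le {n : ℕ} (hn : 1 ≤ n) {Y : Type*} [MeasurableSpace Y]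
    {dom : Set (Fin n → ℝ)} (hdom : IsCompact dom) (hconv : Convex ℝ dom) (c : Fin n → ℝ)
    {a : Y → Fin n → ℝ} (ha : Measurable a) {b : Y → ℝ} (hb : Measurable b)
    {x₀ : Fin n → ℝ} (hx₀ : x₀ ∈ dom) (μ : Measure Y) [IsProbabilityMeasure μ]
    (hfeas : ∀ᵐ y ∂μ, b y ≤ a y ⬝ᵥ x₀) {N : ℕ} {xopt : (Fin N → Y) → Fin n → ℝ}
    (hopt : ∀ᵐ ω ∂(Measure.pi fun _ : Fin N => μ), xopt ω ∈ dom ∧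
      (∀ j, b (ω j) ≤ a (ω j) ⬝ᵥ xopt ω) ∧
      ∀ x ∈ dom, (∀ j, b (ω j) ≤ a (ω j) ⬝ᵥ x) → x ≠ xopt ω → xopt ω ⬝ᵥ c < x ⬝ᵥ c)
    {ε : ℝ} (h0 : 0 ≤ ε) (h1 : ε ≤ 1) :
    (Measure.pi fun _ : Fin N => μ) {ω | ε < μ.real {y | a y ⬝ᵥ xopt ω < b y}} ≤
      ENNReal.ofReal (binomTail n N ε) := by
  rcases lt_or_ge N n with hN | hN
  · rw [binomTail_eq_one hN, ENNReal.ofReal_one]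
    exact prob_le_one
  obtain ⟨m, rfl⟩ : ∃ m, n = m + 1 := ⟨n - 1, by omega⟩
  let ν := μ.prod unitLaw
  let Q : ℕ → ConvexScenario (m + 1) (Y × ℝ) := fun k =>
    perturbedScenario hdom hconv c ha hb hx₀ (1 / ((k : ℝ) + 1)) (by positivity)
  let V : ℕ → (Fin (m + 1) → ℝ) → Set (Y × ℝ) := fun k x =>
    {p | (Q k).normal p ⬝ᵥ x < (Q k).level p}
  let S : ℕ → Set (Fin N → Y × ℝ) := fun k => {z | ε < ν.real (V k ((Q k).sol z Finset.univ))}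
  have hS : ∀ k, (Measure.pi fun _ : Fin N => ν) (S k) ≤
      ENNReal.ofReal (binomTail (m + 1) N ε) := fun k =>
    (Q k).measure_violation_le ν (perturbedScenario_tight hdom hconv c ha hb hx₀ μ _ _)
      (prod_unitLaw_mark μ) hN h0 h1
  let T : Set (Fin N → Y) := {ω | ε < μ.real {y | a y ⬝ᵥ xopt ω < b y} ∧
    (∀ j, b (ω j) ≤ a (ω j) ⬝ᵥ x₀) ∧ xopt ω ∈ dom ∧
      (∀ j, b (ω j) ≤ a (ω j) ⬝ᵥ xopt ω) ∧
      ∀ x ∈ dom, (∀ j, b (ω j) ≤ a (ω j) ⬝ᵥ x) → x ≠ xopt ω → xopt ω ⬝ᵥ c < x ⬝ᵥ c}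
  have hlift : ∀ z : Fin N → Y × ℝ, (fun j => (z j).1) ∈ T → ∀ᶠ k in Filter.atTop, z ∈ S k := by
    rintro z ⟨hε, hz, hxd, hxf, hx⟩
    set x := xopt fun j => (z j).1 with hxdef
    have hlim := tendsto_perturbedScenario_sol hdom hconv c ha hb hx₀ z hz hxd hxf hx
    let W : Set (Y × ℝ) := {y | a y ⬝ᵥ x < b y ∧ b y ≤ a y ⬝ᵥ x₀} ×ˢ univ
    have hW : ENNReal.ofReal ε < ν W := by
      have e1 : ν W = μ {y | a y ⬝ᵥ x < b y} := by
        rw [Measure.prod_prod, measure_univ, mul_one]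
        refine measure_congr ?_
        filter_upwards [hfeas] with y hy
        exact propext ⟨fun h => h.1, fun h => ⟨h, hy⟩⟩
      rw [e1]
      exact (ENNReal.ofReal_lt_iff_lt_toReal h0 (measure_ne_top _ _)).2 hε
    have hev : ∀ p ∈ W, ∀ᶠ k in Filter.atTop, p ∈ V k ((Q k).sol z Finset.univ) := by
      rintro ⟨y, u⟩ ⟨⟨hy, hy'⟩, -⟩
      have h2 : Filter.Tendsto (fun k : ℕ => a y ⬝ᵥ (Q k).sol z Finset.univ +
          1 / ((k : ℝ) + 1) * |u|) Filter.atTop (nhds (a y ⬝ᵥ x + 0 * |u|)) :=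
        (((ConvexScenario.continuous_dotProduct_right _).tendsto x).comp hlim).add
          (tendsto_one_div_add_atTop_nhds_zero_nat.mul_const _)
      rw [zero_mul, add_zero] at h2
      filter_upwards [h2.eventually (gt_mem_nhds hy)] with k hk
      change a y ⬝ᵥ _ < min (b y) (a y ⬝ᵥ x₀) - 1 / ((k : ℝ) + 1) * |u|
      rw [min_eq_left hy']
      linarith
    filter_upwards [eventually_lt_measure hev hW] with k hk
    exact (ENNReal.ofReal_lt_iff_lt_toReal h0 (measure_ne_top _ _)).1 hk
  -- sections in the marks are all of `ℝ`, so the product measure computes the outer measure of `T`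
  have hT : (Measure.pi fun _ : Fin N => ν) {z | (fun j => (z j).1) ∈ T} =
      (Measure.pi fun _ : Fin N => μ) T := by
    have hmp := measurePreserving_arrowProdEquivProdArrow Y ℝ (Fin N) (fun _ => μ)
      (fun _ => unitLaw)
    have h2 := hmp.measure_preimage_equiv (T ×ˢ univ)
    rw [Measure.prod_prod, measure_univ, mul_one] at h2
    rw [← h2]
    congr 1
    ext z
    simp [MeasurableEquiv.arrowProdEquivProdArrow, Equiv.arrowProdEquivProdArrow]
  calc (Measure.pi fun _ : Fin N => μ) {ω | ε < μ.real {y | a y ⬝ᵥ xopt ω < b y}}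
      ≤ (Measure.pi fun _ : Fin N => μ) T := by
        refine measure_mono_ae ?_
        filter_upwards [hopt, ae_pi_forall hfeas] with ω h2 h3 h4
        exact ⟨h4, h3, h2⟩
    _ = _ := hT.symm
    _ ≤ _ := by
        by_contra hcon
        obtain ⟨k, hk⟩ := (eventually_lt_measure hlift (not_le.1 hcon)).exists
        exact absurd (hS k) (not_le.2 hk)

/-- At a positive level the strict inequality may be replaced by a weak one, by continuity of the
tail in the level. The number of samples may exceed the minimal one. -/
theorem measure_le_violation_le {n : ℕ} (hn : 1 ≤ n) {Y : Type*} [MeasurableSpace Y]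
    {dom : Set (Fin n → ℝ)} (hdom : IsCompact dom) (hconv : Convex ℝ dom) (c : Fin n → ℝ)
    {a : Y → Fin n → ℝ} (ha : Measurable a) {b : Y → ℝ} (hb : Measurable b)
    {x₀ : Fin n → ℝ} (hx₀ : x₀ ∈ dom) (μ : Measure Y) [IsProbabilityMeasure μ]
    (hfeas : ∀ᵐ y ∂μ, b y ≤ a y ⬝ᵥ x₀) {N : ℕ} {xopt : (Fin N → Y) → Fin n → ℝ}
    (hopt : ∀ᵐ ω ∂(Measure.pi fun _ : Fin N => μ), xopt ω ∈ dom ∧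
      (∀ j, b (ω j) ≤ a (ω j) ⬝ᵥ xopt ω) ∧
      ∀ x ∈ dom, (∀ j, b (ω j) ≤ a (ω j) ⬝ᵥ x) → x ≠ xopt ω → xopt ω ⬝ᵥ c < x ⬝ᵥ c)
    {ε β : ℝ} (h0 : 0 ≤ ε) (h1 : ε ≤ 1) (hβ : β < 1)
    (hN : sampleBound n ε β ≤ (N : ℕ∞)) :
    (Measure.pi fun _ : Fin N => μ) {ω | ε ≤ μ.real {y | a y ⬝ᵥ xopt ω < b y}} ≤
      ENNReal.ofReal β := by
  have htail : binomTail n N ε ≤ β := by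
    set A := {N : ℕ | binomTail n N ε ≤ β} with hA
    have hne : A.Nonempty := by
      by_contra hemp
      rw [not_nonempty_iff_eq_empty] at hemp
      have : sampleBound n ε β = ⊤ := by
        change sInf ((fun N : ℕ => (N : ℕ∞)) '' A) = ⊤
        rw [hemp, image_empty, sInf_empty]
      rw [this] at hN
      exact absurd hN (by simp)
    have hmem : sampleBound n ε β ∈ (fun N : ℕ => (N : ℕ∞)) '' A := csInf_mem (hne.image _)
    obtain ⟨N₀, hN₀, he⟩ := hmem
    have hN' : (N₀ : ℕ∞) ≤ N := le_of_eq_of_le he hN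
    exact (binomTail_antitone n h0 h1 (by exact_mod_cast hN' : N₀ ≤ N)).trans hN₀
  rcases h0.eq_or_lt with rfl | hpos
  · rw [binomTail_zero hn] at htail
    linarith
  have hlim : Filter.Tendsto (fun s => ENNReal.ofReal (binomTail n N s)) (nhdsWithin ε (Iio ε))
      (nhds (ENNReal.ofReal (binomTail n N ε))) :=
    (ENNReal.continuous_ofReal.comp (continuous_binomTail n N)).continuousAt.tendsto.mono_left
      nhdsWithin_le_nhds
  refine (ge_of_tendsto hlim ?_).trans (ENNReal.ofReal_le_ofReal htail)
  filter_upwards [Ioo_mem_nhdsLT hpos] with s hs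
  refine (measure_mono fun ω hω => ?_).trans (measure_lt_violation_le hn hdom hconv c ha hb hx₀ μ
    hfeas hopt hs.1.le (hs.2.le.trans h1))
  exact lt_of_lt_of_le hs.2 hω

/-! ### Error bounds for the scenario program -/

namespace InfiniteLP

variable {X C B Y : Type*}
  [NormedAddCommGroup X] [NormedSpace ℝ X] [AddCommGroup C] [Module ℝ C]
  [NormedAddCommGroup B] [NormedSpace ℝ B] [AddCommGroup Y] [Module ℝ Y]
  (P : InfiniteLP X C B Y) {S : Discretization X} {n : ℕ}

theorem AnAdj_dot_lt_iff {α : Fin n → ℝ} {y : Y} :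
    P.AnAdj S n y ⬝ᵥ α < P.pB.pairing P.b y ↔ 0 < P.pB.pairing (P.b - P.An S n α) y := by
  rw [map_sub, LinearMap.sub_apply, pairing_An, sub_pos, dotProduct_comm]

section Probability

variable [MeasurableSpace Y] (μ : Measure Y)

/-- The probability that a random constraint is violated at `α`. -/
def violation (S : Discretization X) (n : ℕ) (α : Fin n → ℝ) : ℝ :=
  μ.real {y | P.AnAdj S n y ⬝ᵥ α < P.pB.pairing P.b y}

/-- A tail bound controls the largest violation of a point with small violation probability. -/
theorem IsTailBound.supportFun_le {P : InfiniteLP X C B Y} {μ : Measure Y}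
    {h : (Fin n → ℝ) → ℝ → ℝ} (hh : P.IsTailBound S n μ h) {α : Fin n → ℝ} {ε : ℝ}
    (h0 : 0 ≤ ε) (h1 : ε < 1) (hV : P.violation μ S n α ≤ ε) :
    max (P.supportFun (P.b - P.An S n α)) 0 ≤ h α ε := by
  obtain ⟨hnn, hle⟩ := hh α ε h0 h1
  refine max_le ?_ hnn
  rcases le_total (P.supportFun (P.b - P.An S n α)) 0 with hs | hs
  · exact hs.trans hnn
  refine hle _ hs (le_of_eq_of_le ?_ hV)
  rw [tailProb, violation, neg_add_eq_sub]
  congr 1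
  ext y
  simp only [mem_ofPred_eq, AnAdj_dot_lt_iff, lt_add_iff_pos_left]

/-- If the violation of `α` costs more than `ε`, it is attained up to `ε` on a dual-norm ball of
radius `z_n ε` around an extreme ray, and all constraints in this ball are violated. -/
theorem IsBallBound.le_violation {P : InfiniteLP X C B Y} {μ : Measure Y}
    [IsProbabilityMeasure μ] {g : ℝ → ℝ} (hg : P.IsBallBound μ g) {γ JLB : ℝ}
    (hθ : 0 ≤ P.θD S n γ JLB) {α : Fin n → ℝ} (hα : α ∈ S.ball n) {ε : ℝ} (hε : 0 < ε)
    (h : ε < P.θD S n γ JLB * max (P.supportFun (P.b - P.An S n α)) 0) :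
    g (P.zn S n γ JLB * ε) ≤ P.violation μ S n α := by
  set θ := P.θD S n γ JLB with hθdef
  set v := P.b - P.An S n α with hv
  set q := S.θP n * S.ratio n * ‖P.A‖ + ‖P.b‖ with hq
  have hθ0 : 0 < θ := by
    refine lt_of_le_of_ne hθ fun h0 => ?_
    rw [← h0, zero_mul] at h
    linarith
  have hmax : ε / θ < max (P.supportFun v) 0 := by
    rw [div_lt_iff₀ hθ0]; linarith
  have hσ : ε / θ < P.supportFun v := by
    rcases lt_max_iff.1 hmax with h1 | h1
    · exact h1
    · have : 0 < ε / θ := by positivity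
      linarith
  have hne : ((fun y => P.pB.pairing v y) '' P.extremeRays).Nonempty := by
    by_contra hemp
    rw [not_nonempty_iff_eq_empty] at hemp
    rw [supportFun, hemp, Real.sSup_empty] at hσ
    have : 0 < ε / θ := by positivity
    linarith
  obtain ⟨_, ⟨κ, hκ, rfl⟩, hlt⟩ := exists_lt_of_lt_csSup hne hσ
  have hlt' : ε / θ < P.pB.pairing v κ := hlt
  have hvq : ‖v‖ ≤ q := by
    have h1 := norm_sub_le P.b (P.An S n α)
    have h2 := P.norm_An_le S n α
    have h3 := S.sum_abs_le n α
    have h4 : S.R n α * S.ratio n ≤ S.θP n * S.ratio n :=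
      mul_le_mul_of_nonneg_right hα (S.ratio_nonneg n)
    have h5 := mul_le_mul_of_nonneg_right (h3.trans h4) (norm_nonneg P.A)
    linarith
  have hq0 : 0 < q := by
    refine lt_of_lt_of_le (norm_pos_iff.2 fun hv0 => ?_) hvq
    rw [hv0, map_zero, LinearMap.zero_apply] at hlt'
    have : 0 < ε / θ := by positivity
    linarith
  have hz : P.zn S n γ JLB = (θ * q)⁻¹ := rfl
  refine (hg.2.2 κ hκ (P.zn S n γ JLB * ε) (by rw [hz]; positivity)).trans
    (measureReal_mono fun y hy => ?_)
  have hy' : P.pB.dualNorm (y - κ) < P.zn S n γ JLB * ε := hy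
  change P.AnAdj S n y ⬝ᵥ α < P.pB.pairing P.b y
  rw [AnAdj_dot_lt_iff, ← hv]
  have h1 := (abs_le.1 (P.pB.abs_pairing_le v (y - κ))).1
  rw [map_sub] at h1
  have h2 : ‖v‖ * P.pB.dualNorm (y - κ) ≤ q * (P.zn S n γ JLB * ε) :=
    mul_le_mul hvq hy'.le (P.pB.dualNorm_nonneg _) hq0.le
  have h3 : q * (P.zn S n γ JLB * ε) = ε / θ := by rw [hz]; field_simp
  linarith

/-- The scenario bound for the minimizers of the sampled programs. -/
theorem measure_violation_le (hmeas : ∀ v : B, Measurable fun y : Y => P.pB.pairing v y)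
    (hn : 1 ≤ n) {γ : ℝ} (hreg : P.IsRegular S n γ) [IsProbabilityMeasure μ]
    (hμ : ∀ᵐ y ∂μ, y ∈ P.extremeRays) {N : ℕ} {αN : (Fin N → Y) → Fin n → ℝ}
    (hαN : ∀ᵐ ω ∂(Measure.pi fun _ : Fin N => μ), P.IsUniqueScenarioOptimizer S n ω (αN ω))
    {ε β : ℝ} (h0 : 0 ≤ ε) (h1 : ε ≤ 1) (hβ : β < 1) (hN : sampleBound n ε β ≤ (N : ℕ∞)) :
    (Measure.pi fun _ : Fin N => μ) {ω | ε ≤ P.violation μ S n (αN ω)} ≤ ENNReal.ofReal β := by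
  obtain ⟨x₀, hx₀⟩ := hreg.feasible
  refine measure_le_violation_le hn (S.isCompact_ball n) (S.convex_ball n) (P.cvec S n)
    (a := fun y => P.AnAdj S n y) (measurable_pi_lambda _ fun i => hmeas _)
    (b := fun y => P.pB.pairing P.b y) (hmeas _) hx₀.2 μ ?_ ?_ h0 h1 hβ hN
  · filter_upwards [hμ] with y hy
    rw [dotProduct_comm]
    exact P.le_dot_AnAdj hx₀ hy
  · filter_upwards [hαN] with ω hω
    refine ⟨hω.1.2, fun j => ?_, fun x hx hxf hne => hω.2 x ⟨fun j => ?_, hx⟩ hne⟩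
    · rw [dotProduct_comm]
      exact hω.1.1 j
    · rw [dotProduct_comm]
      exact hxf j

end Probability

end InfiniteLP

theorem mul_rpow_neg_inv_le {K ε d : ℝ} (hK : 0 ≤ K) (hε : 0 < ε) (hd : 0 < d) {n : ℕ}
    (hn : 1 ≤ n) (h : (K * ε⁻¹) ^ d ≤ (n : ℝ)) : K * (n : ℝ) ^ (-1 / d) ≤ ε := by
  have hx : 0 ≤ K * ε⁻¹ := by positivity
  have hn0 : (0 : ℝ) < n := by exact_mod_cast hn
  have h1 : K * ε⁻¹ ≤ (n : ℝ) ^ (1 / d) := by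
    have := Real.rpow_le_rpow (by positivity) h (by positivity : 0 ≤ 1 / d)
    rwa [← Real.rpow_mul hx, mul_one_div_cancel hd.ne', Real.rpow_one] at this
  rw [neg_div, Real.rpow_neg hn0.le, ← div_eq_mul_inv, div_le_iff₀ (by positivity)]
  rwa [← div_eq_mul_inv, div_le_iff₀ hε, mul_comm] at h1

end

theorem mainTheorem4 {X C B Y : Type*}
    [NormedAddCommGroup X] [NormedSpace ℝ X] [AddCommGroup C] [Module ℝ C]
    [NormedAddCommGroup B] [NormedSpace ℝ B] [AddCommGroup Y] [Module ℝ Y]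
    [MeasurableSpace Y]
    -- the infinite program, an optimizer, and the finite dimensional subspaces
    (P : InfiniteLP X C B Y)
    (hmeas : ∀ v : B, Measurable fun y : Y => P.pB.pairing v y)
    (xstar : X) (hxstar : P.IsOptimizer xstar)
    (S : Discretization X)
    -- the residuals of the projections of the optimizer
    (d D : ℝ) (hd : 0 < d)
    (proj : ℕ → X) (hproj : ∀ m : ℕ, 1 ≤ m → IsProjection (S.ballX m) xstar (proj m))
    (hres : ∀ m : ℕ, 1 ≤ m → ‖xstar - proj m‖ ≤ D * (m : ℝ) ^ (-1 / d))
    -- regularity of the semi-infinite program, and a lower bound on its value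
    (n : ℕ) (hn : 1 ≤ n) (γ : ℝ) (hreg : P.IsRegular S n γ)
    (JLB : ℝ) (hJLB : JLB ≤ P.semiValue S n)
    -- the scenario program
    (hgen : P.GeneratedByExtremeRays)
    (μ : Measure Y) [IsProbabilityMeasure μ] (hμ : ∀ᵐ y ∂μ, y ∈ P.extremeRays)
    (N : ℕ) (αN : (Fin N → Y) → Fin n → ℝ)
    (hαN : ∀ᵐ ω ∂(Measure.pi fun _ : Fin N => μ), P.IsUniqueScenarioOptimizer S n ω (αN ω))
    (β : ℝ) (hβ0 : 0 < β) (hβ1 : β < 1)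
    -- the smoothing algorithm
    (prox : Y → ℝ) (hprox : P.IsProx (P.θD S n γ JLB) prox)
    (ystar : ℝ → (Fin n → ℝ) → Y)
    (hystar : ∀ s : ℝ, 0 < s → ∀ α ∈ S.ball n,
      P.IsProxMaximizer S n (P.θD S n γ JLB) prox s α (ystar s α))
    (η L ϑ : ℝ) (hη : 0 < η) (hL : 0 < L) (hϑ : 0 < ϑ)
    (hLip : ∀ α ∈ S.ball n, ∀ α' ∈ S.ball n,
      S.dualR n (P.AnAdj S n (ystar η α) - P.AnAdj S n (ystar η α')) ≤ L / η * S.R n (α - α'))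
    (hsc : StrongConvexWrt (S.R n) univ ϑ (fun α => 1 / 2 * S.R n α ^ 2))
    (w z a : ℕ → Fin n → ℝ) (halg : P.IsAlgorithmRun S n (ystar η) η L ϑ w z a) (k : ℕ) :
    -- the two-sided bound: the (outer) probability that it fails is at most `β`
    (∀ (ε : ℝ) (h : (Fin n → ℝ) → ℝ → ℝ), 0 < ε → ε < 1 → P.IsTailBound S n μ h →
      sampleBound n ε β ≤ (N : ℕ∞) →
      (Measure.pi fun _ : Fin N => μ) {ω | ¬
        (max (P.scenarioValue S n ω) (P.lowerValue S n (weightedMean (fun j => ystar η (w j)) k))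
            - D * (P.pX.dualNorm P.c + P.θD S n γ JLB * ‖P.A‖) * (n : ℝ) ^ (-1 / d) ≤ P.value ∧
          P.value ≤ min (P.upperValue S n (P.θD S n γ JLB) (a k))
            (P.scenarioValue S n ω + P.θD S n γ JLB * h (αN ω) ε))} ≤ ENNReal.ofReal β) ∧
    -- the a priori bound
    (∀ ε : ℝ, 0 < ε →
      (D * (P.pX.dualNorm P.c + P.θD S n γ JLB * ‖P.A‖) * ε⁻¹) ^ d ≤ (n : ℝ) →
      ((∃ g : ℝ → ℝ, P.IsBallBound μ g ∧
          sampleBound n (g (P.zn S n γ JLB * ε)) β ≤ (N : ℕ∞)) ∨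
        (∃ c₀ C₀ : ℝ, 0 < c₀ ∧ 0 < C₀ ∧
          (∀ s : ℝ, 0 < s → ∀ α ∈ S.ball n,
            prox (ystar s α) ≤ C₀ * max (Real.log (c₀ * s⁻¹)) 1) ∧
          η ≤ ε / (2 * C₀ * max (2 * Real.log (2 * c₀ * C₀ * ε⁻¹)) 1) ∧
          5 * S.θP n * Real.sqrt (L / (ϑ * η * ε)) ≤ (k : ℝ))) →
      (Measure.pi fun _ : Fin N => μ) {ω | ¬
        min |P.value - P.scenarioValue S n ω|
          |P.value - P.lowerValue S n (weightedMean (fun j => ystar η (w j)) k)| ≤ ε} ≤ ENNReal.ofReal β) := by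
  have hθ := InfiniteLP.θD_nonneg hreg hJLB
  set θ := P.θD S n γ JLB with hθdef
  have hD : 0 ≤ D := by
    have := (norm_nonneg _).trans (hres 1 le_rfl)
    simpa using this
  set G := P.pX.dualNorm P.c + θ * ‖P.A‖ with hG
  have hG0 : 0 ≤ G := add_nonneg (P.pX.dualNorm_nonneg _) (by positivity)
  have hw := halg.w_mem
  -- the deterministic estimates
  have hJn : P.value ≤ P.semiValue S n := P.value_le_semiValue hxstar hreg
  have happrox : P.semiValue S n ≤ P.value + D * G * (n : ℝ) ^ (-1 / d) := by
    have h1 := P.semiValue_le_value hxstar hreg hJLB (hproj n hn).1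
    have h2 := mul_le_mul_of_nonneg_left (hres n hn) hG0
    linarith
  have hLB : P.lowerValue S n (weightedMean (fun j => ystar η (w j)) k) ≤ P.semiValue S n :=
    P.lowerValue_le_semiValue hreg
      (InfiniteLP.weightedMean_mem (fun j => (hystar η hη _ (hw j)).1.1) k)
  have hUB : P.semiValue S n ≤ P.upperValue S n θ (a k) :=
    P.semiValue_le_upperValue hreg hJLB (halg.step_a k).1
  -- the estimates for almost every sample
  have hgood : ∀ᵐ ω ∂(Measure.pi fun _ : Fin N => μ), αN ω ∈ S.ball n ∧
      P.scenarioValue S n ω ≤ P.semiValue S n ∧ P.semiValue S n ≤ P.scenarioValue S n ω +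
        θ * max (P.supportFun (P.b - P.An S n (αN ω))) 0 := by
    filter_upwards [hαN, ae_pi_forall hμ] with ω h1 h2
    exact ⟨h1.1.2, P.scenarioValue_le_semiValue hreg h2,
      P.semiValue_le_scenarioValue hreg hJLB hgen h1⟩
  refine ⟨fun ε h hε0 hε1 hh hN => ?_, fun ε hε hnε hab => ?_⟩
  · refine (measure_mono_ae ?_).trans
      (P.measure_violation_le μ hmeas hn hreg hμ hαN hε0.le hε1.le hβ1 hN)
    filter_upwards [hgood] with ω ⟨_, h2, h3⟩ hfail
    by_contra hV
    refine hfail ⟨?_, le_min (hJn.trans hUB) ?_⟩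
    · rw [sub_le_iff_le_add]
      exact (max_le h2 hLB).trans happrox
    · have h4 := mul_le_mul_of_nonneg_left (hh.supportFun_le hε0.le hε1 (not_le.1 hV).le) hθ
      linarith
  · have hacc : P.semiValue S n ≤ P.value + ε :=
      happrox.trans (add_le_add_right (mul_rpow_neg_inv_le (by positivity) hε hd hn hnε) _)
    rcases hab with ⟨g, hg, hN⟩ | ⟨c₀, C₀, hc₀, hC₀, hlog, hηε, hk⟩
    · have hz : 0 ≤ P.zn S n γ JLB * ε := by
        have := S.ratio_nonneg n
        have := hreg.θP_pos
        rw [InfiniteLP.zn, ← hθdef]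
        positivity
      obtain ⟨hg0, hg1⟩ := hg.2.1 _ hz
      refine (measure_mono_ae ?_).trans
        (P.measure_violation_le μ hmeas hn hreg hμ hαN hg0 hg1 hβ1 hN)
      filter_upwards [hgood] with ω ⟨h1, h2, h3⟩ hfail
      by_contra hV
      refine hfail (min_le_iff.2 (Or.inl ?_))
      have h4 : θ * max (P.supportFun (P.b - P.An S n (αN ω))) 0 ≤ ε := by
        by_contra hcon
        exact hV (hg.le_violation hθ h1 hε (not_le.1 hcon))
      rw [abs_le]
      constructor <;> linarith
    · have hgap := halg.upperValue_le hn hreg.θP_pos hη hL hϑ hprox.1 hystar hLip hsc hc₀ hC₀ hε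
        hlog hηε hk
      have hempty : {ω : Fin N → Y | ¬ min |P.value - P.scenarioValue S n ω|
          |P.value - P.lowerValue S n (weightedMean (fun j => ystar η (w j)) k)| ≤ ε} = ∅ := by
        refine eq_empty_iff_forall_notMem.2 fun ω hω => hω (min_le_iff.2 (Or.inr ?_))
        rw [abs_le]
        constructor <;> linarith
      rw [hempty, measure_empty]
      exact zero_le
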